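/- Let $d\in\{2,3\}$ and let $\Omega\subset\mathbb{R}^d$ be a polyhedral domain (connected, and the interior of a finite union of closed simplices). Let $c\in L^\infty(\Omega)$ and $\boldsymbol\beta\in W^{1,\infty}(\Omega;\mathbb{R}^d)$, with $\boldsymbol\beta$ continuous on $\overline\Omega$, and suppose that $\boldsymbol\beta\cdot\nabla\psi\ge b_0>0$ a.e. in $\Omega$ for some $\psi\in W^{1,\infty}(\Omega)$ and some constant $b_0$, and that $c-\tfrac12\nabla\cdot\boldsymbol\beta\ge 0$ a.e. in $\Omega$. Fix an integer $k\ge 0$. For a conforming triangulation $\mathcal{T}_h$ of $\Omega$ by finitely many simplices, set $h_K=|K|^{1/d}$ for a cell $K$, $h=\max_K h_K$, and $h_F=|F|^{1/(d-1)}$ for a face $F$; let $\mathcal{E}_h^\partial$ be the set of faces contained in $\partial\Omega$, and $\boldsymbol n$ the unit outward normal. We call $\mathcal{T}_h$ shape regular with constant $\sigma$ if every $K$ contains a ball of some radius $r>0$ with $\operatorname{diam}K\le\sigma r$, and quasi-uniform with constant $\rho$ if $h\le\rho h_K$ for all $K$. Let $\mathcal{U}_h=\boldsymbol Q_h\times W_h$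 with $$\boldsymbol Q_h=\{\boldsymbol p\in H(\mathrm{div},\Omega):\boldsymbol p|_K\in P_{k+1}(K;\mathbb{R}^d)+\boldsymbol x P_{k+1}(K)\ \forall K\},\qquad W_h=\{w\in H^1(\Omega):w|_K\in P_{k+1}(K)\ \forall K\},$$ where $P_m(K)$ denotes the polynomials of total degree at most $m$ on $K$. For $0<\epsilon\le1$ let $$a_\epsilon((\boldsymbol q,u),(\boldsymbol p,w))=(\boldsymbol q+\epsilon^{1/2}\nabla u,\boldsymbol p+\epsilon^{1/2}\nabla w)_\Omega+(\epsilon^{1/2}\nabla\cdot\boldsymbol q+\boldsymbol\beta\cdot\nabla u+cu,\ \epsilon^{1/2}\nabla\cdot\boldsymbol p+\boldsymbol\beta\cdot\nabla w+cw)_\Omega+\sum_{F\in\mathcal{E}_h^\partial}h_F^{-1}\langle(\epsilon+\max(-\boldsymbol\beta\cdot\boldsymbol n,0))u,w\rangle_F .$$ For a basis $b=(b_i)$ of $\mathcal{U}_h$ let $A=(a_\epsilon(b_j,b_i))_{ij}$ be the stiffness matrix of the first order least squares method, $M=((b_j,b_i)_{L^2(\Omega;\mathbb{R}^d)\times L^2(\Omega)})_{ij}$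 the mass matrix, and write $\kappa(B)=\|B\|_2\|B^{-1}\|_2$ for the spectral condition number. (i) For all $\sigma,\rho$ there is a constant $C>0$, depending only on $d,\Omega,\boldsymbol\beta,c,k,\sigma,\rho$ (and not on $\epsilon$, $h$, the mesh or the basis), such that for every $\epsilon\in(0,1]$, every conforming triangulation of $\Omega$ that is shape regular with constant $\sigma$ and quasi-uniform with constant $\rho$, and every basis of $\mathcal{U}_h$, the matrices $A$ and $M$ are symmetric positive definite and $$\kappa(A)\le C\,h^{-2}\,\kappa(M).$$ In particular $\kappa(A)\le C'h^{-2}$ for bases whose mass matrices have bounded condition numbers, such as $L^2$-orthonormal ones. (ii) Let $S_1,\dots,S_n$ be linearly independent polynomial vector fields and $R_1,\dots,R_m$ linearly independent polynomials on the reference simplex, and let $\tau>0$. For all $\sigma,\rho$ there is a constant $C>0$, depending only on these data and on $d,\Omega,\boldsymbol\beta,c,k,\sigma,\rho$ (and not on $\epsilon$, $h$ or the mesh), such that for all $\epsilon$ and $\mathcal{T}_h$ as in (i) and every finite element basis $b$ of $\mathcal{U}_h$ assembled from these shape functions, $A$ is symmetric positive definite and $$\kappa(A)\le C\,h^{-2}.$$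 Here each cell $K$ carries an ordering of its vertices, and $F_K$ is the affine map of the reference simplex onto $K$ that respects it. The basis $b$ is assembled from the shape functions if on each cell $K$ exactly $n+m$ of the $b_i$, numbered by $K$, may be nonzero, namely $(t\,(DF_K S_a)\circ F_K^{-1},0)$ for $a=1,\dots,n$, with scalars $t=t_{K,a}$ such that $\tau^{-1}\le h|t|\le\tau$, and $(0,R_a\circ F_K^{-1})$ for $a=1,\dots,m$; and the cells numbering a given $b_i$ have a common vertex. -/

import Mathlib

open MeasureTheory
open scoped ENNReal MeasureTheory

noncomputable section

namespace LeastSquaresFEM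

/-- `ℝ^d` with the Euclidean norm. -/
abbrev E (d : ℕ) : Type := EuclideanSpace ℝ (Fin d)

/-! ### Weak derivatives on an open set -/

/-- Test functions `φ ∈ C_c^∞(Ω)`. -/
def IsTestFunction {d : ℕ} (Ω : Set (E d)) (φ : E d → ℝ) : Prop :=
  ContDiff ℝ (⊤ : ℕ∞) φ ∧ HasCompactSupport φ ∧ tsupport φ ⊆ Ω

/-- The classical partial derivative `∂_i φ`. -/
def partialDeriv {d : ℕ} (i : Fin d) (φ : E d → ℝ) (x : E d) : ℝ :=
  fderiv ℝ φ x (EuclideanSpace.single i 1)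

/-- `g` is the weak partial derivative `∂_i f` on `Ω`. -/
def HasWeakPartial {d : ℕ} (Ω : Set (E d)) (i : Fin d) (f g : E d → ℝ) : Prop :=
  LocallyIntegrableOn f Ω ∧ LocallyIntegrableOn g Ω ∧
    ∀ φ, IsTestFunction Ω φ →
      ∫ x in Ω, f x * partialDeriv i φ x = - ∫ x in Ω, g x * φ x

/-- `g` is the weak divergence of the vector field `f` on `Ω`. -/
def HasWeakDiv {d : ℕ} (Ω : Set (E d)) (f : E d → E d) (g : E d → ℝ) : Prop :=
  LocallyIntegrableOn f Ω ∧ LocallyIntegrableOn g Ω ∧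
    ∀ φ, IsTestFunction Ω φ →
      ∫ x in Ω, ∑ i, f x i * partialDeriv i φ x = - ∫ x in Ω, g x * φ x

/-- `f ∈ H¹(Ω)`. -/
def MemH1 {d : ℕ} (Ω : Set (E d)) (f : E d → ℝ) : Prop :=
  MemLp f 2 (volume.restrict Ω) ∧
    ∀ i, ∃ g, MemLp g 2 (volume.restrict Ω) ∧ HasWeakPartial Ω i f g

/-- `f ∈ H(div, Ω)`. -/
def MemHdiv {d : ℕ} (Ω : Set (E d)) (f : E d → E d) : Prop :=
  MemLp f 2 (volume.restrict Ω) ∧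
    ∃ g, MemLp g 2 (volume.restrict Ω) ∧ HasWeakDiv Ω f g

/-- `f ∈ W^{1,∞}(Ω)` with weak gradient `(Df 0, …, Df (d-1))`. -/
def MemW1Infty {d : ℕ} (Ω : Set (E d)) (f : E d → ℝ) (Df : Fin d → E d → ℝ) : Prop :=
  MemLp f ∞ (volume.restrict Ω) ∧
    ∀ i, MemLp (Df i) ∞ (volume.restrict Ω) ∧ HasWeakPartial Ω i f (Df i)

/-- The assumptions on the coefficients: `c ∈ L^∞(Ω)`, `β ∈ W^{1,∞}(Ω; ℝ^d)` (its continuous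
representative on the closure of `Ω`, which gives `β · n` a meaning on the boundary),
`β · ∇ψ ≥ b₀ > 0` in `Ω` for some `ψ ∈ W^{1,∞}(Ω)`, and `c - (1/2) ∇ · β ≥ 0` in `Ω`. -/
structure IsAdmissible {d : ℕ} (Ω : Set (E d)) (β : E d → E d) (c : E d → ℝ) : Prop where
  c_mem : MemLp c ∞ (volume.restrict Ω)
  continuousOn : ContinuousOn β (closure Ω)
  exists_psi : ∃ (ψ : E d → ℝ) (Dψ : Fin d → E d → ℝ) (b₀ : ℝ), MemW1Infty Ω ψ Dψ ∧ 0 < b₀ ∧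
    ∀ᵐ x ∂(volume.restrict Ω), b₀ ≤ ∑ i, β x i * Dψ i x
  exists_jacobian : ∃ Dβ : Fin d → Fin d → E d → ℝ,
    (∀ j, MemW1Infty Ω (fun x => β x j) (Dβ j)) ∧
    ∀ᵐ x ∂(volume.restrict Ω), 0 ≤ c x - (1 / 2) * ∑ i, Dβ i i x

/-! ### Meshes -/

/-- A finite conforming simplicial mesh: the intersection of two cells is the convex hull of their
common vertices. A cell carries an ordering of its vertices, and no simplex occurs twice. -/
structure Mesh (d : ℕ) where
  cells : Finset (Affine.Simplex ℝ (E d) d)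
  injOn : Set.InjOn (fun K : Affine.Simplex ℝ (E d) d => Set.range K.points) cells
  conforming : ∀ K ∈ cells, ∀ K' ∈ cells,
    K.closedInterior ∩ K'.closedInterior =
      convexHull ℝ (Set.range K.points ∩ Set.range K'.points)

/-- The closed set covered by the mesh. -/
def Mesh.space {d : ℕ} (T : Mesh d) : Set (E d) :=
  ⋃ K ∈ T.cells, K.closedInterior

/-- `T` is a triangulation of the (hence polyhedral) open set `Ω`. -/
def Mesh.Triangulates {d : ℕ} (T : Mesh d) (Ω : Set (E d)) : Prop :=
  Ω = interior T.space

/-- `h_K = |K|^{1/d}`. -/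
def cellSize {d : ℕ} (K : Affine.Simplex ℝ (E d) d) : ℝ :=
  (volume.real K.closedInterior) ^ ((d : ℝ)⁻¹)

/-- The mesh size `h = max_K h_K`. -/
def Mesh.h {d : ℕ} (T : Mesh d) : ℝ := ⨆ K : T.cells, cellSize K.1

/-- Shape regularity with constant `σ`: every cell contains a ball of radius `r` with
`diam K ≤ σ r`. -/
def Mesh.ShapeRegular {d : ℕ} (T : Mesh d) (σ : ℝ) : Prop :=
  ∀ K ∈ T.cells, ∃ (x : E d) (r : ℝ), 0 < r ∧ Metric.ball x r ⊆ K.closedInterior ∧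
    Metric.diam K.closedInterior ≤ σ * r

/-- Quasi-uniformity with constant `ρ`: `h ≤ ρ h_K` for every cell. -/
def Mesh.QuasiUniform {d : ℕ} (T : Mesh d) (ρ : ℝ) : Prop :=
  ∀ K ∈ T.cells, T.h ≤ ρ * cellSize K

/-- The closed face of `K` opposite to the vertex `i`. -/
def face {d : ℕ} [NeZero d] (K : Affine.Simplex ℝ (E d) d) (i : Fin (d + 1)) : Set (E d) :=
  (K.faceOpposite i).closedInterior

/-- `h_F = |F|^{1/(d-1)}`, where `|F|` is the `(d-1)`-dimensional Lebesgue measure. -/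
def faceSize {d : ℕ} [NeZero d] (K : Affine.Simplex ℝ (E d) d) (i : Fin (d + 1)) : ℝ :=
  ((μHE[d - 1] : Measure (E d)).real (face K i)) ^ (((d : ℝ) - 1)⁻¹)

/-- The unit normal to the face of `K` opposite to the vertex `i`, pointing out of `K`: the
direction from that vertex to the foot of its altitude. -/
def outwardNormal {d : ℕ} [NeZero d] (K : Affine.Simplex ℝ (E d) d) (i : Fin (d + 1)) : E d :=
  (K.height i)⁻¹ • (K.altitudeFoot i - K.points i)

open Classical in
/-- The boundary faces, each given by its (unique) cell `K` and the vertex of `K` opposite to it. -/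
def Mesh.boundaryFaces {d : ℕ} [NeZero d] (T : Mesh d) (Ω : Set (E d)) :
    Finset (T.cells × Fin (d + 1)) :=
  Finset.univ.filter fun F => face F.1.1 F.2 ⊆ frontier Ω

/-! ### Piecewise polynomials and the finite element space -/

/-- Polynomials in `d` variables. -/
abbrev Poly (d : ℕ) : Type := MvPolynomial (Fin d) ℝ

/-- The value of a polynomial at a point of `ℝ^d`. -/
def Poly.val {d : ℕ} (f : Poly d) (x : E d) : ℝ := MvPolynomial.eval (fun i => x i) f

/-- The value of a vector of polynomials at a point of `ℝ^d`. -/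
def vecVal {d : ℕ} (f : Fin d → Poly d) (x : E d) : E d :=
  WithLp.toLp 2 fun i => Poly.val (f i) x

/-- The gradient of a polynomial at a point. -/
def gradVal {d : ℕ} (f : Poly d) (x : E d) : E d :=
  WithLp.toLp 2 fun i => Poly.val (MvPolynomial.pderiv i f) x

/-- The divergence of a vector of polynomials at a point. -/
def divVal {d : ℕ} (f : Fin d → Poly d) (x : E d) : ℝ :=
  ∑ i, Poly.val (MvPolynomial.pderiv i (f i)) x

/-- The function on `ℝ^d` (defined up to the null set of cell boundaries) that is `f K` on
each cell `K`. -/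
def Mesh.glue {d : ℕ} (T : Mesh d) {F : Type} [AddCommMonoid F] (f : T.cells → E d → F)
    (x : E d) : F :=
  ∑ K : T.cells, K.1.interior.indicator (f K) x

/-- Pairs `(p, w)` of a piecewise polynomial vector field and a piecewise polynomial, each given by
one polynomial (vector) on each cell. -/
abbrev Mesh.Piecewise {d : ℕ} (T : Mesh d) : Type :=
  (T.cells → Fin d → Poly d) × (T.cells → Poly d)

/-- `p` as a function. -/
def Mesh.vec {d : ℕ} (T : Mesh d) (u : T.Piecewise) : E d → E d :=
  T.glue fun K => vecVal (u.1 K)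

/-- `∇ · p`. -/
def Mesh.div {d : ℕ} (T : Mesh d) (u : T.Piecewise) : E d → ℝ :=
  T.glue fun K => divVal (u.1 K)

/-- `w` as a function. -/
def Mesh.scal {d : ℕ} (T : Mesh d) (u : T.Piecewise) : E d → ℝ :=
  T.glue fun K => Poly.val (u.2 K)

/-- `∇ w`. -/
def Mesh.grad {d : ℕ} (T : Mesh d) (u : T.Piecewise) : E d → E d :=
  T.glue fun K => gradVal (u.2 K)

/-- The local space `P_m(K; ℝ^d) + x P_m(K)`. -/
def IsRaviartThomas {d : ℕ} (m : ℕ) (f : Fin d → Poly d) : Prop :=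
  ∃ (a : Fin d → Poly d) (b : Poly d), (∀ i, (a i).totalDegree ≤ m) ∧ b.totalDegree ≤ m ∧
    ∀ i, f i = a i + MvPolynomial.X i * b

/-- Membership in `U_h = Q_h × W_h`. -/
def Mesh.MemFESpace {d : ℕ} (T : Mesh d) (Ω : Set (E d)) (k : ℕ) (u : T.Piecewise) : Prop :=
  (MemHdiv Ω (T.vec u) ∧ ∀ K, IsRaviartThomas (k + 1) (u.1 K)) ∧
  (MemH1 Ω (T.scal u) ∧ ∀ K, (u.2 K).totalDegree ≤ k + 1)

theorem integrable_mul_test {d : ℕ} {Ω : Set (E d)} {f ψ : E d → ℝ} {S : Set (E d)}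
    (hf : LocallyIntegrableOn f Ω) (hψ : Continuous ψ) (hS : IsCompact S) (hSΩ : S ⊆ Ω)
    (hsupp : Function.support ψ ⊆ S) : IntegrableOn (fun x => f x * ψ x) Ω := by
  have h1 : IntegrableOn (fun x => f x * ψ x) S :=
    (hf.integrableOn_compact_subset hSΩ hS).mul_continuousOn hψ.continuousOn hS
  have h2 : Function.support (fun x => f x * ψ x) ⊆ S := fun x hx =>
    hsupp (by
      simp only [Function.mem_support] at hx ⊢
      exact right_ne_zero_of_mul hx)
  exact ((integrableOn_iff_integrable_of_support_subset h2).1 h1).integrableOn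

theorem IsTestFunction.integrable_mul {d : ℕ} {Ω : Set (E d)} {f φ : E d → ℝ}
    (hφ : IsTestFunction Ω φ) (hf : LocallyIntegrableOn f Ω) :
    IntegrableOn (fun x => f x * φ x) Ω :=
  integrable_mul_test hf hφ.1.continuous hφ.2.1 hφ.2.2 (subset_tsupport φ)

theorem IsTestFunction.integrable_mul_partial {d : ℕ} {Ω : Set (E d)} {f φ : E d → ℝ}
    (hφ : IsTestFunction Ω φ) (hf : LocallyIntegrableOn f Ω) (i : Fin d) :
    IntegrableOn (fun x => f x * partialDeriv i φ x) Ω := by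
  refine integrable_mul_test hf ?_ hφ.2.1 hφ.2.2 ?_
  · exact (hφ.1.continuous_fderiv (by simp)).clm_apply continuous_const
  · intro x hx
    refine support_fderiv_subset ℝ (f := φ) ?_
    intro h0
    apply hx
    simp [partialDeriv, h0]

theorem locallyIntegrableOn_component {d : ℕ} {Ω : Set (E d)} {f : E d → E d}
    (hf : LocallyIntegrableOn f Ω) (i : Fin d) : LocallyIntegrableOn (fun x => f x i) Ω := by
  intro x hx
  obtain ⟨U, hU, hfU⟩ := hf x hx
  exact ⟨U, hU, (EuclideanSpace.proj i : E d →L[ℝ] ℝ).integrable_comp hfU⟩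

theorem HasWeakPartial.add {d : ℕ} {Ω : Set (E d)} {i : Fin d} {f f' g g' : E d → ℝ}
    (h : HasWeakPartial Ω i f g) (h' : HasWeakPartial Ω i f' g') :
    HasWeakPartial Ω i (f + f') (g + g') := by
  refine ⟨h.1.add h'.1, h.2.1.add h'.2.1, fun φ hφ => ?_⟩
  simp only [Pi.add_apply, add_mul]
  rw [integral_add (hφ.integrable_mul_partial h.1 i) (hφ.integrable_mul_partial h'.1 i),
    integral_add (hφ.integrable_mul h.2.1) (hφ.integrable_mul h'.2.1), h.2.2 φ hφ, h'.2.2 φ hφ]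
  ring

theorem HasWeakPartial.smul {d : ℕ} {Ω : Set (E d)} {i : Fin d} {f g : E d → ℝ}
    (h : HasWeakPartial Ω i f g) (a : ℝ) : HasWeakPartial Ω i (a • f) (a • g) := by
  refine ⟨h.1.smul a, h.2.1.smul a, fun φ hφ => ?_⟩
  simp only [Pi.smul_apply, smul_eq_mul, mul_assoc, integral_const_mul]
  rw [h.2.2 φ hφ]
  ring

theorem HasWeakDiv.add {d : ℕ} {Ω : Set (E d)} {f f' : E d → E d} {g g' : E d → ℝ}
    (h : HasWeakDiv Ω f g) (h' : HasWeakDiv Ω f' g') : HasWeakDiv Ω (f + f') (g + g') := by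
  refine ⟨h.1.add h'.1, h.2.1.add h'.2.1, fun φ hφ => ?_⟩
  simp only [Pi.add_apply, PiLp.add_apply, add_mul, Finset.sum_add_distrib]
  rw [integral_add, integral_add (hφ.integrable_mul h.2.1) (hφ.integrable_mul h'.2.1),
    h.2.2 φ hφ, h'.2.2 φ hφ]
  · ring
  · exact integrable_finsetSum _ fun i _ =>
      hφ.integrable_mul_partial (locallyIntegrableOn_component h.1 i) i
  · exact integrable_finsetSum _ fun i _ =>
      hφ.integrable_mul_partial (locallyIntegrableOn_component h'.1 i) i

theorem HasWeakDiv.smul {d : ℕ} {Ω : Set (E d)} {f : E d → E d} {g : E d → ℝ}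
    (h : HasWeakDiv Ω f g) (a : ℝ) : HasWeakDiv Ω (a • f) (a • g) := by
  refine ⟨h.1.smul a, h.2.1.smul a, fun φ hφ => ?_⟩
  simp only [Pi.smul_apply, PiLp.smul_apply, smul_eq_mul, mul_assoc, ← Finset.mul_sum,
    integral_const_mul]
  rw [h.2.2 φ hφ]
  ring

theorem Mesh.vec_add {d : ℕ} (T : Mesh d) (u v : T.Piecewise) :
    T.vec (u + v) = T.vec u + T.vec v := by
  ext x i
  simp only [Mesh.vec, Mesh.glue, Pi.add_apply, ← Finset.sum_add_distrib]
  refine congrArg (fun y : E d => y i) (Finset.sum_congr rfl fun K _ => ?_)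
  by_cases hx : x ∈ K.1.interior
  · ext j; simp [hx, vecVal, Poly.val]
  · simp [hx]

theorem Mesh.vec_smul {d : ℕ} (T : Mesh d) (a : ℝ) (u : T.Piecewise) :
    T.vec (a • u) = a • T.vec u := by
  ext x i
  simp only [Mesh.vec, Mesh.glue, Pi.smul_apply, Finset.smul_sum]
  refine congrArg (fun y : E d => y i) (Finset.sum_congr rfl fun K _ => ?_)
  by_cases hx : x ∈ K.1.interior
  · ext j; simp [hx, vecVal, Poly.val]
  · simp [hx]

theorem Mesh.scal_add {d : ℕ} (T : Mesh d) (u v : T.Piecewise) :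
    T.scal (u + v) = T.scal u + T.scal v := by
  ext x
  simp only [Mesh.scal, Mesh.glue, Pi.add_apply, ← Finset.sum_add_distrib]
  refine Finset.sum_congr rfl fun K _ => ?_
  by_cases hx : x ∈ K.1.interior
  · simp [hx, Poly.val]
  · simp [hx]

theorem Mesh.scal_smul {d : ℕ} (T : Mesh d) (a : ℝ) (u : T.Piecewise) :
    T.scal (a • u) = a • T.scal u := by
  ext x
  simp only [Mesh.scal, Mesh.glue, Pi.smul_apply, Finset.smul_sum]
  refine Finset.sum_congr rfl fun K _ => ?_
  by_cases hx : x ∈ K.1.interior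
  · simp [hx, Poly.val]
  · simp [hx]

theorem Mesh.vec_zero {d : ℕ} (T : Mesh d) : T.vec 0 = 0 := by
  simpa using T.vec_smul 0 0

theorem Mesh.scal_zero {d : ℕ} (T : Mesh d) : T.scal 0 = 0 := by
  simpa using T.scal_smul 0 0

theorem totalDegree_smul_le' {d m : ℕ} {f : Poly d} (hf : f.totalDegree ≤ m) (a : ℝ) :
    (a • f).totalDegree ≤ m :=
  (MvPolynomial.totalDegree_smul_le a f).trans hf

theorem totalDegree_add_le' {d m : ℕ} {f g : Poly d} (hf : f.totalDegree ≤ m)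
    (hg : g.totalDegree ≤ m) : (f + g).totalDegree ≤ m :=
  (MvPolynomial.totalDegree_add f g).trans (max_le hf hg)

/-- The finite element space `U_h = Q_h × W_h`, where `Q_h` consists of the `p ∈ H(div, Ω)` with
`p|_K ∈ P_{k+1}(K; ℝ^d) + x P_{k+1}(K)` and `W_h` of the `w ∈ H¹(Ω)` with `w|_K ∈ P_{k+1}(K)`. -/
def Mesh.feSpace {d : ℕ} (T : Mesh d) (Ω : Set (E d)) (k : ℕ) : Submodule ℝ T.Piecewise where
  carrier := {u | T.MemFESpace Ω k u}
  zero_mem' := by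
    have hz : ∀ {F : Type} [NormedAddCommGroup F], LocallyIntegrableOn (0 : E d → F) Ω :=
      fun {F} _ => locallyIntegrable_zero.locallyIntegrableOn Ω
    refine ⟨⟨⟨?_, 0, MemLp.zero, ?_, hz, ?_⟩, fun K => ⟨0, 0, ?_⟩⟩,
      ⟨⟨?_, fun i => ⟨0, MemLp.zero, ?_, hz, ?_⟩⟩, ?_⟩⟩
    · rw [T.vec_zero]; exact MemLp.zero
    · rw [T.vec_zero]; exact hz
    · simp [T.vec_zero]
    · simp
    · rw [T.scal_zero]; exact MemLp.zero
    · rw [T.scal_zero]; exact hz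
    · simp [T.scal_zero]
    · simp
  add_mem' := by
    rintro u v ⟨⟨⟨hu1, gu, hgu, hu2⟩, hu3⟩, ⟨hu4, hu5⟩, hu6⟩
      ⟨⟨⟨hv1, gv, hgv, hv2⟩, hv3⟩, ⟨hv4, hv5⟩, hv6⟩
    refine ⟨⟨⟨?_, gu + gv, hgu.add hgv, ?_⟩, fun K => ?_⟩, ⟨⟨?_, fun i => ?_⟩, fun K => ?_⟩⟩
    · rw [T.vec_add]; exact hu1.add hv1
    · rw [T.vec_add]; exact hu2.add hv2
    · obtain ⟨a, b, ha, hb, h⟩ := hu3 K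
      obtain ⟨a', b', ha', hb', h'⟩ := hv3 K
      refine ⟨a + a', b + b', fun i => totalDegree_add_le' (ha i) (ha' i),
        totalDegree_add_le' hb hb', fun i => ?_⟩
      simp only [Prod.fst_add, Pi.add_apply, h i, h' i]
      ring
    · rw [T.scal_add]; exact hu4.add hv4
    · obtain ⟨g, hg, hg'⟩ := hu5 i
      obtain ⟨g2, hg2, hg2'⟩ := hv5 i
      exact ⟨g + g2, hg.add hg2, by rw [T.scal_add]; exact hg'.add hg2'⟩
    · exact totalDegree_add_le' (hu6 K) (hv6 K)
  smul_mem' := by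
    rintro r u ⟨⟨⟨hu1, gu, hgu, hu2⟩, hu3⟩, ⟨hu4, hu5⟩, hu6⟩
    refine ⟨⟨⟨?_, r • gu, hgu.const_smul r, ?_⟩, fun K => ?_⟩,
      ⟨⟨?_, fun i => ?_⟩, fun K => ?_⟩⟩
    · rw [T.vec_smul]; exact hu1.const_smul r
    · rw [T.vec_smul]; exact hu2.smul r
    · obtain ⟨a, b, ha, hb, h⟩ := hu3 K
      refine ⟨r • a, r • b, fun i => totalDegree_smul_le' (ha i) r,
        totalDegree_smul_le' hb r, fun i => ?_⟩
      simp only [Prod.smul_fst, Pi.smul_apply, h i, smul_add, mul_smul_comm]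
    · rw [T.scal_smul]; exact hu4.const_smul r
    · obtain ⟨g, hg, hg'⟩ := hu5 i
      exact ⟨r • g, hg.const_smul r, by rw [T.scal_smul]; exact hg'.smul r⟩
    · exact totalDegree_smul_le' (hu6 K) r

/-! ### The least squares form and its stiffness matrix -/

/-- The bilinear form of the first order least squares method. On `U_h` the weak gradient and the
weak divergence are the cellwise ones, and the trace of `w` on a boundary face of the cell `K` is
the restriction of the polynomial that represents `w` on `K`. -/
def lsForm {d : ℕ} [NeZero d] (Ω : Set (E d)) (β : E d → E d) (c : E d → ℝ) (ε : ℝ) (T : Mesh d)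
    (u v : T.Piecewise) : ℝ :=
  (∫ x in Ω, inner ℝ (T.vec u x + √ε • T.grad u x) (T.vec v x + √ε • T.grad v x)) +
  (∫ x in Ω, (√ε * T.div u x + inner ℝ (β x) (T.grad u x) + c x * T.scal u x) *
      (√ε * T.div v x + inner ℝ (β x) (T.grad v x) + c x * T.scal v x)) +
  ∑ F ∈ T.boundaryFaces Ω, (faceSize F.1.1 F.2)⁻¹ *
    ∫ x in face F.1.1 F.2,
      (ε + max (-inner ℝ (β x) (outwardNormal F.1.1 F.2)) 0) *
        Poly.val (u.2 F.1) x * Poly.val (v.2 F.1) x ∂(μHE[d - 1] : Measure (E d))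

/-- The `L²(Ω; ℝ^d) × L²(Ω)` inner product. -/
def l2Form {d : ℕ} (Ω : Set (E d)) (T : Mesh d) (u v : T.Piecewise) : ℝ :=
  (∫ x in Ω, inner ℝ (T.vec u x) (T.vec v x)) + ∫ x in Ω, T.scal u x * T.scal v x

/-- The global stiffness matrix in a basis `b` of `U_h`. -/
def stiffnessMatrix {d : ℕ} [NeZero d] {Ω : Set (E d)} {k : ℕ} {T : Mesh d} {ι : Type}
    (β : E d → E d) (c : E d → ℝ) (ε : ℝ) (b : Module.Basis ι ℝ (T.feSpace Ω k)) : Matrix ι ι ℝ :=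
  Matrix.of fun i j => lsForm Ω β c ε T (b j : T.Piecewise) (b i : T.Piecewise)

/-- The mass (`L²` Gram) matrix of a basis `b` of `U_h`. -/
def massMatrix {d : ℕ} {Ω : Set (E d)} {k : ℕ} {T : Mesh d} {ι : Type}
    (b : Module.Basis ι ℝ (T.feSpace Ω k)) : Matrix ι ι ℝ :=
  Matrix.of fun i j => l2Form Ω T (b j : T.Piecewise) (b i : T.Piecewise)

/-- The spectral condition number `‖A‖₂ ‖A⁻¹‖₂` of an invertible matrix. -/
def condNumber {ι : Type} [Fintype ι] [DecidableEq ι] (A : Matrix ι ι ℝ) : ℝ :=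
  ‖Matrix.toEuclideanCLM (𝕜 := ℝ) A‖ * ‖Matrix.toEuclideanCLM (𝕜 := ℝ) A⁻¹‖

/-! ### Bases generated by a reference element -/

/-- The linear part of the affine map from the reference simplex
`{x : x_i ≥ 0, ∑ x_i ≤ 1}` onto `K`. -/
def refLinear {d : ℕ} (K : Affine.Simplex ℝ (E d) d) (x : E d) : E d :=
  ∑ i : Fin d, x i • (K.points i.succ - K.points 0)

/-- The affine map from the reference simplex onto `K` that respects the order of the vertices. -/
def refMap {d : ℕ} (K : Affine.Simplex ℝ (E d) d) (x : E d) : E d :=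
  K.points 0 + refLinear K x

/-- `b` is assembled from the reference shape functions `S a` (vector valued) and `R a` (scalar).
There is a local-to-global numbering `g K` of the basis functions that do not vanish on `K`; on `K`
these are the transported functions `R a ∘ F_K⁻¹` in the second component and
`t • (DF_K (S a)) ∘ F_K⁻¹` in the first one. (The latter is the contravariant Piola transform up to
the scalar `t`; since `‖DF_K‖` is of the order of `h`, the normalization `τ⁻¹ ≤ h |t| ≤ τ` says that
all basis functions are of unit size.) The cells on which a basis function does not vanish have a
common vertex. -/
def IsAssembledBasis {d k m n : ℕ} {Ω : Set (E d)} {T : Mesh d} {ι : Type}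
    (S : Fin n → Fin d → Poly d) (R : Fin m → Poly d) (τ : ℝ)
    (b : Module.Basis ι ℝ (T.feSpace Ω k)) : Prop :=
  ∃ g : T.cells → Fin n ⊕ Fin m → ι,
    (∀ K, Function.Injective (g K)) ∧
    (∀ K a, (b (g K (Sum.inl a)) : T.Piecewise).2 K = 0 ∧
      ∃ t : ℝ, τ⁻¹ ≤ T.h * |t| ∧ T.h * |t| ≤ τ ∧
        ∀ x, vecVal ((b (g K (Sum.inl a)) : T.Piecewise).1 K) (refMap K.1 x) =
          t • refLinear K.1 (vecVal (S a) x)) ∧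
    (∀ K a, (b (g K (Sum.inr a)) : T.Piecewise).1 K = 0 ∧
      ∀ x, Poly.val ((b (g K (Sum.inr a)) : T.Piecewise).2 K) (refMap K.1 x) =
        Poly.val (R a) x) ∧
    (∀ K i, i ∉ Set.range (g K) →
      (b i : T.Piecewise).1 K = 0 ∧ (b i : T.Piecewise).2 K = 0) ∧
    ∀ i, ∃ v : E d, ∀ K : T.cells, i ∈ Set.range (g K) → v ∈ Set.range K.1.points

end LeastSquaresFEM

end

open LeastSquaresFEM

/-! Write a for the least squares form and ‖u‖ for the L² norm of u = (q, w) in `U_h`. Everything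
rests on two inequalities whose constants do not depend on ε or the mesh: ‖u‖² ≤ C₁ a(u,u) and
a(u,u) ≤ C₂ h⁻² ‖u‖². The matrices A and M represent a and the L² product in the same basis. Hence A
is positive definite, and κ(A) ≤ C₁ C₂ h⁻² κ(M) is linear algebra (`condNumber_le_of_equiv`). For an
assembled basis M is moreover equivalent to h^d times the identity (`exists_mass_bounds`): on each
cell this is equivalence of norms on the reference simplex, and only boundedly many cells meet at a
vertex.

The upper bound (`exists_lsForm_le`) is an inverse estimate. On a cell that contains a ball of
radius comparable to h and has diameter comparable to h, the supremum of a polynomial is at most a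
constant times h^(-d/2) times its L² norm, and each derivative costs a further factor h⁻¹
(`exists_inverse_estimate`, `exists_meshBounds`).

The lower bound (`exists_l2Form_le`) tests the residual r = √ε ∇·q + β·∇w + c w with χ w. The weight
is χ = const - ψ, so that β·∇χ ≤ -b₀, and the constant makes χ large compared with |∇ψ|²/b₀.
Integration by parts turns β·∇w into at least (b₀/2) w² plus the nonnegative term χ (c - ½∇·β) w².
After replacing q by f - √ε∇w, where f is the flux residual q + √ε∇w, the term √ε ∇·q yields χ
ε|∇w|² up to products with f. Young's inequality absorbs the products (`pointwise_coercivity`) and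
leaves control of w and √ε∇w, hence of q.

Two boundary terms remain. The one with β is weighted by the inflow part max(-β·n, 0) and is
contained in a. The other, √ε ∫ χ w (q·n), is split into a small multiple of h|q|², absorbed through
the inverse estimate, and a multiple of ε h⁻¹ w², which a controls because h_F is at most a constant
times h. This is why the face weight h_F⁻¹ ε is in the form.

The integration by parts is needed for fields that are only bounded with bounded weak divergence, on
a domain known only through a triangulation. The one-sided inequality `neg_integral_div_le` is
enough: -∫ ∇·V is at most the sum of the face integrals of any continuous g ≥ 0 that dominates -V·n
near the boundary faces. It is proved with a cutoff that grows linearly in the distance to the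
complement of Ω. In the boundary layer the gradient of the distance is minus the outward normal
wherever the nearest boundary point is interior to a face (`normal_eq_of_ball_subset`). The
remaining points are close to edges and do not count in the limit
(`tendsto_volume_cthickening_edge`). -/

noncomputable section

namespace LeastSquaresFEM

/-! ### Barycentric coordinates -/

section Barycentric

variable {d : ℕ}

/-- The vertices of a full-dimensional simplex as an affine basis. -/
def vertexBasis (K : Affine.Simplex ℝ (E d) d) : AffineBasis (Fin (d + 1)) ℝ (E d) where
  toFun := K.points
  ind' := K.independent
  tot' := by
    rw [K.independent.affineSpan_eq_top_iff_card_eq_finrank_add_one]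
    simp

/-- The `i`-th barycentric coordinate with respect to the vertices of `K`. -/
def bary (K : Affine.Simplex ℝ (E d) d) (i : Fin (d + 1)) : E d →ᵃ[ℝ] ℝ :=
  (vertexBasis K).coord i

variable (K : Affine.Simplex ℝ (E d) d)

theorem coe_vertexBasis : (vertexBasis K : Fin (d + 1) → E d) = K.points := rfl

theorem bary_points (i j : Fin (d + 1)) : bary K i (K.points j) = if i = j then 1 else 0 :=
  (vertexBasis K).coord_apply i j

theorem bary_points_self (i : Fin (d + 1)) : bary K i (K.points i) = 1 := by simp [bary_points]

theorem bary_points_ne {i j : Fin (d + 1)} (h : i ≠ j) : bary K i (K.points j) = 0 := by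
  simp [bary_points, h]

theorem sum_bary (x : E d) : ∑ i, bary K i x = 1 := (vertexBasis K).sum_coord_apply_eq_one x

theorem continuous_bary (i : Fin (d + 1)) : Continuous (bary K i) :=
  continuous_barycentric_coord (vertexBasis K) i

theorem sum_bary_smul (x : E d) : ∑ i, bary K i x • K.points i = x :=
  (vertexBasis K).linear_combination_coord_eq_self x

/-- An affine function is determined by its values at the vertices. This is used to compare
coordinates of neighbouring cells and to read a coordinate as a distance. -/
theorem affineMap_eq_sum_bary (f : E d →ᵃ[ℝ] ℝ) (x : E d) :
    f x = ∑ i, bary K i x * f (K.points i) := by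
  conv_lhs => rw [← (vertexBasis K).affineCombination_coord_eq_self x]
  change f (Finset.univ.affineCombination ℝ K.points fun i => bary K i x) = _
  rw [Finset.map_affineCombination _ _ _ (sum_bary K x),
    Finset.affineCombination_eq_linear_combination _ _ _ (sum_bary K x)]
  rfl

theorem mem_closedInterior_iff {x : E d} : x ∈ K.closedInterior ↔ ∀ i, 0 ≤ bary K i x := by
  rw [← K.convexHull_eq_closedInterior, ← coe_vertexBasis, (vertexBasis K).convexHull_eq_nonneg_coord]
  rfl

/-- The interior of a simplex also asks for coordinates below one. With at least two vertices
positivity of all of them already gives this. -/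
theorem bary_lt_one_of_pos [NeZero d] {x : E d} (h : ∀ i, 0 < bary K i x) (i : Fin (d + 1)) :
    bary K i x < 1 := by
  have h1 := sum_bary K x
  rw [← Finset.add_sum_erase _ _ (Finset.mem_univ i)] at h1
  have : 0 < ∑ j ∈ Finset.univ.erase i, bary K j x := by
    refine Finset.sum_pos (fun j _ => h j) ?_
    have : 0 < (Finset.univ.erase i : Finset (Fin (d + 1))).card := by
      rw [Finset.card_erase_of_mem (Finset.mem_univ i)]
      simpa using Nat.pos_of_ne_zero (NeZero.ne d)
    exact Finset.card_pos.1 this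
  linarith

theorem mem_interior_iff [NeZero d] {x : E d} : x ∈ K.interior ↔ ∀ i, 0 < bary K i x := by
  conv_lhs => rw [← (vertexBasis K).affineCombination_coord_eq_self x]
  change (Finset.univ.affineCombination ℝ K.points fun i => bary K i x) ∈ _ ↔ _
  rw [Affine.Simplex.affineCombination_mem_interior_iff (sum_bary K x)]
  exact ⟨fun h i => (h i).1, fun h i => ⟨h i, bary_lt_one_of_pos K h i⟩⟩

theorem interior_closedInterior [NeZero d] : interior K.closedInterior = K.interior := by
  rw [← K.convexHull_eq_closedInterior, ← coe_vertexBasis, (vertexBasis K).interior_convexHull]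
  ext x
  rw [mem_interior_iff]
  rfl

theorem isOpen_interior [NeZero d] : IsOpen K.interior := by
  rw [← interior_closedInterior]; exact _root_.isOpen_interior

theorem convex_closedInterior : Convex ℝ K.closedInterior := by
  rw [← K.convexHull_eq_closedInterior]; exact convex_convexHull ℝ _

theorem isCompact_closedInterior : IsCompact K.closedInterior := K.isCompact_closedInterior

theorem interior_nonempty [NeZero d] : K.interior.Nonempty := by
  rw [← interior_closedInterior, ← K.convexHull_eq_closedInterior,
    interior_convexHull_nonempty_iff_affineSpan_eq_top]
  exact (vertexBasis K).tot

theorem closure_interior [NeZero d] : closure K.interior = K.closedInterior := by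
  rw [← interior_closedInterior, (convex_closedInterior K).closure_interior_eq_closure_of_nonempty_interior
    (by rw [interior_closedInterior]; exact interior_nonempty K)]
  exact (isCompact_closedInterior K).isClosed.closure_eq

theorem volume_closedInterior_diff_interior [NeZero d] :
    volume (K.closedInterior \ K.interior) = 0 := by
  have := (convex_closedInterior K).addHaar_frontier volume
  rwa [(isCompact_closedInterior K).isClosed.frontier_eq, interior_closedInterior] at this

/-- The zero set of a coordinate is convex and contains every vertex but one. This turns the
conformity condition into statements about vertices. -/
theorem bary_eq_zero_of_mem_convexHull {S : Set (E d)} (hS : S ⊆ Set.range K.points) {x : E d}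
    (hx : x ∈ convexHull ℝ S) {i : Fin (d + 1)} (hi : K.points i ∉ S) : bary K i x = 0 := by
  have hconv : Convex ℝ (bary K i ⁻¹' {0}) := (convex_singleton 0).affine_preimage (bary K i)
  refine convexHull_min ?_ hconv hx
  intro y hy
  obtain ⟨j, rfl⟩ := hS hy
  have : i ≠ j := by rintro rfl; exact hi hy
  simp [bary_points_ne K this]

theorem mem_face_iff [NeZero d] {i : Fin (d + 1)} {x : E d} :
    x ∈ face K i ↔ bary K i x = 0 ∧ ∀ j, 0 ≤ bary K j x := by
  rw [face, ← Affine.Simplex.convexHull_eq_closedInterior, K.range_faceOpposite_points]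
  constructor
  · intro hx
    refine ⟨bary_eq_zero_of_mem_convexHull K (Set.image_subset_range _ _) hx ?_, ?_⟩
    · rintro ⟨j, hj, h⟩
      exact hj (K.independent.injective h)
    · rw [← mem_closedInterior_iff, ← K.convexHull_eq_closedInterior]
      exact convexHull_mono (Set.image_subset_range _ _) hx
  · rintro ⟨h0, h⟩
    have h1 := sum_bary K x
    rw [← Finset.add_sum_erase _ _ (Finset.mem_univ i), h0, zero_add] at h1
    have h2 := sum_bary_smul K x
    rw [← Finset.add_sum_erase _ _ (Finset.mem_univ i), h0, zero_smul, zero_add] at h2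
    rw [← h2]
    refine (convex_convexHull ℝ _).sum_mem (fun j _ => h j) h1 fun j hj => subset_convexHull ℝ _ ?_
    exact ⟨j, Finset.ne_of_mem_erase hj, rfl⟩

theorem isCompact_face [NeZero d] (i : Fin (d + 1)) : IsCompact (face K i) :=
  (K.faceOpposite i).isCompact_closedInterior

theorem face_subset [NeZero d] (i : Fin (d + 1)) : face K i ⊆ K.closedInterior := fun _ hx =>
  (mem_closedInterior_iff K).2 ((mem_face_iff K).1 hx).2

theorem norm_outwardNormal [NeZero d] (i : Fin (d + 1)) : ‖outwardNormal K i‖ = 1 := by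
  rw [outwardNormal, norm_smul, norm_inv, Real.norm_of_nonneg (K.height_pos i).le,
    ← dist_eq_norm, dist_comm]
  exact inv_mul_cancel₀ (K.height_pos i).ne'

/-- Both sides are affine, so it suffices to compare them at the vertices. The scaled coordinate is
the depth below the face, measured against the outward normal. -/
theorem height_mul_bary [NeZero d] (i : Fin (d + 1)) (x : E d) :
    K.height i * bary K i x = - inner ℝ (outwardNormal K i) (x - K.altitudeFoot i) := by
  let f : E d →ᵃ[ℝ] ℝ := (innerSL ℝ (outwardNormal K i)).toLinearMap.toAffineMap.comp
    (AffineMap.id ℝ (E d) -ᵥ AffineMap.const ℝ (E d) (K.altitudeFoot i))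
  have hf : ∀ y, f y = inner ℝ (outwardNormal K i) (y - K.altitudeFoot i) := fun y => rfl
  rw [← hf, affineMap_eq_sum_bary K f x, Finset.sum_eq_single i]
  · have : f (K.points i) = - K.height i := by
      rw [hf, outwardNormal, inner_smul_left, ← neg_sub (K.points i), inner_neg_left,
        real_inner_self_eq_norm_sq, ← dist_eq_norm]
      have h := K.height_pos i
      change (starRingEnd ℝ) (K.height i)⁻¹ * -(K.height i) ^ 2 = _
      simp only [conj_trivial]
      field_simp
    rw [this]; ring
  · intro j _ hj
    have : f (K.points j) = 0 := by
      rw [hf, outwardNormal, inner_smul_left, ← neg_sub (K.points i), inner_neg_left,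
        real_inner_comm]
      have := K.inner_vsub_altitudeFoot_vsub_altitudeFoot_eq_zero hj.symm
      simp only [vsub_eq_sub] at this
      rw [this]; simp
    rw [this, mul_zero]
  · simp

theorem height_mul_bary_of_bary_eq_zero [NeZero d] (i : Fin (d + 1)) {x p : E d}
    (hp : bary K i p = 0) :
    K.height i * bary K i x = - inner ℝ (outwardNormal K i) (x - p) := by
  have h1 := height_mul_bary K i x
  have h2 := height_mul_bary K i p
  rw [hp, mul_zero] at h2
  have : x - p = (x - K.altitudeFoot i) - (p - K.altitudeFoot i) := by abel
  rw [this, inner_sub_right, h1]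
  linarith

end Barycentric

/-! ### Conforming meshes -/

namespace Mesh

variable {d : ℕ} (T : Mesh d)

theorem isCompact_space : IsCompact T.space :=
  T.cells.isCompact_biUnion fun K _ => isCompact_closedInterior K

variable {T}

/-- By conformity a common point of two cells lies in the hull of their common vertices, so its
coordinate at any other vertex vanishes. -/
theorem range_subset_of_bary_pos {K K' : Affine.Simplex ℝ (E d) d} (hK : K ∈ T.cells)
    (hK' : K' ∈ T.cells) {x : E d} (hx : x ∈ K.closedInterior) (hx' : x ∈ K'.closedInterior)
    {i : Fin (d + 1)} (hi : 0 < bary K i x) : K.points i ∈ Set.range K'.points := by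
  have hmem : x ∈ K.closedInterior ∩ K'.closedInterior := ⟨hx, hx'⟩
  rw [T.conforming K hK K' hK'] at hmem
  by_contra h
  exact hi.ne' (bary_eq_zero_of_mem_convexHull K Set.inter_subset_left hmem fun h' => h h'.2)

theorem eq_of_range_subset {K K' : Affine.Simplex ℝ (E d) d} (hK : K ∈ T.cells)
    (hK' : K' ∈ T.cells) (hsub : Set.range K.points ⊆ Set.range K'.points) : K = K' := by
  apply T.injOn hK hK'
  change Set.range K.points = Set.range K'.points
  refine Set.eq_of_subset_of_ncard_le hsub ?_ (Set.finite_range _)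
  rw [← Set.image_univ, ← Set.image_univ, Set.ncard_image_of_injective _ K'.independent.injective,
    Set.ncard_image_of_injective _ K.independent.injective]

/-- At an interior point all coordinates are positive, so every vertex of `K` is a vertex of `K'`,
and the cells have equally many vertices. -/
theorem eq_of_mem_interior [NeZero d] {K K' : Affine.Simplex ℝ (E d) d} (hK : K ∈ T.cells)
    (hK' : K' ∈ T.cells) {x : E d} (hx : x ∈ K.interior) (hx' : x ∈ K'.closedInterior) :
    K = K' := by
  apply eq_of_range_subset hK hK'
  rintro _ ⟨i, rfl⟩
  exact range_subset_of_bary_pos hK hK' (K.interior_subset_closedInterior hx) hx'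
    ((mem_interior_iff K).1 hx i)

/-- A point in the relative interior of a common face of two cells is interior to their union. -/
theorem mem_interior_union [NeZero d] {K K' : Affine.Simplex ℝ (E d) d} (hK : K ∈ T.cells)
    (hK' : K' ∈ T.cells) (hne : K ≠ K') {i : Fin (d + 1)} {p : E d} (h0 : bary K i p = 0)
    (hpos : ∀ j, j ≠ i → 0 < bary K j p) (hp' : p ∈ K'.closedInterior) :
    p ∈ interior (K.closedInterior ∪ K'.closedInterior) := by
  have hp : p ∈ K.closedInterior := (mem_closedInterior_iff K).2 fun j => by
    by_cases hj : j = i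
    · rw [hj, h0]
    · exact (hpos j hj).le
  -- All vertices of the face opposite to `i` are shared. The vertex `i` is not, since the cells are
  -- distinct.
  have hv : ∀ j, j ≠ i → ∃ j', K'.points j' = K.points j := fun j hj =>
    range_subset_of_bary_pos hK hK' hp hp' (hpos j hj)
  have hi : K.points i ∉ Set.range K'.points := by
    intro hi
    apply hne
    apply eq_of_range_subset hK hK'
    rintro _ ⟨j, rfl⟩
    by_cases hj : j = i
    · rw [hj]; exact hi
    · exact hv j hj
  choose! φ hφ using hv
  have hφinj : Set.InjOn φ {i}ᶜ := fun a ha b hb hab => K.independent.injective (by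
    rw [← hφ a ha, ← hφ b hb, hab])
  -- the vertex of `K'` that is not a vertex of `K`
  obtain ⟨i', hi'⟩ : ∃ i', i' ∉ φ '' {i}ᶜ := by
    by_contra! hall
    have h1 : (Set.univ : Set (Fin (d + 1))).ncard ≤ ({i}ᶜ : Set (Fin (d + 1))).ncard := by
      rw [← hφinj.ncard_image]
      exact Set.ncard_le_ncard fun x _ => hall x
    rw [Set.ncard_univ, Set.ncard_compl, Nat.card_eq_fintype_card] at h1
    simp at h1
  -- Counting: `φ` is injective on `d` indices and misses `i'`, so it hits all others.
  have hcov : ∀ j', j' ≠ i' → ∃ j, j ≠ i ∧ φ j = j' := by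
    intro j' hj'
    by_contra! hno
    have h1 : (φ '' {i}ᶜ) ⊆ ({i', j'} : Set (Fin (d + 1)))ᶜ := by
      rintro _ ⟨j, hj, rfl⟩ h
      rcases h with h | h
      · exact hi' (h ▸ ⟨j, hj, rfl⟩)
      · exact hno j hj h
    have h2 := Set.ncard_le_ncard h1
    rw [hφinj.ncard_image, Set.ncard_compl, Set.ncard_compl,
      Set.ncard_pair hj'.symm, Nat.card_eq_fintype_card] at h2
    have : 0 < d := Nat.pos_of_ne_zero (NeZero.ne d)
    simp at h2
    omega
  set w := K'.points i' with hw
  -- the coordinate of `K` that vanishes at `p`, in terms of the one of `K'`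
  have hrel : ∀ y, bary K i y = bary K' i' y * bary K i w := by
    intro y
    rw [affineMap_eq_sum_bary K' (bary K i) y, Finset.sum_eq_single i']
    · intro j' _ hj'
      obtain ⟨j, hj, rfl⟩ := hcov j' hj'
      rw [hφ j hj, bary_points_ne K hj.symm, mul_zero]
    · simp
  have hw0 : bary K i w ≠ 0 := by
    intro h
    have := hrel (K.points i)
    rw [h, mul_zero, bary_points_self] at this
    exact one_ne_zero this
  -- The two cells lie on opposite sides of the common face. Otherwise a short step from `p` towards
  -- `w` would stay in `K'` and enter the interior of `K`.
  have hwneg : bary K i w < 0 := by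
    by_contra! hge
    have hwpos : 0 < bary K i w := lt_of_le_of_ne hge hw0.symm
    have hcont : ∀ j, ContinuousAt (fun t : ℝ => bary K j (AffineMap.lineMap p w t)) 0 := fun j =>
      ((continuous_bary K j).comp AffineMap.lineMap_continuous).continuousAt
    have hev : ∀ᶠ t : ℝ in nhds 0, ∀ j, j ≠ i → 0 < bary K j (AffineMap.lineMap p w t) := by
      rw [Filter.eventually_all]
      intro j
      by_cases hj : j = i
      · simp [hj]
      · filter_upwards [(hcont j).eventually (lt_mem_nhds (by simpa using hpos j hj))] with t ht _
        exact ht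
    obtain ⟨t, ht, ht0, ht1⟩ := ((hev.filter_mono nhdsWithin_le_nhds).and
      (Ioo_mem_nhdsGT (zero_lt_one' ℝ))).exists
    set y := AffineMap.lineMap p w t with hy
    have hyi : 0 < bary K i y := by
      rw [hy, AffineMap.apply_lineMap, h0, AffineMap.lineMap_apply]
      simp; positivity
    have hyK : y ∈ K.interior := (mem_interior_iff K).2 fun j => by
      by_cases hj : j = i
      · rw [hj]; exact hyi
      · exact ht j hj
    have hyK' : y ∈ K'.closedInterior := by
      refine (convex_closedInterior K').segment_subset hp' (K'.point_mem_closedInterior i') ?_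
      rw [segment_eq_image_lineMap]
      exact ⟨t, ⟨ht0.le, ht1.le⟩, rfl⟩
    exact hne (eq_of_mem_interior hK hK' hyK hyK')
  -- the coordinates of `K'` at `p`
  have hpos' : ∀ j', j' ≠ i' → 0 < bary K' j' p := by
    intro j' hj'
    obtain ⟨j, hj, rfl⟩ := hcov j' hj'
    have h1 : bary K j p = ∑ a, bary K' a p * bary K j (K'.points a) :=
      affineMap_eq_sum_bary K' (bary K j) p
    have hi'0 : bary K' i' p = 0 := by
      have := hrel p
      rw [h0] at this
      exact (mul_eq_zero.1 this.symm).resolve_right hw0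
    rw [Finset.sum_eq_single (φ j)] at h1
    · rw [hφ j hj, bary_points_self, mul_one] at h1
      rw [← h1]; exact hpos j hj
    · intro a _ ha
      by_cases hai : a = i'
      · rw [hai, hi'0, zero_mul]
      · obtain ⟨b, hb, rfl⟩ := hcov a hai
        rw [hφ b hb, bary_points_ne K (by rintro rfl; exact ha rfl), mul_zero]
    · simp
  rw [mem_interior_iff_mem_nhds]
  have hevK : ∀ᶠ y in nhds p, ∀ j, j ≠ i → 0 < bary K j y := by
    rw [Filter.eventually_all]
    intro j
    by_cases hj : j = i
    · simp [hj]
    · filter_upwards [(continuous_bary K j).continuousAt.eventually (lt_mem_nhds (hpos j hj))] with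
        t ht _ using ht
  have hevK' : ∀ᶠ y in nhds p, ∀ j, j ≠ i' → 0 < bary K' j y := by
    rw [Filter.eventually_all]
    intro j
    by_cases hj : j = i'
    · simp [hj]
    · filter_upwards [(continuous_bary K' j).continuousAt.eventually (lt_mem_nhds (hpos' j hj))]
        with t ht _ using ht
  -- Near `p` only the coordinates belonging to `i` and `i'` can be negative. By `hrel` and `hwneg`
  -- they have opposite signs, so one of them is nonnegative.
  filter_upwards [hevK, hevK'] with y hy hy'
  rcases le_or_gt 0 (bary K i y) with h | h
  · left
    refine (mem_closedInterior_iff K).2 fun j => ?_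
    by_cases hj : j = i
    · rw [hj]; exact h
    · exact (hy j hj).le
  · right
    refine (mem_closedInterior_iff K').2 fun j => ?_
    by_cases hj : j = i'
    · rw [hj]
      rw [hrel y] at h
      by_contra! hlt
      nlinarith
    · exact (hy' j hj).le

/-- Near a point of a cell which lies in no other cell, the mesh coincides with this cell. -/
theorem eventually_mem_of_unique {K : Affine.Simplex ℝ (E d) d} {p : E d}
    (huniq : ∀ K' ∈ T.cells, p ∈ K'.closedInterior → K' = K) :
    ∀ᶠ y in nhds p, y ∈ T.space → y ∈ K.closedInterior := by
  have : ∀ K' ∈ T.cells, ∀ᶠ y in nhds p, y ∈ K'.closedInterior → y ∈ K.closedInterior := by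
    intro K' hK'
    by_cases hp : p ∈ K'.closedInterior
    · rw [huniq K' hK' hp]; simp
    · filter_upwards [(isCompact_closedInterior K').isClosed.isOpen_compl.mem_nhds hp] with y hy h
      exact absurd h hy
  have := (Finset.eventually_all T.cells).2 this
  filter_upwards [this] with y hy hyT
  simp only [Mesh.space, Set.mem_iUnion] at hyT
  obtain ⟨K', hK', h⟩ := hyT
  exact hy K' hK' h

variable {Ω : Set (E d)}

theorem Triangulates.closure_subset (hT : T.Triangulates Ω) : closure Ω ⊆ T.space := by
  rw [hT]
  exact closure_minimal interior_subset T.isCompact_space.isClosed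

theorem Triangulates.interior_cell_subset [NeZero d] (hT : T.Triangulates Ω)
    {K : Affine.Simplex ℝ (E d) d} (hK : K ∈ T.cells) : K.interior ⊆ Ω := by
  rw [hT, ← interior_closedInterior]
  exact interior_mono (Set.subset_biUnion_of_mem (u := fun K : Affine.Simplex ℝ (E d) d =>
    K.closedInterior) hK)

theorem Triangulates.cell_subset_closure [NeZero d] (hT : T.Triangulates Ω)
    {K : Affine.Simplex ℝ (E d) d} (hK : K ∈ T.cells) : K.closedInterior ⊆ closure Ω := by
  rw [← closure_interior]
  exact closure_mono (hT.interior_cell_subset hK)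

/-- A boundary point lies on a codimension-two face of a cell, or in the relative interior of a
boundary face near which the mesh consists of the cell of this face only. -/
theorem Triangulates.boundary_cases [NeZero d] (hT : T.Triangulates Ω) {p : E d} (hp : p ∉ Ω)
    (hp' : p ∈ closure Ω) :
    ∃ (K : T.cells) (i : Fin (d + 1)), p ∈ face K.1 i ∧ ((∃ j, j ≠ i ∧ bary K.1 j p = 0) ∨
      ((K, i) ∈ T.boundaryFaces Ω ∧ ∀ᶠ y in nhds p, y ∈ Ω → y ∈ K.1.closedInterior)) := by
  have hpT := hT.closure_subset hp'
  simp only [Mesh.space, Set.mem_iUnion] at hpT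
  obtain ⟨K, hK, hpK⟩ := hpT
  have hpint : p ∉ K.interior := fun h => hp (hT.interior_cell_subset hK h)
  rw [mem_interior_iff] at hpint
  push Not at hpint
  obtain ⟨i, hi⟩ := hpint
  have hnn := (mem_closedInterior_iff K).1 hpK
  have h0 : bary K i p = 0 := le_antisymm hi (hnn i)
  refine ⟨⟨K, hK⟩, i, (mem_face_iff K).2 ⟨h0, hnn⟩, ?_⟩
  by_cases hz : ∃ j, j ≠ i ∧ bary K j p = 0
  · exact Or.inl hz
  right
  push Not at hz
  have hpos : ∀ j, j ≠ i → 0 < bary K j p := fun j hj => lt_of_le_of_ne (hnn j) (hz j hj).symm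
  -- A second cell through `p` would make `p` interior to the union of two cells, hence a point of
  -- `Ω`.
  have huniq : ∀ K' ∈ T.cells, p ∈ K'.closedInterior → K' = K := by
    intro K' hK' hpK'
    by_contra hne
    apply hp
    rw [hT]
    refine interior_mono ?_ (mem_interior_union hK hK' (Ne.symm hne) h0 hpos hpK')
    refine Set.union_subset ?_ ?_
    · exact Set.subset_biUnion_of_mem (u := fun K : Affine.Simplex ℝ (E d) d =>
        K.closedInterior) hK
    · exact Set.subset_biUnion_of_mem (u := fun K : Affine.Simplex ℝ (E d) d =>
        K.closedInterior) hK'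
  refine ⟨?_, ?_⟩
  · classical
    simp only [Mesh.boundaryFaces, Finset.mem_filter, Finset.mem_univ, true_and]
    -- With `p`, the whole relative interior of the face is on the boundary: `K` is the only cell at
    -- such a `q`, so `q ∈ Ω` would put a neighbourhood of `q` into `K`, although a coordinate of
    -- `q` vanishes.
    have hrel : ∀ q, bary K i q = 0 → (∀ j, j ≠ i → 0 < bary K j q) → q ∈ frontier Ω := by
      intro q hq0 hq
      have hqK : q ∈ K.closedInterior := (mem_closedInterior_iff K).2 fun j => by
        by_cases hj : j = i
        · rw [hj, hq0]
        · exact (hq j hj).le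
      rw [frontier, (show IsOpen Ω by rw [hT]; exact _root_.isOpen_interior).interior_eq]
      refine ⟨hT.cell_subset_closure hK hqK, fun hqΩ => ?_⟩
      have huq : ∀ K' ∈ T.cells, q ∈ K'.closedInterior → K' = K := by
        intro K' hK' hqK'
        apply huniq K' hK'
        -- A cell through `q` contains all vertices of the face, and therefore also `p`.
        have : p ∈ convexHull ℝ (Set.range K.points ∩ Set.range K'.points) := by
          have hsum := sum_bary_smul K p
          have h1 := sum_bary K p
          rw [← Finset.add_sum_erase _ _ (Finset.mem_univ i), h0, zero_add] at h1
          rw [← Finset.add_sum_erase _ _ (Finset.mem_univ i), h0, zero_smul, zero_add] at hsum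
          rw [← hsum]
          refine (convex_convexHull ℝ _).sum_mem (fun j _ => hnn j) h1 fun j hj =>
            subset_convexHull ℝ _ ⟨⟨j, rfl⟩, ?_⟩
          exact range_subset_of_bary_pos hK hK' hqK hqK' (hq j (Finset.ne_of_mem_erase hj))
        rw [← T.conforming K hK K' hK'] at this
        exact this.2
      have hqint : q ∈ interior K.closedInterior := by
        rw [mem_interior_iff_mem_nhds]
        have hΩn : Ω ∈ nhds q := by
          rw [hT] at hqΩ ⊢
          exact _root_.isOpen_interior.mem_nhds hqΩ
        filter_upwards [eventually_mem_of_unique huq, hΩn] with y hy hyΩ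
        exact hy (hT.closure_subset (subset_closure hyΩ))
      rw [interior_closedInterior, mem_interior_iff] at hqint
      exact (hqint i).ne' hq0
    intro q hq
    obtain ⟨hq0, hqn⟩ := (mem_face_iff K).1 hq
    -- approximate `q` from the relative interior, in the direction of `p`
    have hlim : Filter.Tendsto (fun t : ℝ => AffineMap.lineMap q p t) (nhdsWithin 0 (Set.Ioi 0))
        (nhds q) := by
      have : Continuous (fun t : ℝ => AffineMap.lineMap q p t) := AffineMap.lineMap_continuous
      have h2 := this.tendsto 0
      simp only [AffineMap.lineMap_apply_zero] at h2
      exact h2.mono_left nhdsWithin_le_nhds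
    refine isClosed_frontier.mem_of_tendsto hlim ?_
    filter_upwards [Ioo_mem_nhdsGT (zero_lt_one' ℝ)] with t ht
    apply hrel
    · rw [AffineMap.apply_lineMap, hq0, h0]; simp
    · intro j hj
      rw [AffineMap.apply_lineMap, AffineMap.lineMap_apply_module]
      have := hpos j hj
      have h3 := hqn j
      have h4 := ht.1
      have h5 : 0 < 1 - t := sub_pos.2 ht.2
      simp only [smul_eq_mul]
      positivity
  · filter_upwards [eventually_mem_of_unique huniq] with y hy hyΩ
    exact hy (hT.closure_subset (subset_closure hyΩ))

end Mesh

/-! ### Weak derivatives of bounded functions -/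

section Weak

open Filter Topology Convolution

variable {d : ℕ} {Ω : Set (E d)}

theorem MemLp.locallyIntegrableOn_of_top {F : Type*} [NormedAddCommGroup F] {f : E d → F}
    {p : ℝ≥0∞} (hp : 1 ≤ p) (hf : MemLp f p (volume.restrict Ω)) : LocallyIntegrableOn f Ω :=
  locallyIntegrableOn_of_locallyIntegrable_restrict (hf.locallyIntegrable hp)

theorem exists_bound_of_memLp_top {α F : Type*} [MeasurableSpace α] {μ : Measure α}
    [NormedAddCommGroup F] {f : α → F} (hf : MemLp f ∞ μ) :
    ∃ M : ℝ, 0 ≤ M ∧ ∀ᵐ x ∂μ, ‖f x‖ ≤ M := by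
  refine ⟨(eLpNormEssSup f μ).toReal, ENNReal.toReal_nonneg, ?_⟩
  have hfin : eLpNormEssSup f μ ≠ ∞ := by
    have := hf.2
    rw [eLpNorm_exponent_top] at this
    exact this.ne
  filter_upwards [ae_le_eLpNormEssSup (f := f) (μ := μ)] with x hx
  rw [← toReal_enorm]
  exact ENNReal.toReal_mono hfin hx

theorem continuous_partialDeriv {φ : E d → ℝ} (hφ : ContDiff ℝ 1 φ) (i : Fin d) :
    Continuous (partialDeriv i φ) :=
  (hφ.continuous_fderiv one_ne_zero).clm_apply continuous_const

theorem partialDeriv_eq_zero_of_notMem_tsupport {φ : E d → ℝ} {x : E d} (hx : x ∉ tsupport φ)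
    (i : Fin d) : partialDeriv i φ x = 0 := by
  rw [partialDeriv, fderiv_of_notMem_tsupport ℝ hx]; rfl

theorem hasCompactSupport_partialDeriv {φ : E d → ℝ} (hφ : HasCompactSupport φ) (i : Fin d) :
    HasCompactSupport (partialDeriv i φ) :=
  HasCompactSupport.of_support_subset_isCompact hφ fun x hx => by
    by_contra h
    exact hx (partialDeriv_eq_zero_of_notMem_tsupport h i)

theorem mollify_eq (ρ : ContDiffBump (0 : E d)) (f : E d → ℝ) (x : E d) :
    (ρ.normed volume ⋆[ContinuousLinearMap.lsmul ℝ ℝ] f) x =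
      ∫ t, f t * ρ.normed volume (x - t) := by
  rw [convolution_eq_swap]
  simp [mul_comm]

/-- The mollification averages against a probability density. -/
theorem norm_mollify_le (ρ : ContDiffBump (0 : E d)) {f : E d → ℝ} {M : ℝ}
    (hM : ∀ᵐ t, ‖f t‖ ≤ M) (x : E d) :
    ‖(ρ.normed volume ⋆[ContinuousLinearMap.lsmul ℝ ℝ] f) x‖ ≤ M := by
  rw [mollify_eq]
  have hinteg : Integrable (fun t => M * ρ.normed volume (x - t)) :=
    (ρ.integrable_normed.comp_sub_left x).const_mul M
  refine (norm_integral_le_of_norm_le hinteg ?_).trans ?_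
  · filter_upwards [hM] with t ht
    rw [norm_mul, Real.norm_of_nonneg (ρ.nonneg_normed _)]
    exact mul_le_mul_of_nonneg_right ht (ρ.nonneg_normed _)
  · rw [integral_const_mul, integral_sub_left_eq_self (fun t => ρ.normed volume t),
      ρ.integral_normed, mul_one]

/-- The derivative falls on the kernel. As long as the closed ball stays in `Ω`, the reflected
kernel `t ↦ ρ (x - t)` is a test function, and the sign from the reflection cancels the one in the
weak derivative. -/
theorem partialDeriv_mollify (ρ : ContDiffBump (0 : E d)) {f g : E d → ℝ} {i : Fin d}
    (hΩ : IsOpen Ω) (hf : LocallyIntegrable (Ω.indicator f)) (hfg : HasWeakPartial Ω i f g)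
    {x : E d} (hx : Metric.closedBall x ρ.rOut ⊆ Ω) :
    partialDeriv i (ρ.normed volume ⋆[ContinuousLinearMap.lsmul ℝ ℝ] Ω.indicator f) x =
      (ρ.normed volume ⋆[ContinuousLinearMap.lsmul ℝ ℝ] Ω.indicator g) x := by
  have hρ : ContDiff ℝ (⊤ : ℕ∞) (ρ.normed volume) := ρ.contDiff_normed
  have hρ1 : ContDiff ℝ 1 (ρ.normed volume) := hρ.of_le (by simp)
  have hd := ρ.hasCompactSupport_normed.hasFDerivAt_convolution_left (μ := volume)
    (ContinuousLinearMap.lsmul ℝ ℝ) hρ1 hf x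
  set e : E d := EuclideanSpace.single i 1 with he
  set ξ : E d → ℝ := fun t => ρ.normed volume (x - t) with hξ
  have hξd : ∀ t, partialDeriv i ξ t = - fderiv ℝ (ρ.normed volume) (x - t) e := by
    intro t
    have h1 : HasFDerivAt (fun t : E d => x - t) (-ContinuousLinearMap.id ℝ (E d)) t :=
      (hasFDerivAt_id t).const_sub x
    have h2 := ((hρ1.differentiable one_ne_zero) (x - t)).hasFDerivAt.comp t h1
    change fderiv ℝ (ρ.normed volume ∘ fun t : E d => x - t) t e = _
    rw [h2.fderiv]; simp
  have hξt : IsTestFunction Ω ξ := by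
    have hsupp : tsupport ξ ⊆ Metric.closedBall x ρ.rOut := by
      refine closure_minimal ?_ Metric.isClosed_closedBall
      intro t ht
      have : x - t ∈ tsupport (ρ.normed volume) := subset_tsupport _ ht
      rw [ρ.tsupport_normed_eq] at this
      simpa [dist_eq_norm, norm_sub_rev] using this
    exact ⟨hρ.comp (contDiff_const.sub contDiff_id),
      HasCompactSupport.of_support_subset_isCompact (isCompact_closedBall _ _)
        ((subset_tsupport _).trans hsupp), hsupp.trans hx⟩
  have hw := hfg.2.2 ξ hξt
  rw [mollify_eq, partialDeriv, hd.fderiv]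
  have hconv : ConvolutionExistsAt (fderiv ℝ (ρ.normed volume)) (Ω.indicator f) x
      (ContinuousLinearMap.precompL (E d) (ContinuousLinearMap.lsmul ℝ ℝ)) volume :=
    (ρ.hasCompactSupport_normed.fderiv ℝ).convolutionExists_left _
      (hρ1.continuous_fderiv one_ne_zero) hf x
  rw [convolution_def, ContinuousLinearMap.integral_apply hconv]
  simp only [ContinuousLinearMap.precompL_apply, ContinuousLinearMap.lsmul_apply, smul_eq_mul]
  rw [← integral_sub_left_eq_self _ volume x]
  have h1 : ∀ t, fderiv ℝ (ρ.normed volume) (x - t) e * Ω.indicator f (x - (x - t)) =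
      Ω.indicator (fun t => - (f t * partialDeriv i ξ t)) t := by
    intro t
    rw [sub_sub_cancel]
    by_cases ht : t ∈ Ω
    · simp only [Set.indicator_of_mem ht, hξd]; ring
    · simp [Set.indicator_of_notMem ht]
  have h2 : ∀ t, Ω.indicator g t * ρ.normed volume (x - t) =
      Ω.indicator (fun t => g t * ξ t) t := by
    intro t
    by_cases ht : t ∈ Ω
    · simp only [Set.indicator_of_mem ht, hξ]
    · simp [Set.indicator_of_notMem ht]
  simp only [← he, h1, h2]
  rw [integral_indicator hΩ.measurableSet, integral_indicator hΩ.measurableSet, integral_neg, hw,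
    neg_neg]

/-- The majorant for dominated convergence in `HasWeakDiv.mul`, uniform in the mollification
parameter. -/
theorem bound_sum_mul_add {ι : Type*} [Fintype ι] {V p q : ι → ℝ} {g a f A : ℝ} (hA : 0 ≤ A)
    (hV : ∀ i, |V i| ≤ A) (hq : ∀ i, |q i| ≤ A) (hg : |g| ≤ A) (ha : |a| ≤ A) :
    ‖∑ i, V i * (a * p i + f * q i) + g * (f * a)‖ ≤
      ∑ i, A * (A * |p i| + |f| * A) + A * (|f| * A) := by
  refine (norm_add_le _ _).trans (add_le_add ((norm_sum_le _ _).trans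
    (Finset.sum_le_sum fun i _ => ?_)) ?_)
  · rw [norm_mul]
    refine mul_le_mul (hV i) ((norm_add_le _ _).trans ?_) (norm_nonneg _) hA
    rw [norm_mul, norm_mul]
    exact add_le_add (mul_le_mul_of_nonneg_right ha (abs_nonneg _))
      (mul_le_mul_of_nonneg_left (hq i) (abs_nonneg _))
  · rw [norm_mul, norm_mul]
    exact mul_le_mul hg (mul_le_mul_of_nonneg_left ha (abs_nonneg _)) (by positivity) hA

/-- The product rule for the divergence of a bounded field times a `W^{1,∞}` function. -/
theorem HasWeakDiv.mul (hΩ : IsOpen Ω) {V : E d → E d} {g v : E d → ℝ} {Dv : Fin d → E d → ℝ}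
    (hV : MemLp V ∞ (volume.restrict Ω)) (hg : MemLp g ∞ (volume.restrict Ω))
    (hdiv : HasWeakDiv Ω V g) (hv : MemW1Infty Ω v Dv) :
    HasWeakDiv Ω (fun x => v x • V x) (fun x => v x * g x + ∑ i, V x i * Dv i x) := by
  obtain ⟨hv0, hv1⟩ := hv
  have hVi : ∀ i, MemLp (fun x => V x i) ∞ (volume.restrict Ω) := fun i =>
    (EuclideanSpace.proj (𝕜 := ℝ) i : E d →L[ℝ] ℝ).comp_memLp' hV
  have hprod : ∀ {f g : E d → ℝ}, MemLp f ∞ (volume.restrict Ω) → MemLp g ∞ (volume.restrict Ω) →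
      MemLp (fun x => f x * g x) ∞ (volume.restrict Ω) := fun hf hg => hg.mul' hf
  have hvV : MemLp (fun x => v x • V x) ∞ (volume.restrict Ω) := hV.smul hv0
  have hnew : MemLp (fun x => v x * g x + ∑ i, V x i * Dv i x) ∞ (volume.restrict Ω) :=
    (hprod hv0 hg).add (memLp_finsetSum _ fun i _ => hprod (hVi i) (hv1 i).1)
  have hloc1 := MemLp.locallyIntegrableOn_of_top le_top hvV
  have hloc2 := MemLp.locallyIntegrableOn_of_top le_top hnew
  refine ⟨hloc1, hloc2, fun φ hφ => ?_⟩
  -- The mollification radii stay below `δ`, so that balls around the support of `φ` remain in `Ω`.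
  obtain ⟨δ, hδ, hδΩ⟩ := (show IsCompact (tsupport φ) from hφ.2.1).exists_cthickening_subset_open
    hΩ hφ.2.2
  let ρ : ℕ → ContDiffBump (0 : E d) := fun n =>
    ⟨δ / (n + 1) / 2, δ / (n + 1), by positivity, half_lt_self (by positivity)⟩
  have hρout : ∀ n, (ρ n).rOut = δ / (n + 1) := fun n => rfl
  have hρle : ∀ n, (ρ n).rOut ≤ δ := fun n => by
    rw [hρout]
    refine div_le_self hδ.le ?_
    have : (0 : ℝ) ≤ n := n.cast_nonneg
    linarith
  have hρlim : Tendsto (fun n => (ρ n).rOut) atTop (𝓝 0) := by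
    simp only [hρout]
    have := (tendsto_one_div_add_atTop_nhds_zero_nat (𝕜 := ℝ)).const_mul δ
    simpa [div_eq_mul_inv] using this
  have hρratio : ∀ᶠ n in atTop, (ρ n).rOut ≤ 2 * (ρ n).rIn := Eventually.of_forall fun n => by
    change δ / (n + 1) ≤ 2 * (δ / (n + 1) / 2)
    linarith
  have hind : ∀ {f : E d → ℝ}, MemLp f ∞ (volume.restrict Ω) → MemLp (Ω.indicator f) ∞ volume :=
    fun hf => (memLp_indicator_iff_restrict hΩ.measurableSet).2 hf
  have hli : ∀ {f : E d → ℝ}, MemLp f ∞ (volume.restrict Ω) →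
      LocallyIntegrable (Ω.indicator f) := fun hf => (hind hf).locallyIntegrable le_top
  let vn : ℕ → E d → ℝ := fun n =>
    (ρ n).normed volume ⋆[ContinuousLinearMap.lsmul ℝ ℝ] Ω.indicator v
  let Dn : Fin d → ℕ → E d → ℝ := fun i n =>
    (ρ n).normed volume ⋆[ContinuousLinearMap.lsmul ℝ ℝ] Ω.indicator (Dv i)
  have hsm : ∀ {f : E d → ℝ}, MemLp f ∞ (volume.restrict Ω) → ∀ n, ContDiff ℝ (⊤ : ℕ∞)
      ((ρ n).normed volume ⋆[ContinuousLinearMap.lsmul ℝ ℝ] Ω.indicator f) := fun hf n =>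
    (ρ n).hasCompactSupport_normed.contDiff_convolution_left _ (ρ n).contDiff_normed (hli hf)
  have hpd : ∀ n i x, partialDeriv i (fun x => φ x * vn n x) x =
      vn n x * partialDeriv i φ x + φ x * Dn i n x := by
    intro n i x
    have h1 : HasFDerivAt φ (fderiv ℝ φ x) x :=
      ((hφ.1.differentiable (by simp)) x).hasFDerivAt
    have h2 : HasFDerivAt (vn n) (fderiv ℝ (vn n) x) x :=
      (((hsm hv0 n).differentiable (by simp)) x).hasFDerivAt
    have h3 : partialDeriv i (fun x => φ x * vn n x) x =
        vn n x * partialDeriv i φ x + φ x * partialDeriv i (vn n) x := by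
      rw [partialDeriv, show (fun x => φ x * vn n x) = φ * vn n from rfl, (h1.mul h2).fderiv]
      simp [partialDeriv]; ring
    rw [h3]
    -- The derivative of the mollified function is known only away from the boundary; elsewhere it
    -- is multiplied by `φ x = 0`.
    by_cases hx : x ∈ tsupport φ
    · rw [partialDeriv_mollify (ρ n) hΩ (hli hv0) (hv1 i).2]
      refine (Metric.closedBall_subset_closedBall (hρle n)).trans
        ((Metric.closedBall_subset_cthickening hx δ).trans hδΩ)
    · rw [image_eq_zero_of_notMem_tsupport hx]; simp
  have htest : ∀ n, IsTestFunction Ω (fun x => φ x * vn n x) := fun n =>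
    ⟨hφ.1.mul (hsm hv0 n), hφ.2.1.mul_right, (tsupport_mul_subset_left).trans hφ.2.2⟩
  obtain ⟨A, hA, hAV, hAg, hAv, hAD⟩ : ∃ A : ℝ, 0 ≤ A ∧
      (∀ᵐ x ∂(volume.restrict Ω), ∀ i, |V x i| ≤ A) ∧ (∀ᵐ x ∂(volume.restrict Ω), |g x| ≤ A) ∧
      (∀ᵐ x, ‖Ω.indicator v x‖ ≤ A) ∧ (∀ i, ∀ᵐ x, ‖Ω.indicator (Dv i) x‖ ≤ A) := by
    obtain ⟨A1, h1, h1'⟩ := exists_bound_of_memLp_top hV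
    obtain ⟨A2, h2, h2'⟩ := exists_bound_of_memLp_top hg
    obtain ⟨A3, h3, h3'⟩ := exists_bound_of_memLp_top (hind hv0)
    choose A4 h4 h4' using fun i => exists_bound_of_memLp_top (hind (hv1 i).1)
    have h5 : 0 ≤ ∑ i, A4 i := Finset.sum_nonneg fun i _ => h4 i
    refine ⟨A1 + A2 + A3 + ∑ i, A4 i, by positivity, ?_, ?_, ?_, fun i => ?_⟩
    · filter_upwards [h1'] with x hx i
      have := (PiLp.norm_apply_le (V x) i).trans hx
      rw [Real.norm_eq_abs] at this
      linarith
    · filter_upwards [h2'] with x hx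
      rw [Real.norm_eq_abs] at hx
      linarith
    · filter_upwards [h3'] with x hx
      linarith
    · filter_upwards [h4' i] with x hx
      have := Finset.single_le_sum (fun j _ => h4 j) (Finset.mem_univ i)
      linarith
  let F : ℕ → E d → ℝ := fun n x =>
    ∑ i, V x i * (vn n x * partialDeriv i φ x + φ x * Dn i n x) + g x * (φ x * vn n x)
  let F' : E d → ℝ := fun x =>
    ∑ i, V x i * (v x * partialDeriv i φ x + φ x * Dv i x) + g x * (φ x * v x)
  have hφc : Continuous φ := hφ.1.continuous
  have hφ1 : ContDiff ℝ 1 φ := hφ.1.of_le (by simp)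
  -- The weak divergence of `V` tested with `φ` times the mollified `v`.
  have hF0 : ∀ n, ∫ x in Ω, F n x = 0 := by
    intro n
    have h := hdiv.2.2 _ (htest n)
    simp only [hpd] at h
    have i1 : IntegrableOn (fun x => ∑ i, V x i *
        (vn n x * partialDeriv i φ x + φ x * Dn i n x)) Ω := by
      simp only [← hpd]
      exact integrable_finsetSum _ fun i _ =>
        (htest n).integrable_mul_partial (locallyIntegrableOn_component hdiv.1 i) i
    have i2 : IntegrableOn (fun x => g x * (φ x * vn n x)) Ω :=
      (htest n).integrable_mul hdiv.2.1
    rw [integral_add i1 i2, h]; ring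
  -- Mollifications converge almost everywhere and keep the uniform bounds, so dominated convergence
  -- applies.
  have hlimF : Tendsto (fun n => ∫ x in Ω, F n x) atTop (𝓝 (∫ x in Ω, F' x)) := by
    refine tendsto_integral_of_dominated_convergence
      (fun x => ∑ i, A * (A * |partialDeriv i φ x| + |φ x| * A) + A * (|φ x| * A)) ?_ ?_ ?_ ?_
    · intro n
      refine AEStronglyMeasurable.add (Finset.aestronglyMeasurable_fun_sum _ fun i _ => ?_) ?_
      · exact (hVi i).1.mul (((hsm hv0 n).continuous.mul (continuous_partialDeriv hφ1 i)).add
          (hφc.mul (hsm (hv1 i).1 n).continuous)).aestronglyMeasurable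
      · exact hg.1.mul (hφc.mul (hsm hv0 n).continuous).aestronglyMeasurable
    · refine Integrable.integrableOn ?_
      have hφi : Integrable (fun x => |φ x|) :=
        (hφc.integrable_of_hasCompactSupport hφ.2.1).abs
      refine (integrable_finsetSum _ fun i _ => ?_).add ((hφi.mul_const A).const_mul A)
      exact ((((continuous_partialDeriv hφ1 i).integrable_of_hasCompactSupport
        (hasCompactSupport_partialDeriv hφ.2.1 i)).abs.const_mul A).add (hφi.mul_const A)).const_mul A
    · intro n
      filter_upwards [hAV, hAg] with x hx1 hx2
      exact bound_sum_mul_add hA hx1 (fun i => norm_mollify_le (ρ n) (hAD i) x) hx2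
        (norm_mollify_le (ρ n) hAv x)
    · have c1 := ContDiffBump.ae_convolution_tendsto_right_of_locallyIntegrable (μ := volume)
        hρlim hρratio (hli hv0)
      have c2 : ∀ᵐ x, ∀ i, Tendsto (fun n => Dn i n x) atTop (𝓝 (Ω.indicator (Dv i) x)) :=
        ae_all_iff.2 fun i => ContDiffBump.ae_convolution_tendsto_right_of_locallyIntegrable
          (μ := volume) hρlim hρratio (hli (hv1 i).1)
      filter_upwards [ae_restrict_of_ae c1, ae_restrict_of_ae c2,
        ae_restrict_mem hΩ.measurableSet] with x h1 h2 hx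
      rw [Set.indicator_of_mem hx] at h1
      have h2' : ∀ i, Tendsto (fun n => Dn i n x) atTop (𝓝 (Dv i x)) := fun i => by
        simpa [Set.indicator_of_mem hx] using h2 i
      exact (tendsto_finsetSum _ fun i _ => ((h1.mul_const _).add
        ((h2' i).const_mul _)).const_mul _).add ((h1.const_mul _).const_mul _)
  have hF' : ∫ x in Ω, F' x = 0 := by
    refine tendsto_nhds_unique hlimF ?_
    simp only [hF0]
    exact tendsto_const_nhds
  have j1 : IntegrableOn (fun x => ∑ i, (v x • V x) i * partialDeriv i φ x) Ω :=
    integrable_finsetSum _ fun i _ =>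
      hφ.integrable_mul_partial (locallyIntegrableOn_component hloc1 i) i
  have j2 : IntegrableOn (fun x => (v x * g x + ∑ i, V x i * Dv i x) * φ x) Ω :=
    hφ.integrable_mul hloc2
  have hFeq : ∀ x, F' x = ∑ i, (v x • V x) i * partialDeriv i φ x +
      (v x * g x + ∑ i, V x i * Dv i x) * φ x := by
    intro x
    simp only [F', PiLp.smul_apply, smul_eq_mul, add_mul, Finset.sum_mul]
    rw [add_comm (v x * g x * φ x), ← add_assoc, ← Finset.sum_add_distrib]
    congr 1
    · exact Finset.sum_congr rfl fun i _ => by ring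
    · ring
  simp only [hFeq] at hF'
  rw [integral_add j1 j2] at hF'
  linarith

/-- A compactly supported field has divergence of mean zero. -/
theorem HasWeakDiv.integral_eq_zero (hΩ : IsOpen Ω) {V : E d → E d} {g : E d → ℝ}
    (h : HasWeakDiv Ω V g) {S : Set (E d)} (hS : IsCompact S) (hSΩ : S ⊆ Ω)
    (hV : ∀ x ∉ S, V x = 0) (hg : ∀ x ∉ S, g x = 0) : ∫ x in Ω, g x = 0 := by
  obtain ⟨δ, hδ, hδΩ⟩ := hS.exists_cthickening_subset_open hΩ hSΩ
  have hSc : IsCompact (Metric.cthickening (δ / 2) S) := hS.cthickening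
  -- A test function equal to one on a neighbourhood of `S`: its gradient vanishes on `S`, and the
  -- field vanishes off `S`.
  obtain ⟨f, hf1, hf0, -⟩ := exists_contMDiffMap_one_nhds_of_subset_interior
    (n := (⊤ : ℕ∞)) (modelWithCornersSelf ℝ (E d)) (s := S) (t := Metric.cthickening (δ / 2) S)
    hS.isClosed ((Metric.self_subset_thickening (by positivity) S).trans
      (Metric.thickening_subset_interior_cthickening _ _))
  have hsupp : tsupport (f : E d → ℝ) ⊆ Metric.cthickening (δ / 2) S := by
    refine closure_minimal (fun x hx => ?_) hSc.isClosed
    by_contra hc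
    exact hx (hf0 x hc)
  have htest : IsTestFunction Ω f := ⟨f.contMDiff.contDiff, hSc.of_isClosed_subset
    (isClosed_tsupport _) hsupp, hsupp.trans ((Metric.cthickening_mono (by linarith) S).trans hδΩ)⟩
  have key := h.2.2 f htest
  have e1 : ∀ x, ∑ i, V x i * partialDeriv i f x = 0 := by
    intro x
    by_cases hx : x ∈ S
    · refine Finset.sum_eq_zero fun i _ => ?_
      have : (f : E d → ℝ) =ᶠ[𝓝 x] fun _ => 1 := hf1.filter_mono (nhds_le_nhdsSet hx)
      rw [partialDeriv, this.fderiv_eq]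
      simp
    · simp [hV x hx]
  have e2 : ∀ x, g x * f x = g x := by
    intro x
    by_cases hx : x ∈ S
    · rw [(hf1.filter_mono (nhds_le_nhdsSet hx)).self_of_nhds, mul_one]
    · simp [hg x hx]
  simp only [e1, e2, integral_zero] at key
  linarith

/-- Where a field is continuously differentiable its weak divergence is the classical one. -/
theorem HasWeakDiv.ae_eq_of_contDiff {V : E d → E d} {g : E d → ℝ} (h : HasWeakDiv Ω V g)
    {U : Set (E d)} (hU : IsOpen U) (hUΩ : U ⊆ Ω) {W : Fin d → E d → ℝ}
    (hW : ∀ i, ContDiff ℝ 1 (W i)) (hVW : ∀ x ∈ U, ∀ i, V x i = W i x) :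
    ∀ᵐ x, x ∈ U → g x = ∑ i, partialDeriv i (W i) x := by
  have hcont : Continuous (fun x => ∑ i, partialDeriv i (W i) x) :=
    continuous_finsetSum _ fun i _ => continuous_partialDeriv (hW i) i
  have hloc : LocallyIntegrableOn (fun x => g x - ∑ i, partialDeriv i (W i) x) U :=
    (h.2.1.mono_set hUΩ).sub (hcont.locallyIntegrable.locallyIntegrableOn U)
  -- The fundamental lemma of the calculus of variations, applied to the difference of the weak and
  -- the classical divergence.
  have key := hU.ae_eq_zero_of_integral_contDiff_smul_eq_zero hloc ?_
  · filter_upwards [key] with x hx hxU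
    exact sub_eq_zero.1 (hx hxU)
  intro φ hφ hφc hφU
  have htest : IsTestFunction Ω φ := ⟨hφ, hφc, hφU.trans hUΩ⟩
  have hφ1 : ContDiff ℝ 1 φ := hφ.of_le (by simp)
  have key := h.2.2 φ htest
  have hout : ∀ x ∉ U, φ x = 0 := fun x hx => image_eq_zero_of_notMem_tsupport fun h => hx (hφU h)
  have hout' : ∀ x ∉ U, ∀ i, partialDeriv i φ x = 0 := fun x hx i =>
    partialDeriv_eq_zero_of_notMem_tsupport (fun h => hx (hφU h)) i
  rw [setIntegral_eq_integral_of_forall_compl_eq_zero, setIntegral_eq_integral_of_forall_compl_eq_zero]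
    at key
  rotate_left
  · intro x hx
    rw [hout x fun h => hx (hUΩ h), mul_zero]
  · intro x hx
    exact Finset.sum_eq_zero fun i _ => by rw [hout' x (fun h => hx (hUΩ h)) i, mul_zero]
  have e1 : ∀ x, ∑ i, V x i * partialDeriv i φ x = ∑ i, W i x * partialDeriv i φ x := by
    intro x
    refine Finset.sum_congr rfl fun i _ => ?_
    by_cases hx : x ∈ U
    · rw [hVW x hx]
    · rw [hout' x hx, mul_zero, mul_zero]
  simp only [e1] at key
  have i1 : ∀ i, Integrable (fun x => W i x * partialDeriv i φ x) := fun i =>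
    ((hW i).continuous.mul (continuous_partialDeriv hφ1 i)).integrable_of_hasCompactSupport
      (hasCompactSupport_partialDeriv hφc i).mul_left
  have i2 : ∀ i, Integrable (fun x => partialDeriv i (W i) x * φ x) := fun i =>
    ((continuous_partialDeriv (hW i) i).mul hφ.continuous).integrable_of_hasCompactSupport
      hφc.mul_left
  rw [integral_finsetSum _ fun i _ => i1 i] at key
  have e2 : ∀ i, ∫ x, W i x * partialDeriv i φ x = - ∫ x, partialDeriv i (W i) x * φ x := fun i =>
    integral_mul_fderiv_eq_neg_fderiv_mul_of_integrable (i2 i) (i1 i)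
      (((hW i).continuous.mul hφ.continuous).integrable_of_hasCompactSupport hφc.mul_left)
      (fun x _ => ((hW i).differentiable one_ne_zero) x)
      (fun x _ => (hφ1.differentiable one_ne_zero) x)
  simp only [e2] at key
  rw [Finset.sum_neg_distrib, ← integral_finsetSum _ fun i _ => i2 i, neg_inj] at key
  have i3 : Integrable (fun x => g x * φ x) := by
    have := htest.integrable_mul h.2.1
    refine (integrableOn_iff_integrable_of_support_subset ?_).1 this
    intro x hx
    by_contra hc
    exact hx (by
      change g x * φ x = 0
      rw [hout x fun h => hc (hUΩ h), mul_zero])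
  have e3 : ∀ x, φ x • (g x - ∑ i, partialDeriv i (W i) x) =
      g x * φ x - ∑ i, partialDeriv i (W i) x * φ x := by
    intro x
    rw [smul_eq_mul, ← Finset.sum_mul]; ring
  simp only [e3]
  rw [integral_sub i3 (integrable_finsetSum _ fun i _ => i2 i), key, sub_self]

/-- Weak partial derivatives as weak divergences. -/
theorem HasWeakPartial.hasWeakDiv_single {f g : E d → ℝ} {i : Fin d} (h : HasWeakPartial Ω i f g) :
    HasWeakDiv Ω (fun x => f x • (EuclideanSpace.single i 1 : E d)) g := by
  refine ⟨?_, h.2.1, fun φ hφ => ?_⟩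
  · intro x hx
    obtain ⟨U, hU, hfU⟩ := h.1 x hx
    exact ⟨U, hU, (ContinuousLinearMap.toSpanSingleton ℝ
      (EuclideanSpace.single i 1 : E d)).integrable_comp hfU⟩
  · rw [← h.2.2 φ hφ]
    congr 1
    ext x
    rw [Finset.sum_eq_single i]
    · simp
    · intro j _ hj
      simp [hj]
    · simp

/-- The divergence of a field with weakly differentiable components. -/
theorem hasWeakDiv_of_partial {V : E d → E d} {D : Fin d → E d → ℝ}
    (hV : LocallyIntegrableOn V Ω) (h : ∀ i, HasWeakPartial Ω i (fun x => V x i) (D i)) :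
    HasWeakDiv Ω V (fun x => ∑ i, D i x) := by
  refine ⟨hV, ?_, fun φ hφ => ?_⟩
  · have hs : ∀ s : Finset (Fin d), LocallyIntegrableOn (fun x => ∑ i ∈ s, D i x) Ω := by
      classical
      intro s
      induction s using Finset.induction_on with
      | empty =>
        simp only [Finset.sum_empty]
        exact locallyIntegrable_zero.locallyIntegrableOn Ω
      | insert a s ha ih =>
        simp only [Finset.sum_insert ha]
        exact (h a).2.1.add ih
    exact hs Finset.univ
  · rw [integral_finsetSum _ fun i _ => hφ.integrable_mul_partial (h i).1 i]
    simp only [Finset.sum_mul]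
    rw [integral_finsetSum _ fun i _ => hφ.integrable_mul (h i).2.1, ← Finset.sum_neg_distrib]
    exact Finset.sum_congr rfl fun i _ => (h i).2.2 φ hφ

/-- Bounded Lipschitz functions are in `W^{1,∞}`. -/
theorem memW1Infty_of_lipschitz {f : E d → ℝ} {C : NNReal}
    (hf : LipschitzWith C f) {M : ℝ} (hM : ∀ x, ‖f x‖ ≤ M) :
    MemW1Infty Ω f (fun i x => lineDeriv ℝ f x (EuclideanSpace.single i 1)) := by
  have h1 : ∀ i : Fin d, MemLp (fun x => lineDeriv ℝ f x (EuclideanSpace.single i 1)) ∞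
      (volume.restrict Ω) := fun i => (hf.memLp_lineDeriv _).restrict Ω
  have h0 : MemLp f ∞ (volume.restrict Ω) :=
    memLp_top_of_bound hf.continuous.aestronglyMeasurable M (Eventually.of_forall hM)
  refine ⟨h0, fun i => ⟨h1 i, MemLp.locallyIntegrableOn_of_top le_top h0,
    MemLp.locallyIntegrableOn_of_top le_top (h1 i), fun φ hφ => ?_⟩⟩
  have hφ1 : ContDiff ℝ 1 φ := hφ.1.of_le (by simp)
  obtain ⟨D, hD⟩ := hφ1.lipschitzWith_of_hasCompactSupport hφ.2.1 one_ne_zero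
  -- Integration by parts for Lipschitz functions; the derivative of `φ` appears in the direction
  -- `-e_i`, which is the minus sign in `HasWeakPartial`.
  have key := hf.integral_lineDeriv_mul_eq (μ := volume) hD hφ.2.1 (EuclideanSpace.single i 1)
  have e : ∀ x, lineDeriv ℝ φ x (-EuclideanSpace.single i 1) = - partialDeriv i φ x := fun x => by
    rw [((hφ1.differentiable one_ne_zero) x).lineDeriv_eq_fderiv, map_neg, partialDeriv]
  have hz : ∀ x ∉ Ω, φ x = 0 := fun x hx =>
    image_eq_zero_of_notMem_tsupport fun h => hx (hφ.2.2 h)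
  have hz' : ∀ x ∉ Ω, partialDeriv i φ x = 0 := fun x hx =>
    partialDeriv_eq_zero_of_notMem_tsupport (fun h => hx (hφ.2.2 h)) i
  rw [setIntegral_eq_integral_of_forall_compl_eq_zero (fun x hx => by rw [hz' x hx, mul_zero]),
    setIntegral_eq_integral_of_forall_compl_eq_zero (fun x hx => by rw [hz x hx, mul_zero]), key,
    ← integral_neg]
  congr 1
  ext x
  rw [e]; ring

end Weak

/-! ### Coordinates adapted to a face -/

section Chart

open Filter Topology

variable {d : ℕ}

/-- `L` parametrizes the hyperplane orthogonal to the unit vector `n`. -/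
structure IsPlaneChart [NeZero d] (n : E d) (L : E (d - 1) →ₗᵢ[ℝ] E d) : Prop where
  norm_normal : ‖n‖ = 1
  inner_eq_zero : ∀ w, inner ℝ n (L w) = 0
  surj : ∀ x, inner ℝ n x = 0 → ∃ w, L w = x

/-- An orthonormal basis of the complement of the normal, which has dimension `d - 1`. -/
theorem exists_isPlaneChart [NeZero d] {n : E d} (hn : ‖n‖ = 1) :
    ∃ L : E (d - 1) →ₗᵢ[ℝ] E d, IsPlaneChart n L := by
  have hfin : Module.finrank ℝ (Submodule.span ℝ {n})ᗮ = d - 1 := by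
    have hn0 : n ≠ 0 := by rintro rfl; simp at hn
    have h1 := Submodule.finrank_add_finrank_orthogonal (Submodule.span ℝ {n})
    rw [finrank_span_singleton hn0] at h1
    simp only [finrank_euclideanSpace, Fintype.card_fin] at h1
    omega
  let e : (Submodule.span ℝ {n})ᗮ ≃ₗᵢ[ℝ] E (d - 1) := 
    ((stdOrthonormalBasis ℝ (Submodule.span ℝ {n})ᗮ).reindex (finCongr hfin)).repr
  refine ⟨(Submodule.span ℝ {n})ᗮ.subtypeₗᵢ.comp e.symm.toLinearIsometry, hn, fun w => ?_,
    fun x hx => ?_⟩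
  · exact (Submodule.mem_orthogonal_singleton_iff_inner_right).1 (e.symm w).2
  · exact ⟨e ⟨x, (Submodule.mem_orthogonal_singleton_iff_inner_right).2 hx⟩, by simp⟩

/-- The point at depth `s` below the point `p + L w` of a hyperplane. -/
def stripMap (p n : E d) (L : E (d - 1) →ₗᵢ[ℝ] E d) (z : E (d - 1) × ℝ) : E d :=
  p + L z.1 - z.2 • n

theorem continuous_stripMap {p n : E d} {L : E (d - 1) →ₗᵢ[ℝ] E d} :
    Continuous (stripMap p n L) := by
  unfold stripMap
  fun_prop

theorem isometry_add_chart (p : E d) (L : E (d - 1) →ₗᵢ[ℝ] E d) : Isometry (fun w => p + L w) :=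
  (IsometryEquiv.addLeft p).isometry.comp L.isometry

variable [NeZero d] {p n : E d} {L : E (d - 1) →ₗᵢ[ℝ] E d}

theorem IsPlaneChart.norm_sq (h : IsPlaneChart n L) (w : E (d - 1)) (s : ℝ) :
    ‖L w - s • n‖ ^ 2 = ‖w‖ ^ 2 + s ^ 2 := by
  rw [norm_sub_sq_real, inner_smul_right, real_inner_comm, h.inner_eq_zero, norm_smul,
    h.norm_normal, L.norm_map]
  simp

/-- With the Euclidean norm on the product, the map is an affine isometry between spaces of equal
dimension. This makes Fubini's theorem available in layers along a face. -/
theorem IsPlaneChart.measurePreserving (h : IsPlaneChart n L) (p : E d) :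
    MeasurePreserving (stripMap p n L) (volume.prod volume) volume := by
  let A : WithLp 2 (E (d - 1) × ℝ) →ₗ[ℝ] E d :=
    { toFun := fun z => L z.fst - z.snd • n
      map_add' := fun x y => by simp [add_smul]; abel
      map_smul' := fun a x => by simp [smul_sub, mul_smul] }
  let Ai : WithLp 2 (E (d - 1) × ℝ) →ₗᵢ[ℝ] E d := ⟨A, fun z => by
    have h1 : ‖A z‖ ^ 2 = ‖z‖ ^ 2 := by
      rw [WithLp.prod_norm_sq_eq_of_L2]
      change ‖L z.fst - z.snd • n‖ ^ 2 = _
      rw [h.norm_sq]; simp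
    exact (sq_eq_sq₀ (norm_nonneg _) (norm_nonneg _)).1 h1⟩
  have hdim : Module.finrank ℝ (WithLp 2 (E (d - 1) × ℝ)) = Module.finrank ℝ (E d) := by
    rw [(WithLp.linearEquiv 2 ℝ (E (d - 1) × ℝ)).finrank_eq, Module.finrank_prod]
    have : 0 < d := Nat.pos_of_ne_zero (NeZero.ne d)
    simp only [finrank_euclideanSpace, Fintype.card_fin, Module.finrank_self]
    omega
  have h1 := (Ai.toLinearIsometryEquiv hdim).measurePreserving
  have h2 := (h1.comp (WithLp.volume_preserving_toLp (U := E (d - 1)) (V := ℝ)))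
  have h3 := (measurePreserving_add_left (volume : Measure (E d)) p).comp h2
  rw [← Measure.volume_eq_prod]
  convert h3 using 1
  ext z i
  simp [stripMap, Ai, A]
  ring

theorem IsPlaneChart.injective (h : IsPlaneChart n L) (p : E d) :
    Function.Injective (stripMap p n L) := by
  rintro ⟨w, s⟩ ⟨w', s'⟩ hz
  have h1 : L (w - w') - (s - s') • n = 0 := by
    simp only [stripMap] at hz
    rw [map_sub, sub_smul]
    have : p + L w - s • n - (p + L w' - s' • n) = 0 := sub_eq_zero.2 hz
    rw [← this]; abel
  have h2 := h.norm_sq (w - w') (s - s')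
  rw [h1] at h2
  simp only [norm_zero, ne_eq, OfNat.ofNat_ne_zero, not_false_eq_true, zero_pow] at h2
  have h3 : ‖w - w'‖ = 0 := by
    have := sq_nonneg (s - s'); have := sq_nonneg ‖w - w'‖
    exact pow_eq_zero_iff (two_ne_zero) |>.1 (by linarith)
  have h4 : s - s' = 0 := by
    have := sq_nonneg (s - s'); have := sq_nonneg ‖w - w'‖
    exact pow_eq_zero_iff (two_ne_zero) |>.1 (by linarith)
  rw [norm_eq_zero, sub_eq_zero] at h3
  rw [h3, sub_eq_zero.1 h4]

theorem IsPlaneChart.measurableEmbedding (h : IsPlaneChart n L) (p : E d) :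
    MeasurableEmbedding (stripMap p n L) :=
  continuous_stripMap.measurableEmbedding (h.injective p)

theorem IsPlaneChart.exists_stripMap (h : IsPlaneChart n L) (p x : E d) :
    ∃ w, stripMap p n L (w, - inner ℝ n (x - p)) = x := by
  obtain ⟨w, hw⟩ := h.surj (x - p - inner ℝ n (x - p) • n) (by
    rw [inner_sub_right, inner_smul_right, real_inner_self_eq_norm_sq, h.norm_normal]; ring)
  refine ⟨w, ?_⟩
  simp only [stripMap, hw]
  module

variable {K : Affine.Simplex ℝ (E d) d} {i : Fin (d + 1)}

/-- The part of the parameter domain that corresponds to a set. -/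
def chartPreimage (p : E d) (L : E (d - 1) →ₗᵢ[ℝ] E d) (S : Set (E d)) : Set (E (d - 1)) :=
  (fun w => p + L w) ⁻¹' S

theorem isCompact_chartPreimage {S : Set (E d)} (hS : IsCompact S) :
    IsCompact (chartPreimage p L S) :=
  (isometry_add_chart p L).isClosedEmbedding.isCompact_preimage hS

theorem face_subset_range (h : IsPlaneChart (outwardNormal K i) L) (hp : bary K i p = 0)
    {y : E d} (hy : bary K i y = 0) : ∃ w, p + L w = y := by
  have h1 := height_mul_bary_of_bary_eq_zero K i (x := y) hp
  rw [hy, mul_zero] at h1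
  obtain ⟨w, hw⟩ := h.surj (y - p) (by linarith)
  exact ⟨w, by rw [hw]; abel⟩

theorem bary_stripMap (h : IsPlaneChart (outwardNormal K i) L) (hp : bary K i p = 0)
    (w : E (d - 1)) (s : ℝ) :
    K.height i * bary K i (stripMap p (outwardNormal K i) L (w, s)) = s := by
  rw [height_mul_bary_of_bary_eq_zero K i hp]
  have : stripMap p (outwardNormal K i) L (w, s) - p = L w - s • outwardNormal K i := by
    simp only [stripMap]; abel
  rw [this, inner_sub_right, h.inner_eq_zero, inner_smul_right, real_inner_self_eq_norm_sq,
    norm_outwardNormal]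
  ring

/-- Isometries transport the normalized Hausdorff measure, which is Lebesgue measure on `E (d - 1)`.
-/
theorem restrict_face_eq (h : IsPlaneChart (outwardNormal K i) L) (hp : bary K i p = 0) :
    (μHE[d - 1] : Measure (E d)).restrict (face K i) =
      Measure.map (fun w => p + L w) (volume.restrict (chartPreimage p L (face K i))) := by
  have hiso := isometry_add_chart p L
  have hemb := hiso.isClosedEmbedding.measurableEmbedding
  have h1 := hiso.map_euclideanHausdorffMeasure (d := d - 1)
  rw [EuclideanSpace.euclideanHausdorffMeasure_eq_volume] at h1
  rw [chartPreimage, ← hemb.restrict_map, h1,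
    Measure.restrict_restrict (isCompact_face K i).measurableSet, Set.inter_eq_left.2]
  intro y hy
  obtain ⟨w, hw⟩ := face_subset_range h hp ((mem_face_iff K).1 hy).1
  exact ⟨w, hw⟩

theorem setIntegral_face_eq (h : IsPlaneChart (outwardNormal K i) L) (hp : bary K i p = 0)
    (f : E d → ℝ) : ∫ x in face K i, f x ∂(μHE[d - 1] : Measure (E d)) =
      ∫ w in chartPreimage p L (face K i), f (p + L w) := by
  rw [restrict_face_eq h hp]
  exact (isometry_add_chart p L).isClosedEmbedding.measurableEmbedding.integral_map _

theorem exists_bary_eq_zero (K : Affine.Simplex ℝ (E d) d) (i : Fin (d + 1)) :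
    ∃ p, bary K i p = 0 := by
  refine ⟨K.altitudeFoot i, ?_⟩
  have := height_mul_bary K i (K.altitudeFoot i)
  rw [sub_self, inner_zero_right, neg_zero] at this
  exact (mul_eq_zero.1 this).resolve_left (K.height_pos i).ne'

/-- The measure of a face is controlled by the diameter of the cell. -/
theorem measure_face_le (K : Affine.Simplex ℝ (E d) d) (i : Fin (d + 1)) :
    (μHE[d - 1] : Measure (E d)) (face K i) ≤
      ENNReal.ofReal (Metric.diam K.closedInterior ^ (d - 1)) *
        volume (Metric.ball (0 : E (d - 1)) 1) := by
  obtain ⟨L, h⟩ := exists_isPlaneChart (norm_outwardNormal K i)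
  obtain ⟨p, hp⟩ := exists_bary_eq_zero K i
  have h1 : (μHE[d - 1] : Measure (E d)) (face K i) = volume (chartPreimage p L (face K i)) := by
    have := congrArg (fun μ => μ Set.univ) (restrict_face_eq h hp)
    simp only [Measure.restrict_apply_univ] at this
    rw [this, Measure.map_apply (isometry_add_chart p L).continuous.measurable MeasurableSet.univ]
    simp
  rw [h1]
  by_cases hne : (chartPreimage p L (face K i)).Nonempty
  · obtain ⟨w0, hw0⟩ := hne
    -- The isometric copy of the face fits into a ball of `E (d - 1)` whose radius is the diameter
    -- of the cell.
    have hsub : chartPreimage p L (face K i) ⊆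
        Metric.closedBall w0 (Metric.diam K.closedInterior) := by
      intro w hw
      rw [Metric.mem_closedBall, ← (isometry_add_chart p L).dist_eq]
      exact Metric.dist_le_diam_of_mem (isCompact_closedInterior K).isBounded
        (face_subset K i hw) (face_subset K i hw0)
    refine (measure_mono hsub).trans ?_
    rw [Measure.addHaar_closedBall _ _ Metric.diam_nonneg]
    simp
  · rw [Set.not_nonempty_iff_eq_empty.1 hne]; simp

theorem measure_face_lt_top (K : Affine.Simplex ℝ (E d) d) (i : Fin (d + 1)) :
    (μHE[d - 1] : Measure (E d)) (face K i) < ∞ :=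
  (measure_face_le K i).trans_lt (ENNReal.mul_lt_top ENNReal.ofReal_lt_top measure_ball_lt_top)

/-! ### Strips along the boundary -/

/-- The points at depth between `δ` and `2δ` below a face. -/
def strip (K : Affine.Simplex ℝ (E d) d) (i : Fin (d + 1)) (δ : ℝ) : Set (E d) :=
  (fun z : E d × ℝ => z.1 - z.2 • outwardNormal K i) '' (face K i ×ˢ Set.Icc δ (2 * δ))

theorem isCompact_strip (K : Affine.Simplex ℝ (E d) d) (i : Fin (d + 1)) (δ : ℝ) :
    IsCompact (strip K i δ) :=
  ((isCompact_face K i).prod isCompact_Icc).image (by fun_prop)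

theorem strip_eq (h : IsPlaneChart (outwardNormal K i) L) (hp : bary K i p = 0) (δ : ℝ) :
    strip K i δ = stripMap p (outwardNormal K i) L ''
      (chartPreimage p L (face K i) ×ˢ Set.Icc δ (2 * δ)) := by
  ext x
  constructor
  · rintro ⟨⟨y, s⟩, ⟨hy, hs⟩, rfl⟩
    obtain ⟨w, hw⟩ := face_subset_range h hp ((mem_face_iff K).1 hy).1
    refine ⟨(w, s), ⟨?_, hs⟩, ?_⟩
    · change p + L w ∈ face K i
      rw [hw]; exact hy
    · simp only [stripMap, hw]
  · rintro ⟨⟨w, s⟩, ⟨hw, hs⟩, rfl⟩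
    exact ⟨(p + L w, s), ⟨hw, hs⟩, rfl⟩

open Classical in
/-- `g` inside the cell, and the constant `Λ` outside. -/
def cellOr (K : Affine.Simplex ℝ (E d) d) (g : E d → ℝ) (Λ : ℝ) : E d → ℝ :=
  K.interior.piecewise g fun _ => Λ

theorem measurable_cellOr {g : E d → ℝ} (hg : ContinuousOn g K.closedInterior) (Λ : ℝ) :
    Measurable (cellOr K g Λ) := by
  classical
  exact (hg.mono K.interior_subset_closedInterior).measurable_piecewise continuousOn_const
    (isOpen_interior K).measurableSet

theorem exists_bound_cellOr {g : E d → ℝ} (hg : ContinuousOn g K.closedInterior) (Λ : ℝ) :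
    ∃ B, 0 ≤ B ∧ ∀ x, ‖cellOr K g Λ x‖ ≤ B := by
  obtain ⟨B, hB⟩ := (isCompact_closedInterior K).exists_bound_of_continuousOn hg
  classical
  refine ⟨max B |Λ|, le_max_of_le_right (abs_nonneg _), fun x => ?_⟩
  by_cases hx : x ∈ K.interior
  · rw [cellOr, Set.piecewise_eq_of_mem _ _ _ hx]
    exact (hB x (K.interior_subset_closedInterior hx)).trans (le_max_left _ _)
  · rw [cellOr, Set.piecewise_eq_of_notMem _ _ _ hx]
    exact le_max_right _ _

/-- The zero set is an affine subspace that misses `w`, hence a proper one. -/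
theorem volume_coord_eq_zero {m : ℕ} (f : E m →ᵃ[ℝ] ℝ) {w : E m} (hw : f w ≠ 0) :
    volume {x | f x = 0} = 0 := by
  let S : AffineSubspace ℝ (E m) := (AffineSubspace.mk' (0 : ℝ) ⊥).comap f
  have hS : (S : Set (E m)) = {x | f x = 0} := by
    ext x
    simp [S]
  rw [← hS]
  apply Measure.addHaar_affineSubspace
  intro htop
  apply hw
  have : w ∈ (S : Set (E m)) := by rw [htop]; trivial
  rwa [hS] at this

/-- The vertex `j` lies in the plane of the face opposite to `i`, and its own coordinate is one
there, so the coordinate does not vanish identically on this plane. -/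
theorem volume_chartPreimage_edge (h : IsPlaneChart (outwardNormal K i) L) (hp : bary K i p = 0)
    {j : Fin (d + 1)} (hj : j ≠ i) :
    volume (chartPreimage p L {y | bary K j y = 0}) = 0 := by
  obtain ⟨w, hw⟩ := face_subset_range h hp (bary_points_ne K hj.symm)
  let f : E (d - 1) →ᵃ[ℝ] ℝ := (bary K j).comp
    (AffineMap.const ℝ (E (d - 1)) p + L.toLinearMap.toAffineMap)
  have hf : ∀ w, f w = bary K j (p + L w) := fun w => rfl
  exact volume_coord_eq_zero f (w := w) (by rw [hf, hw, bary_points_self]; exact one_ne_zero)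

/-- The averages over thin strips converge to the integral over the face. -/
theorem tendsto_strip (K : Affine.Simplex ℝ (E d) d) (i : Fin (d + 1)) {g : E d → ℝ}
    (hg : ContinuousOn g K.closedInterior) (Λ : ℝ) {δ : ℕ → ℝ} (hδ : ∀ k, 0 < δ k)
    (hδ0 : Tendsto δ atTop (𝓝 0)) :
    Tendsto (fun k => (δ k)⁻¹ * ∫ x in strip K i (δ k), cellOr K g Λ x) atTop
      (𝓝 (∫ x in face K i, g x ∂(μHE[d - 1] : Measure (E d)))) := by
  obtain ⟨L, h⟩ := exists_isPlaneChart (norm_outwardNormal K i)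
  obtain ⟨p, hp⟩ := exists_bary_eq_zero K i
  set n := outwardNormal K i with hn
  set F' := chartPreimage p L (face K i) with hF'
  have hF'c : IsCompact F' := isCompact_chartPreimage (isCompact_face K i)
  obtain ⟨B, hB0, hB⟩ := exists_bound_cellOr hg Λ
  have hmeas := measurable_cellOr (K := K) hg Λ
  have hmeas' : Measurable fun z => cellOr K g Λ (stripMap p n L z) :=
    hmeas.comp continuous_stripMap.measurable
  have hvol : ∀ k, (volume : Measure ℝ).real (Set.Icc (δ k) (2 * δ k)) = δ k := fun k => by
    rw [Real.volume_real_Icc_of_le (by linarith [hδ k])]; ring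
  -- Fubini in the chart: the strip is the product of the face and an interval of length `δ k`.
  have e1 : ∀ k, (δ k)⁻¹ * ∫ x in strip K i (δ k), cellOr K g Λ x =
      ∫ w in F', (δ k)⁻¹ * ∫ s in Set.Icc (δ k) (2 * δ k), cellOr K g Λ (stripMap p n L (w, s)) := by
    intro k
    rw [integral_const_mul, strip_eq h hp,
      (h.measurePreserving p).setIntegral_image_emb (h.measurableEmbedding p),
      setIntegral_prod]
    refine Integrable.mono' (g := fun _ => B) ?_ hmeas'.aestronglyMeasurable
      (Eventually.of_forall fun z => hB _)
    refine integrableOn_const ?_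
    rw [Measure.prod_prod]
    exact (ENNReal.mul_lt_top hF'c.measure_lt_top isCompact_Icc.measure_lt_top).ne
  simp only [e1]
  rw [setIntegral_face_eq h hp]
  refine tendsto_integral_of_dominated_convergence (fun _ => B) ?_ ?_ ?_ ?_
  · intro k
    refine AEStronglyMeasurable.const_mul ?_ _
    exact (hmeas'.stronglyMeasurable.integral_prod_right'
      (ν := volume.restrict (Set.Icc (δ k) (2 * δ k)))).aestronglyMeasurable
  · exact integrableOn_const hF'c.measure_lt_top.ne
  · intro k
    refine Eventually.of_forall fun w => ?_
    rw [norm_mul, norm_inv, Real.norm_of_nonneg (hδ k).le]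
    have := norm_setIntegral_le_of_norm_le_const (μ := volume) (s := Set.Icc (δ k) (2 * δ k))
      (f := fun s => cellOr K g Λ (stripMap p n L (w, s))) (C := B)
      isCompact_Icc.measure_lt_top (fun s _ => hB _)
    rw [hvol] at this
    rw [inv_mul_le_iff₀ (hδ k)]
    linarith
  -- Almost every point of the face is off its edges. There the inner normal enters the open cell,
  -- so the constant outside of the cell plays no role for small depth.
  · have hnull : ∀ᵐ w, ∀ j, j ≠ i → bary K j (p + L w) ≠ 0 := by
      rw [ae_all_iff]
      intro j
      by_cases hj : j = i
      · simp [hj]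
      · have := volume_chartPreimage_edge h hp hj
        filter_upwards [compl_mem_ae_iff.2 this] with w hw _ using hw
    filter_upwards [ae_restrict_of_ae hnull, ae_restrict_mem hF'c.measurableSet] with w hw hwF
    have hface := (mem_face_iff K).1 (show p + L w ∈ face K i from hwF)
    have hpos : ∀ j, j ≠ i → 0 < bary K j (p + L w) := fun j hj =>
      lt_of_le_of_ne (hface.2 j) (hw j hj).symm
    -- along the inner normal the points are in the cell, and `g` converges
    have hcs : Continuous fun s : ℝ => stripMap p n L (w, s) :=
      continuous_stripMap.comp (by fun_prop)
    have hs0 : stripMap p n L (w, 0) = p + L w := by simp [stripMap]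
    have hin : ∀ᶠ s in 𝓝[>] (0 : ℝ), stripMap p n L (w, s) ∈ K.interior := by
      have : ∀ j, ∀ᶠ s in 𝓝[>] (0 : ℝ), 0 < bary K j (stripMap p n L (w, s)) := by
        intro j
        by_cases hj : j = i
        · filter_upwards [self_mem_nhdsWithin] with s hs
          have h1 := bary_stripMap h hp w s
          rw [hj]
          have h2 := K.height_pos i
          have h3 : 0 < K.height i * bary K i (stripMap p n L (w, s)) := by rw [h1]; exact hs
          exact (pos_iff_pos_of_mul_pos h3).1 h2
        · have hc := ((continuous_bary K j).comp hcs).tendsto 0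
          simp only [Function.comp_apply, hs0] at hc
          exact (hc.eventually (lt_mem_nhds (hpos j hj))).filter_mono nhdsWithin_le_nhds
      filter_upwards [eventually_all.2 this] with s hs
      exact (mem_interior_iff K).2 hs
    have hlim : Tendsto (fun s => cellOr K g Λ (stripMap p n L (w, s))) (𝓝[>] 0)
        (𝓝 (g (p + L w))) := by
      have h1 : Tendsto (fun s : ℝ => stripMap p n L (w, s)) (𝓝[>] 0)
          (𝓝[K.closedInterior] (p + L w)) := by
        refine tendsto_nhdsWithin_iff.2 ⟨?_, ?_⟩
        · rw [← hs0]
          exact (hcs.tendsto 0).mono_left nhdsWithin_le_nhds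
        · filter_upwards [hin] with s hs using K.interior_subset_closedInterior hs
      have h2 := (hg (p + L w) (face_subset K i hwF)).tendsto.comp h1
      refine h2.congr' ?_
      filter_upwards [hin] with s hs
      simp [cellOr, hs]
    rw [Metric.tendsto_atTop]
    intro ε hε
    obtain ⟨a, ha, haε⟩ := (mem_nhdsGT_iff_exists_Ioo_subset).1
      (hlim.eventually (Metric.ball_mem_nhds _ (half_pos hε)))
    obtain ⟨N, hN⟩ := (Metric.tendsto_atTop.1 hδ0) (a / 2) (half_pos ha)
    refine ⟨N, fun k hk => ?_⟩
    have hka := hN k hk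
    rw [Real.dist_eq, sub_zero, abs_of_pos (hδ k)] at hka
    have hinteg : IntegrableOn (fun s => cellOr K g Λ (stripMap p n L (w, s)))
        (Set.Icc (δ k) (2 * δ k)) := by
      refine Integrable.mono' (g := fun _ => B) (integrableOn_const isCompact_Icc.measure_lt_top.ne)
        (hmeas.comp hcs.measurable).aestronglyMeasurable (Eventually.of_forall fun z => hB _)
    have hdiff : (δ k)⁻¹ * (∫ s in Set.Icc (δ k) (2 * δ k), cellOr K g Λ (stripMap p n L (w, s))) -
        g (p + L w) = (δ k)⁻¹ * ∫ s in Set.Icc (δ k) (2 * δ k),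
          (cellOr K g Λ (stripMap p n L (w, s)) - g (p + L w)) := by
      rw [integral_sub hinteg (integrableOn_const isCompact_Icc.measure_lt_top.ne),
        setIntegral_const, hvol]
      have := (hδ k).ne'
      simp only [smul_eq_mul]
      field_simp
    rw [Real.dist_eq, hdiff, abs_mul, abs_inv, abs_of_pos (hδ k)]
    have hle := norm_setIntegral_le_of_norm_le_const (μ := volume) (s := Set.Icc (δ k) (2 * δ k))
      (f := fun s => cellOr K g Λ (stripMap p n L (w, s)) - g (p + L w)) (C := ε / 2)
      isCompact_Icc.measure_lt_top (fun s hs => by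
        have : s ∈ Set.Ioo 0 a := ⟨(hδ k).trans_le hs.1, hs.2.trans_lt (by linarith)⟩
        have h' : dist _ _ < _ := haε this
        rw [Real.dist_eq] at h'
        exact h'.le)
    rw [hvol, Real.norm_eq_abs] at hle
    calc (δ k)⁻¹ * _ ≤ (δ k)⁻¹ * (ε / 2 * δ k) :=
          mul_le_mul_of_nonneg_left hle (inv_nonneg.2 (hδ k).le)
      _ = ε / 2 := by have := (hδ k).ne'; field_simp
      _ < ε := half_lt_self hε

/-- The part of a face where a further barycentric coordinate vanishes. -/
def edge (K : Affine.Simplex ℝ (E d) d) (i j : Fin (d + 1)) : Set (E d) :=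
  face K i ∩ {y | bary K j y = 0}

theorem isCompact_edge (K : Affine.Simplex ℝ (E d) d) (i j : Fin (d + 1)) :
    IsCompact (edge K i j) :=
  (isCompact_face K i).inter_right (isClosed_singleton.preimage (continuous_bary K j))

theorem tendsto_volume_cthickening_edge (K : Affine.Simplex ℝ (E d) d) {i j : Fin (d + 1)}
    (hj : j ≠ i) {δ : ℕ → ℝ} (hδ : ∀ k, 0 < δ k) (hδ0 : Tendsto δ atTop (𝓝 0)) :
    Tendsto (fun k => (δ k)⁻¹ * volume.real (Metric.cthickening (2 * δ k) (edge K i j))) atTop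
      (𝓝 0) := by
  obtain ⟨L, h⟩ := exists_isPlaneChart (norm_outwardNormal K i)
  obtain ⟨p, hp⟩ := exists_bary_eq_zero K i
  set n := outwardNormal K i with hn
  set Z := chartPreimage p L (edge K i j) with hZ
  have hZc : IsCompact Z := isCompact_chartPreimage (isCompact_edge K i j)
  have hZ0 : volume Z = 0 :=
    measure_mono_null (Set.preimage_mono Set.inter_subset_right) (volume_chartPreimage_edge h hp hj)
  -- Splitting along the plane and the normal, the neighbourhood of the edge lies in a planar
  -- neighbourhood of `Z` times an interval of length `4 * δ k`.
  have hsub : ∀ k, Metric.cthickening (2 * δ k) (edge K i j) ⊆ stripMap p n L ''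
      (Metric.cthickening (2 * δ k) Z ×ˢ Set.Icc (-(2 * δ k)) (2 * δ k)) := by
    intro k x hx
    rw [(isCompact_edge K i j).cthickening_eq_biUnion_closedBall (by linarith [hδ k])] at hx
    simp only [Set.mem_iUnion, Metric.mem_closedBall] at hx
    obtain ⟨z, hz, hxz⟩ := hx
    obtain ⟨w, hw⟩ := h.exists_stripMap p x
    obtain ⟨v, hv⟩ := face_subset_range h hp ((mem_face_iff K).1 hz.1).1
    set s := - inner ℝ n (x - p) with hs
    have h1 := h.norm_sq (w - v) s
    have h2 : L (w - v) - s • n = x - z := by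
      rw [← hw, ← hv, map_sub, stripMap]; abel
    rw [h2, ← dist_eq_norm, ← dist_eq_norm] at h1
    have h3 : dist x z ^ 2 ≤ (2 * δ k) ^ 2 := pow_le_pow_left₀ dist_nonneg hxz 2
    refine ⟨(w, s), ⟨?_, ?_⟩, hw⟩
    · refine Metric.mem_cthickening_of_dist_le w v _ _ ?_ ?_
      · change p + L v ∈ edge K i j
        rw [hv]; exact hz
      · exact abs_le_of_sq_le_sq' (by nlinarith [sq_nonneg s]) (by linarith [hδ k]) |>.2
    · exact abs_le_of_sq_le_sq' (by nlinarith [sq_nonneg (dist w v)]) (by linarith [hδ k])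
  have hb : ∀ k, (δ k)⁻¹ * volume.real (Metric.cthickening (2 * δ k) (edge K i j)) ≤
      4 * volume.real (Metric.cthickening (2 * δ k) Z) := by
    intro k
    have h1 : volume (Metric.cthickening (2 * δ k) (edge K i j)) ≤
        volume (Metric.cthickening (2 * δ k) Z) * ENNReal.ofReal (4 * δ k) := by
      refine (measure_mono (hsub k)).trans ?_
      have hm := (h.measurePreserving p).measure_preimage_emb (h.measurableEmbedding p)
        (stripMap p n L '' (Metric.cthickening (2 * δ k) Z ×ˢ Set.Icc (-(2 * δ k)) (2 * δ k)))
      rw [Set.preimage_image_eq _ (h.injective p), Measure.prod_prod, Real.volume_Icc] at hm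
      rw [← hm]
      exact le_of_eq (by ring_nf)
    have h2 : volume.real (Metric.cthickening (2 * δ k) (edge K i j)) ≤
        volume.real (Metric.cthickening (2 * δ k) Z) * (4 * δ k) := by
      have := ENNReal.toReal_mono (ENNReal.mul_lt_top
        hZc.cthickening.measure_lt_top ENNReal.ofReal_lt_top).ne h1
      rwa [ENNReal.toReal_mul, ENNReal.toReal_ofReal (by linarith [hδ k])] at this
    rw [inv_mul_le_iff₀ (hδ k)]
    linarith
  -- The interval compensates the factor `(δ k)⁻¹`. The planar factor tends to zero because `Z` is
  -- compact and null.
  have hlim : Tendsto (fun k => 4 * volume.real (Metric.cthickening (2 * δ k) Z)) atTop (𝓝 0) := by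
    have h1 := tendsto_measure_cthickening_of_isCompact (μ := volume) hZc
    rw [hZ0] at h1
    have h2 : Tendsto (fun k => 2 * δ k) atTop (𝓝 0) := by simpa using hδ0.const_mul 2
    have h3 := (ENNReal.tendsto_toReal ENNReal.zero_ne_top).comp (h1.comp h2)
    simpa [Measure.real] using h3.const_mul 4
  exact squeeze_zero (fun k => mul_nonneg (inv_nonneg.2 (hδ k).le) measureReal_nonneg) hb hlim

end Chart

/-! ### Distance to the complement and cutoff functions -/

section Cutoff

open Filter Topology

variable {d : ℕ} {Ω : Set (E d)}

/-- The gradient of the distance to a closed set points away from the nearest point. -/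
theorem fderiv_infDist_apply {S : Set (E d)} {x p : E d}
    (hp : p ∈ S) (hpd : Metric.infDist x S = dist x p) (hpos : 0 < dist x p)
    (hd : DifferentiableAt ℝ (fun y => Metric.infDist y S) x) (v : E d) :
    fderiv ℝ (fun y => Metric.infDist y S) x v = - inner ℝ ((dist x p)⁻¹ • (p - x)) v := by
  set D : E d → ℝ := fun y => Metric.infDist y S with hD
  set r := dist x p with hr
  set e : E d := r⁻¹ • (p - x) with he
  have hLip : LipschitzWith 1 D := Metric.lipschitz_infDist_pt S
  have hen : ‖e‖ = 1 := by
    rw [he, norm_smul, norm_inv, Real.norm_of_nonneg hpos.le, ← dist_eq_norm, dist_comm, ← hr,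
      inv_mul_cancel₀ hpos.ne']
  -- On the segment to the nearest point the distance decreases with unit speed: `p` bounds it from
  -- above, the Lipschitz constant one from below.
  have hval : ∀ t ∈ Set.Icc 0 r, D (x + t • e) = r - t := by
    intro t ht
    apply le_antisymm
    · refine (Metric.infDist_le_dist_of_mem hp).trans (le_of_eq ?_)
      have : x + t • e - p = (t * r⁻¹ - 1) • (p - x) := by
        rw [he, smul_smul, sub_smul, one_smul]; abel
      rw [dist_eq_norm, this, norm_smul, ← dist_eq_norm p x, dist_comm p x, ← hr,
        Real.norm_eq_abs, abs_of_nonpos, neg_sub, sub_mul, mul_assoc, inv_mul_cancel₀ hpos.ne']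
      · ring
      · rw [sub_nonpos, ← div_eq_mul_inv, div_le_one hpos]; exact ht.2
    · have h1 := hLip.dist_le_mul x (x + t • e)
      rw [NNReal.coe_one, one_mul, Real.dist_eq, dist_eq_norm, sub_add_cancel_left, norm_neg,
        norm_smul, hen, mul_one, Real.norm_of_nonneg ht.1] at h1
      have h2 := (abs_le.1 h1).2
      have h3 : D x = r := hpd
      linarith
  have hfd := hd.hasFDerivAt
  have h1 : HasDerivAt (fun t : ℝ => D (x + t • e)) (fderiv ℝ D x e) 0 := by
    have hl : HasDerivAt (fun t : ℝ => x + t • e) e 0 := by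
      simpa using ((hasDerivAt_id (0 : ℝ)).smul_const e).const_add x
    have hfd' : HasFDerivAt D (fderiv ℝ D x) (x + (0 : ℝ) • e) := by simpa using hfd
    exact hfd'.comp_hasDerivAt (0 : ℝ) hl
  have h2 : HasDerivWithinAt (fun t : ℝ => D (x + t • e)) (-1) (Set.Icc 0 r) 0 := by
    have : HasDerivWithinAt (fun t : ℝ => r - t) (-1) (Set.Icc 0 r) 0 :=
      (hasDerivAt_id (0 : ℝ)).const_sub r |>.hasDerivWithinAt
    exact this.congr hval (hval 0 ⟨le_rfl, hpos.le⟩)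
  have hkey : fderiv ℝ D x e = -1 :=
    (uniqueDiffOn_Icc hpos 0 ⟨le_rfl, hpos.le⟩).eq_deriv _ h1.hasDerivWithinAt h2
  have hnorm : ‖fderiv ℝ D x‖ ≤ 1 := by
    simpa using norm_fderiv_le_of_lipschitz ℝ hLip (x₀ := x)
  set a : E d := (InnerProductSpace.toDual ℝ (E d)).symm (fderiv ℝ D x) with ha
  have hav : ∀ w, inner ℝ a w = fderiv ℝ D x w := fun w =>
    InnerProductSpace.toDual_symm_apply
  have han : ‖a‖ ≤ 1 := by rw [ha, LinearIsometryEquiv.norm_map]; exact hnorm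
  -- The gradient `a` has norm at most one and inner product `-1` with the unit vector `e`, which
  -- leaves only `-e`.
  have hae : a = -e := by
    have h3 : ‖a + e‖ ^ 2 ≤ 0 := by
      rw [norm_add_sq_real, hav, hkey, hen]
      have : ‖a‖ ^ 2 ≤ 1 := pow_le_one₀ (norm_nonneg _) han
      linarith
    have h4 : ‖a + e‖ = 0 := by
      have := sq_nonneg ‖a + e‖
      exact pow_eq_zero_iff two_ne_zero |>.1 (le_antisymm h3 this)
    exact eq_neg_of_add_eq_zero_left (norm_eq_zero.1 h4)
  rw [← hav, hae, inner_neg_left]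

/-- The cutoff function that grows from `0` to `1` at distance between `δ` and `2δ` from the
complement. -/
def cutoff (Ω : Set (E d)) (δ : ℝ) (x : E d) : ℝ :=
  max 0 (min 1 (δ⁻¹ * Metric.infDist x Ωᶜ - 1))

theorem lipschitzWith_cutoff (Ω : Set (E d)) {δ : ℝ} (hδ : 0 < δ) :
    LipschitzWith (Real.toNNReal δ⁻¹) (cutoff Ω δ) := by
  have h1 : LipschitzWith (Real.toNNReal δ⁻¹) fun x : E d => δ⁻¹ * Metric.infDist x Ωᶜ - 1 := by
    refine LipschitzWith.of_dist_le_mul fun x y => ?_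
    rw [Real.coe_toNNReal _ (inv_nonneg.2 hδ.le), Real.dist_eq, sub_sub_sub_cancel_right,
      ← mul_sub, abs_mul, abs_of_pos (inv_pos.2 hδ)]
    refine mul_le_mul_of_nonneg_left ?_ (inv_nonneg.2 hδ.le)
    have := (Metric.lipschitz_infDist_pt Ωᶜ).dist_le_mul x y
    simpa [Real.dist_eq] using this
  exact (h1.const_min 1).const_max 0

theorem cutoff_nonneg (δ : ℝ) (x : E d) : 0 ≤ cutoff Ω δ x := le_max_left _ _

theorem cutoff_le_one (δ : ℝ) (x : E d) : cutoff Ω δ x ≤ 1 :=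
  max_le zero_le_one (min_le_left _ _)

theorem norm_cutoff_le (δ : ℝ) (x : E d) : ‖cutoff Ω δ x‖ ≤ 1 := by
  rw [Real.norm_of_nonneg (cutoff_nonneg δ x)]; exact cutoff_le_one δ x

theorem cutoff_eq_zero {δ : ℝ} (hδ : 0 < δ) {x : E d} (hx : Metric.infDist x Ωᶜ ≤ δ) :
    cutoff Ω δ x = 0 := by
  refine max_eq_left ((min_le_right _ _).trans ?_)
  rw [sub_nonpos, inv_mul_le_iff₀ hδ, mul_one]; exact hx

theorem cutoff_eq_one {δ : ℝ} (hδ : 0 < δ) {x : E d} (hx : 2 * δ ≤ Metric.infDist x Ωᶜ) :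
    cutoff Ω δ x = 1 := by
  have : 1 ≤ δ⁻¹ * Metric.infDist x Ωᶜ - 1 := by
    rw [le_sub_iff_add_le, le_inv_mul_iff₀ hδ]; linarith
  rw [cutoff, min_eq_left this, max_eq_right zero_le_one]

theorem continuous_infDist_compl (Ω : Set (E d)) : Continuous fun x : E d => Metric.infDist x Ωᶜ :=
  Metric.continuous_infDist_pt _

theorem tendsto_cutoff (hΩ : IsOpen Ω) (hne : Ωᶜ.Nonempty) {δ : ℕ → ℝ} (hδ : ∀ k, 0 < δ k)
    (hδ0 : Tendsto δ atTop (𝓝 0)) {x : E d} (hx : x ∈ Ω) :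
    Tendsto (fun k => cutoff Ω (δ k) x) atTop (𝓝 1) := by
  have hpos : 0 < Metric.infDist x Ωᶜ :=
    (hΩ.isClosed_compl.notMem_iff_infDist_pos hne).1 (by simpa using hx)
  have h2 : Tendsto (fun k => 2 * δ k) atTop (𝓝 0) := by simpa using hδ0.const_mul 2
  refine tendsto_const_nhds.congr' ?_
  filter_upwards [h2.eventually (gt_mem_nhds hpos)] with k hk
  exact (cutoff_eq_one (hδ k) hk.le).symm

/-- The derivative of the cutoff function, off the layer where it grows and inside of it. -/
theorem fderiv_cutoff {δ : ℝ} (hδ : 0 < δ) {x : E d} (hd : DifferentiableAt ℝ (cutoff Ω δ) x) :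
    fderiv ℝ (cutoff Ω δ) x = 0 ∨ (δ ≤ Metric.infDist x Ωᶜ ∧ Metric.infDist x Ωᶜ ≤ 2 * δ ∧
      (fderiv ℝ (cutoff Ω δ) x = δ⁻¹ • fderiv ℝ (fun y => Metric.infDist y Ωᶜ) x)) := by
  -- Where the cutoff takes its extreme values its derivative vanishes by Fermat's rule. This
  -- includes the two edges of the layer.
  by_cases h1 : Metric.infDist x Ωᶜ ≤ δ
  · left
    have : IsLocalMin (cutoff Ω δ) x := Eventually.of_forall fun y => by
      rw [cutoff_eq_zero hδ h1]; exact cutoff_nonneg δ y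
    exact this.fderiv_eq_zero
  by_cases h2 : 2 * δ ≤ Metric.infDist x Ωᶜ
  · left
    have : IsLocalMax (cutoff Ω δ) x := Eventually.of_forall fun y => by
      rw [cutoff_eq_one hδ h2]; exact cutoff_le_one δ y
    exact this.fderiv_eq_zero
  push Not at h1 h2
  refine Or.inr ⟨h1.le, h2.le, ?_⟩
  have hev : cutoff Ω δ =ᶠ[𝓝 x] fun y => δ⁻¹ * Metric.infDist y Ωᶜ - 1 := by
    filter_upwards [(continuous_infDist_compl Ω).continuousAt.eventually (lt_mem_nhds h1),
      (continuous_infDist_compl Ω).continuousAt.eventually (gt_mem_nhds h2)] with y hy1 hy2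
    have e1 : δ⁻¹ * Metric.infDist y Ωᶜ - 1 ≤ 1 := by
      rw [sub_le_iff_le_add, inv_mul_le_iff₀ hδ]; linarith
    have e2 : 0 ≤ δ⁻¹ * Metric.infDist y Ωᶜ - 1 := by
      rw [sub_nonneg, le_inv_mul_iff₀ hδ]; linarith
    rw [cutoff, min_eq_right e1, max_eq_right e2]
  rw [hev.fderiv_eq, fderiv_sub_const]
  have : DifferentiableAt ℝ (fun y => Metric.infDist y Ωᶜ) x := by
    have h3 : DifferentiableAt ℝ (fun y => δ⁻¹ * Metric.infDist y Ωᶜ - 1) x :=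
      hev.differentiableAt_iff.1 hd
    have h4 := (h3.add_const 1).const_mul δ
    refine h4.congr_of_eventuallyEq (Eventually.of_forall fun y => ?_)
    have := hδ.ne'
    simp only
    field_simp
    ring
  exact fderiv_const_mul this δ⁻¹

end Cutoff

/-! ### The divergence inequality -/

section Divergence

open Filter Topology

variable {d : ℕ} {Ω : Set (E d)} {T : Mesh d}

theorem Mesh.Triangulates.isOpen (hT : T.Triangulates Ω) : IsOpen Ω := by
  rw [hT]; exact _root_.isOpen_interior

theorem Mesh.Triangulates.isBounded (hT : T.Triangulates Ω) : Bornology.IsBounded Ω :=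
  T.isCompact_space.isBounded.subset (subset_closure.trans hT.closure_subset)

variable [NeZero d]

theorem Mesh.Triangulates.compl_nonempty (hT : T.Triangulates Ω) : Ωᶜ.Nonempty := by
  rw [Set.nonempty_compl]
  intro h
  have hb := hT.isBounded
  rw [h] at hb
  have : Nonempty (Fin d) := ⟨⟨0, Nat.pos_of_ne_zero (NeZero.ne d)⟩⟩
  exact NormedSpace.unbounded_univ ℝ (E d) hb

/-- Near a boundary face the nearest boundary point is in the direction of the outward normal. -/
theorem normal_eq_of_ball_subset {K : Affine.Simplex ℝ (E d) d} {i : Fin (d + 1)} {x p : E d}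
    (hp : bary K i p = 0) (hpos : 0 < dist x p)
    (hball : ∀ᶠ y in 𝓝 p, y ∈ Metric.ball x (dist x p) → y ∈ K.closedInterior) :
    (dist x p)⁻¹ • (p - x) = outwardNormal K i := by
  set r := dist x p with hr
  set e : E d := r⁻¹ • (p - x) with he
  set n := outwardNormal K i with hn
  have hen : ‖e‖ = 1 := by
    rw [he, norm_smul, norm_inv, Real.norm_of_nonneg hpos.le, ← dist_eq_norm, dist_comm, ← hr,
      inv_mul_cancel₀ hpos.ne']
  have hnn : ‖n‖ = 1 := norm_outwardNormal K i
  have hxe : x - p = -(r • e) := by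
    rw [he, smul_smul, mul_inv_cancel₀ hpos.ne', one_smul]; abel
  -- A direction `w` at `p` with `⟨w, e⟩ < 0` leads into the ball, hence into the cell, so it cannot
  -- point outwards across the face.
  have key : ∀ w : E d, inner ℝ w e < 0 → inner ℝ n w ≤ 0 := by
    intro w hw
    have hlim : Tendsto (fun t : ℝ => p + t • w) (𝓝[>] 0) (𝓝 p) := by
      have : Continuous fun t : ℝ => p + t • w := by fun_prop
      have h := this.tendsto 0
      simp only [zero_smul, add_zero] at h
      exact h.mono_left nhdsWithin_le_nhds
    have hin : ∀ᶠ t in 𝓝[>] (0 : ℝ), p + t • w ∈ Metric.ball x r := by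
      have hc : Tendsto (fun t : ℝ => t * ‖w‖ ^ 2 + 2 * r * inner ℝ w e) (𝓝[>] 0)
          (𝓝 (2 * r * inner ℝ w e)) := by
        have : Continuous fun t : ℝ => t * ‖w‖ ^ 2 + 2 * r * inner ℝ w e := by fun_prop
        have h := this.tendsto 0
        simp only [zero_mul, zero_add] at h
        exact h.mono_left nhdsWithin_le_nhds
      have hneg : 2 * r * inner ℝ w e < 0 := by nlinarith
      filter_upwards [hc.eventually (gt_mem_nhds hneg), self_mem_nhdsWithin] with t ht ht0
      rw [Metric.mem_ball, dist_eq_norm]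
      have h1 : p + t • w - x = t • w + r • e := by
        have : p - x = r • e := by rw [← neg_sub, hxe, neg_neg]
        rw [← this]; abel
      have h2 : ‖t • w + r • e‖ ^ 2 = t * (t * ‖w‖ ^ 2 + 2 * r * inner ℝ w e) + r ^ 2 := by
        rw [norm_add_sq_real, norm_smul, norm_smul, inner_smul_left, inner_smul_right, hen,
          Real.norm_eq_abs, Real.norm_eq_abs]
        simp only [conj_trivial, mul_one, sq_abs, mul_pow]
        ring
      rw [h1]
      refine lt_of_pow_lt_pow_left₀ 2 hpos.le ?_
      rw [h2]
      have : t * (t * ‖w‖ ^ 2 + 2 * r * inner ℝ w e) < 0 := mul_neg_of_pos_of_neg ht0 ht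
      linarith
    obtain ⟨t, ⟨ht1, ht2⟩, ht3⟩ := ((hin.and (hlim.eventually hball)).and
      self_mem_nhdsWithin).exists
    have hK := (mem_closedInterior_iff K).1 (ht2 ht1) i
    have h4 := height_mul_bary_of_bary_eq_zero K i (x := p + t • w) hp
    rw [add_sub_cancel_left, inner_smul_right] at h4
    have h5 : 0 ≤ K.height i * bary K i (p + t • w) := mul_nonneg (K.height_pos i).le hK
    have ht0 : 0 < t := ht3
    rw [h4] at h5
    by_contra! hcon
    have := mul_pos ht0 hcon
    linarith
  have hle : inner ℝ n e ≤ 1 := by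
    have := real_inner_le_norm n e
    rwa [hnn, hen, mul_one] at this
  have hge : 1 ≤ inner ℝ n e := by
    by_contra! hlt
    -- If the unit vectors differed, `n - e` would lead into the ball and still have a positive
    -- inner product with `n`.
    have h1 := key (n - e) (by
      rw [inner_sub_left, real_inner_self_eq_norm_sq, hen]; linarith)
    rw [inner_sub_right, real_inner_self_eq_norm_sq, hnn] at h1
    linarith
  exact ((inner_eq_one_iff_of_norm_eq_one hnn hen).1 (le_antisymm hle hge)).symm

/-- Pointwise bound of the gradient of the cutoff function against a field. -/
theorem fderiv_cutoff_apply_le (hT : T.Triangulates Ω) {δ : ℝ} (hδ : 0 < δ) {x v : E d}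
    {Λ : ℝ} (hv : ‖v‖ ≤ Λ) {g : T.cells → Fin (d + 1) → E d → ℝ}
    (hg0 : ∀ F ∈ T.boundaryFaces Ω, ∀ x ∈ F.1.1.closedInterior, 0 ≤ g F.1 F.2 x)
    (hg : ∀ F ∈ T.boundaryFaces Ω, x ∈ F.1.1.interior →
      - inner ℝ v (outwardNormal F.1.1 F.2) ≤ g F.1 F.2 x)
    (hd : DifferentiableAt ℝ (cutoff Ω δ) x)
    (hd' : DifferentiableAt ℝ (fun y => Metric.infDist y Ωᶜ) x) :
    fderiv ℝ (cutoff Ω δ) x v ≤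
      ∑ F ∈ T.boundaryFaces Ω, δ⁻¹ * (strip F.1.1 F.2 δ).indicator
        (cellOr F.1.1 (g F.1 F.2) Λ) x +
      ∑ K : T.cells, ∑ i : Fin (d + 1), ∑ j ∈ Finset.univ.erase i,
        δ⁻¹ * (Metric.cthickening (2 * δ) (edge K.1 i j)).indicator (fun _ => Λ) x := by
  classical
  have hΛ : 0 ≤ Λ := (norm_nonneg _).trans hv
  have hδi : 0 ≤ δ⁻¹ := inv_nonneg.2 hδ.le
  have hcell : ∀ F ∈ T.boundaryFaces Ω, ∀ x, 0 ≤ cellOr F.1.1 (g F.1 F.2) Λ x := by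
    intro F hF y
    by_cases hy : y ∈ F.1.1.interior
    · rw [cellOr, Set.piecewise_eq_of_mem _ _ _ hy]
      exact hg0 F hF y (F.1.1.interior_subset_closedInterior hy)
    · rw [cellOr, Set.piecewise_eq_of_notMem _ _ _ hy]; exact hΛ
  have hA : ∀ F ∈ T.boundaryFaces Ω, 0 ≤ δ⁻¹ * (strip F.1.1 F.2 δ).indicator
      (cellOr F.1.1 (g F.1 F.2) Λ) x := fun F hF =>
    mul_nonneg hδi (Set.indicator_nonneg (fun y _ => hcell F hF y) x)
  have hB : ∀ (K : T.cells) (i j : Fin (d + 1)), 0 ≤ δ⁻¹ *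
      (Metric.cthickening (2 * δ) (edge K.1 i j)).indicator (fun _ => Λ) x := fun K i j =>
    mul_nonneg hδi (Set.indicator_nonneg (fun _ _ => hΛ) x)
  have hBs : 0 ≤ ∑ K : T.cells, ∑ i : Fin (d + 1), ∑ j ∈ Finset.univ.erase i,
      δ⁻¹ * (Metric.cthickening (2 * δ) (edge K.1 i j)).indicator (fun _ => Λ) x :=
    Finset.sum_nonneg fun K _ => Finset.sum_nonneg fun i _ => Finset.sum_nonneg fun j _ => hB K i j
  rcases fderiv_cutoff hδ hd with h0 | ⟨h1, h2, h3⟩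
  · rw [h0]
    exact add_nonneg (Finset.sum_nonneg hA) hBs
  obtain ⟨p, hp, hpd⟩ := hT.isOpen.isClosed_compl.exists_infDist_eq_dist hT.compl_nonempty x
  have hpos : 0 < dist x p := by rw [← hpd]; linarith
  have hball : Metric.ball x (dist x p) ⊆ Ω := by
    rw [← hpd]; exact Metric.ball_infDist_compl_subset
  have hpcl : p ∈ closure Ω := by
    refine closure_mono hball ?_
    rw [closure_ball x hpos.ne', Metric.mem_closedBall, dist_comm]
  rw [h3, smul_apply, fderiv_infDist_apply hp hpd hpos hd', smul_eq_mul]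
  -- Either the nearest point `p` is on an edge, and the crude bound `Λ` is paid near this edge, or
  -- `p` is interior to a boundary face and `x` lies in the strip of that face.
  obtain ⟨K, i, hpF, ⟨j, hj, hpj⟩ | ⟨hbd, hnear⟩⟩ := hT.boundary_cases hp hpcl
  · have hx' : x ∈ Metric.cthickening (2 * δ) (edge K.1 i j) :=
      Metric.mem_cthickening_of_dist_le x p _ _ ⟨hpF, hpj⟩ (by rw [← hpd]; exact h2)
    have hle : - inner ℝ ((dist x p)⁻¹ • (p - x)) v ≤ Λ := by
      have h5 := abs_real_inner_le_norm ((dist x p)⁻¹ • (p - x)) v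
      rw [norm_smul, norm_inv, Real.norm_of_nonneg hpos.le, ← dist_eq_norm, dist_comm p x,
        inv_mul_cancel₀ hpos.ne', one_mul] at h5
      linarith [(abs_le.1 h5).1]
    have h6 : δ⁻¹ * - inner ℝ ((dist x p)⁻¹ • (p - x)) v ≤ δ⁻¹ *
        (Metric.cthickening (2 * δ) (edge K.1 i j)).indicator (fun _ => Λ) x := by
      rw [Set.indicator_of_mem hx']
      exact mul_le_mul_of_nonneg_left hle hδi
    refine h6.trans (le_add_of_nonneg_of_le (Finset.sum_nonneg hA) ?_)
    calc _ ≤ ∑ j ∈ Finset.univ.erase i, δ⁻¹ *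
          (Metric.cthickening (2 * δ) (edge K.1 i j)).indicator (fun _ => Λ) x :=
          Finset.single_le_sum (f := fun j => δ⁻¹ *
            (Metric.cthickening (2 * δ) (edge K.1 i j)).indicator (fun _ => Λ) x)
            (fun j _ => hB K i j) (Finset.mem_erase.2 ⟨hj, Finset.mem_univ j⟩)
      _ ≤ ∑ i : Fin (d + 1), ∑ j ∈ Finset.univ.erase i, δ⁻¹ *
          (Metric.cthickening (2 * δ) (edge K.1 i j)).indicator (fun _ => Λ) x :=
          Finset.single_le_sum (f := fun i => ∑ j ∈ Finset.univ.erase i, δ⁻¹ *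
            (Metric.cthickening (2 * δ) (edge K.1 i j)).indicator (fun _ => Λ) x)
            (fun i _ => Finset.sum_nonneg fun j _ => hB K i j) (Finset.mem_univ i)
      _ ≤ _ := Finset.single_le_sum (f := fun K : T.cells => ∑ i : Fin (d + 1),
            ∑ j ∈ Finset.univ.erase i, δ⁻¹ *
            (Metric.cthickening (2 * δ) (edge K.1 i j)).indicator (fun _ => Λ) x)
            (fun K _ => Finset.sum_nonneg fun i _ => Finset.sum_nonneg fun j _ => hB K i j)
            (Finset.mem_univ K)
  · have hn : (dist x p)⁻¹ • (p - x) = outwardNormal K.1 i := by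
      refine normal_eq_of_ball_subset ((mem_face_iff K.1).1 hpF).1 hpos ?_
      filter_upwards [hnear] with y hy hyb
      exact hy (hball hyb)
    have hxs : x ∈ strip K.1 i δ := by
      refine ⟨(p, dist x p), ⟨hpF, ?_, ?_⟩, ?_⟩
      · rw [← hpd]; exact h1
      · rw [← hpd]; exact h2
      · simp only [← hn, smul_smul, mul_inv_cancel₀ hpos.ne', one_smul]
        abel
    -- The point `x` may lie outside of the open cell of the nearest face, where `g` says nothing
    -- about `v`. This is the case for which `cellOr` carries the constant `Λ`.
    have hle : - inner ℝ (outwardNormal K.1 i) v ≤ cellOr K.1 (g K i) Λ x := by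
      by_cases hxK : x ∈ K.1.interior
      · rw [cellOr, Set.piecewise_eq_of_mem _ _ _ hxK, real_inner_comm]
        exact hg (K, i) hbd hxK
      · rw [cellOr, Set.piecewise_eq_of_notMem _ _ _ hxK]
        have h5 := abs_real_inner_le_norm (outwardNormal K.1 i) v
        rw [norm_outwardNormal, one_mul] at h5
        linarith [(abs_le.1 h5).1]
    rw [hn]
    have h6 : δ⁻¹ * - inner ℝ (outwardNormal K.1 i) v ≤
        δ⁻¹ * (strip K.1 i δ).indicator (cellOr K.1 (g K i) Λ) x := by
      rw [Set.indicator_of_mem hxs]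
      exact mul_le_mul_of_nonneg_left hle hδi
    refine h6.trans (le_add_of_le_of_nonneg ?_ hBs)
    let f : T.cells × Fin (d + 1) → ℝ := fun F => δ⁻¹ *
      (strip F.1.1 F.2 δ).indicator (cellOr F.1.1 (g F.1 F.2) Λ) x
    have h7 : f (K, i) ≤ ∑ F ∈ T.boundaryFaces Ω, f F := Finset.single_le_sum hA hbd
    exact h7

/-- A one-sided divergence theorem: the total divergence of a bounded field is bounded from below by
the flux through the boundary faces. -/
theorem neg_integral_div_le (hT : T.Triangulates Ω) {V : E d → E d} {G : E d → ℝ}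
    (hV : MemLp V ∞ (volume.restrict Ω)) (hG : MemLp G ∞ (volume.restrict Ω))
    (hdiv : HasWeakDiv Ω V G) {g : T.cells → Fin (d + 1) → E d → ℝ}
    (hgc : ∀ F ∈ T.boundaryFaces Ω, ContinuousOn (g F.1 F.2) F.1.1.closedInterior)
    (hg0 : ∀ F ∈ T.boundaryFaces Ω, ∀ x ∈ F.1.1.closedInterior, 0 ≤ g F.1 F.2 x)
    (hg : ∀ F ∈ T.boundaryFaces Ω, ∀ᵐ x, x ∈ F.1.1.interior →
      - inner ℝ (V x) (outwardNormal F.1.1 F.2) ≤ g F.1 F.2 x) :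
    - ∫ x in Ω, G x ≤
      ∑ F ∈ T.boundaryFaces Ω, ∫ x in face F.1.1 F.2, g F.1 F.2 x ∂(μHE[d - 1] : Measure (E d)) := by
  classical
  have hΩ := hT.isOpen
  have hfinΩ : volume Ω ≠ ∞ := hT.isBounded.measure_lt_top.ne
  have : IsFiniteMeasure (volume.restrict Ω) := ⟨by simpa using hfinΩ.lt_top⟩
  obtain ⟨Λ, hΛ, hVΛ⟩ := exists_bound_of_memLp_top hV
  obtain ⟨M, hM, hGM⟩ := exists_bound_of_memLp_top hG
  let δ : ℕ → ℝ := fun k => 1 / ((k : ℝ) + 1)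
  have hδ : ∀ k, 0 < δ k := fun k => by positivity
  have hδ0 : Tendsto δ atTop (𝓝 0) := tendsto_one_div_add_atTop_nhds_zero_nat
  -- integration by parts against the cutoff function
  have hibp : ∀ k, - ∫ x in Ω, cutoff Ω (δ k) x * G x =
      ∫ x in Ω, ∑ i, V x i * lineDeriv ℝ (cutoff Ω (δ k)) x (EuclideanSpace.single i 1) := by
    intro k
    have hW := memW1Infty_of_lipschitz (Ω := Ω) (lipschitzWith_cutoff Ω (hδ k))
      (norm_cutoff_le (δ k))
    have hprod := hdiv.mul hΩ hV hG hW
    have hS : IsCompact {x | δ k ≤ Metric.infDist x Ωᶜ} := by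
      refine Metric.isCompact_of_isClosed_isBounded
        (isClosed_le continuous_const (continuous_infDist_compl Ω)) ?_
      refine hT.isBounded.subset fun x hx => ?_
      by_contra hc
      have h0 : Metric.infDist x Ωᶜ = 0 := Metric.infDist_zero_of_mem hc
      have : δ k ≤ Metric.infDist x Ωᶜ := hx
      linarith [hδ k]
    have hz := hprod.integral_eq_zero hΩ hS (fun x hx => by
      by_contra hc
      have h0 : Metric.infDist x Ωᶜ = 0 := Metric.infDist_zero_of_mem hc
      have : δ k ≤ Metric.infDist x Ωᶜ := hx
      linarith [hδ k]) (fun x hx => by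
        have hx' : Metric.infDist x Ωᶜ < δ k := not_le.1 hx
        rw [cutoff_eq_zero (hδ k) hx'.le, zero_smul]) (fun x hx => by
        have hx' : Metric.infDist x Ωᶜ < δ k := not_le.1 hx
        have hev : cutoff Ω (δ k) =ᶠ[𝓝 x] fun _ => 0 := by
          filter_upwards [(continuous_infDist_compl Ω).continuousAt.eventually (gt_mem_nhds hx')]
            with y hy
          exact cutoff_eq_zero (hδ k) (le_of_lt hy)
        rw [cutoff_eq_zero (hδ k) hx'.le, zero_mul, zero_add]
        refine Finset.sum_eq_zero fun i _ => ?_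
        rw [hev.lineDeriv_eq]
        simp [lineDeriv])
    rw [integral_add] at hz
    · linarith
    · exact (hG.mul' hW.1 (r := ∞)).integrable le_top
    · refine integrable_finsetSum _ fun i _ => ?_
      have hVi : MemLp (fun x => V x i) ∞ (volume.restrict Ω) :=
        (EuclideanSpace.proj (𝕜 := ℝ) i : E d →L[ℝ] ℝ).comp_memLp' hV
      exact ((hW.2 i).1.mul' hVi (r := ∞)).integrable le_top
  have hlim1 : Tendsto (fun k => - ∫ x in Ω, cutoff Ω (δ k) x * G x) atTop
      (𝓝 (- ∫ x in Ω, G x)) := by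
    refine Tendsto.neg (tendsto_integral_of_dominated_convergence (fun _ => M) ?_ ?_ ?_ ?_)
    · intro k
      exact (lipschitzWith_cutoff Ω (hδ k)).continuous.aestronglyMeasurable.mul hG.1
    · exact integrable_const M
    · intro k
      filter_upwards [hGM] with x hx
      rw [norm_mul]
      calc _ ≤ 1 * ‖G x‖ := mul_le_mul_of_nonneg_right (norm_cutoff_le _ x) (norm_nonneg _)
        _ ≤ M := by rw [one_mul]; exact hx
    · filter_upwards [ae_restrict_mem hΩ.measurableSet] with x hx
      simpa using (tendsto_cutoff hΩ hT.compl_nonempty hδ hδ0 hx).mul_const (G x)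
  -- the bound by strips
  have hmeasA : ∀ F ∈ T.boundaryFaces Ω, ∀ k, Integrable ((strip F.1.1 F.2 (δ k)).indicator
      (cellOr F.1.1 (g F.1 F.2) Λ)) := by
    intro F hF k
    obtain ⟨B, hB0, hB⟩ := exists_bound_cellOr (hgc F hF) Λ
    rw [integrable_indicator_iff (isCompact_strip _ _ _).measurableSet]
    exact Integrable.mono' (g := fun _ => B)
      (integrableOn_const (isCompact_strip _ _ _).measure_lt_top.ne)
      (measurable_cellOr (hgc F hF) Λ).aestronglyMeasurable (Eventually.of_forall fun x => hB x)
  have hmeasB : ∀ (K : T.cells) i j k, Integrable ((Metric.cthickening (2 * δ k)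
      (edge K.1 i j)).indicator fun _ => Λ) := by
    intro K i j k
    rw [integrable_indicator_iff Metric.isClosed_cthickening.measurableSet]
    exact integrableOn_const (isCompact_edge K.1 i j).cthickening.measure_lt_top.ne
  let A : (T.cells × Fin (d + 1)) → ℕ → ℝ := fun F k =>
    (δ k)⁻¹ * ∫ x in strip F.1.1 F.2 (δ k), cellOr F.1.1 (g F.1 F.2) Λ x
  let B : T.cells → Fin (d + 1) → Fin (d + 1) → ℕ → ℝ := fun K i j k =>
    Λ * ((δ k)⁻¹ * volume.real (Metric.cthickening (2 * δ k) (edge K.1 i j)))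
  have hbound : ∀ k, - ∫ x in Ω, cutoff Ω (δ k) x * G x ≤
      ∑ F ∈ T.boundaryFaces Ω, A F k +
        ∑ K : T.cells, ∑ i : Fin (d + 1), ∑ j ∈ Finset.univ.erase i, B K i j k := by
    intro k
    let R : E d → ℝ := fun x => ∑ F ∈ T.boundaryFaces Ω, (δ k)⁻¹ *
        (strip F.1.1 F.2 (δ k)).indicator (cellOr F.1.1 (g F.1 F.2) Λ) x +
      ∑ K : T.cells, ∑ i : Fin (d + 1), ∑ j ∈ Finset.univ.erase i,
        (δ k)⁻¹ * (Metric.cthickening (2 * δ k) (edge K.1 i j)).indicator (fun _ => Λ) x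
    have iA : ∀ F ∈ T.boundaryFaces Ω, Integrable (fun x => (δ k)⁻¹ *
        (strip F.1.1 F.2 (δ k)).indicator (cellOr F.1.1 (g F.1 F.2) Λ) x) := fun F hF =>
      (hmeasA F hF k).const_mul _
    have iB : ∀ (K : T.cells) (i j : Fin (d + 1)), Integrable (fun x => (δ k)⁻¹ *
        (Metric.cthickening (2 * δ k) (edge K.1 i j)).indicator (fun _ => Λ) x) := fun K i j =>
      (hmeasB K i j k).const_mul _
    have iBs : Integrable (fun x => ∑ K : T.cells, ∑ i : Fin (d + 1), ∑ j ∈ Finset.univ.erase i,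
        (δ k)⁻¹ * (Metric.cthickening (2 * δ k) (edge K.1 i j)).indicator (fun _ => Λ) x) :=
      integrable_finsetSum _ fun K _ => integrable_finsetSum _ fun i _ =>
        integrable_finsetSum _ fun j _ => iB K i j
    have iR : Integrable R := (integrable_finsetSum _ iA).add iBs
    have hR : ∫ x, R x = ∑ F ∈ T.boundaryFaces Ω, A F k +
        ∑ K : T.cells, ∑ i : Fin (d + 1), ∑ j ∈ Finset.univ.erase i, B K i j k := by
      rw [integral_add (integrable_finsetSum _ iA) iBs, integral_finsetSum _ iA,
        integral_finsetSum _ fun K _ => integrable_finsetSum _ fun i _ =>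
          integrable_finsetSum _ fun j _ => iB K i j]
      congr 1
      · refine Finset.sum_congr rfl fun F hF => ?_
        rw [integral_const_mul, integral_indicator (isCompact_strip _ _ _).measurableSet]
      · refine Finset.sum_congr rfl fun K _ => ?_
        rw [integral_finsetSum _ fun i _ => integrable_finsetSum _ fun j _ => iB K i j]
        refine Finset.sum_congr rfl fun i _ => ?_
        rw [integral_finsetSum _ fun j _ => iB K i j]
        refine Finset.sum_congr rfl fun j _ => ?_
        rw [integral_const_mul, integral_indicator Metric.isClosed_cthickening.measurableSet,
          setIntegral_const]
        simp only [B, smul_eq_mul]; ring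
    have hR0 : ∀ x, 0 ≤ R x := by
      intro x
      refine add_nonneg (Finset.sum_nonneg fun F hF => mul_nonneg (inv_nonneg.2 (hδ k).le)
        (Set.indicator_nonneg (fun y _ => ?_) x)) (Finset.sum_nonneg fun K _ =>
          Finset.sum_nonneg fun i _ => Finset.sum_nonneg fun j _ =>
            mul_nonneg (inv_nonneg.2 (hδ k).le) (Set.indicator_nonneg (fun _ _ => hΛ) x))
      by_cases hy : y ∈ F.1.1.interior
      · rw [cellOr, Set.piecewise_eq_of_mem _ _ _ hy]
        exact hg0 F hF y (F.1.1.interior_subset_closedInterior hy)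
      · rw [cellOr, Set.piecewise_eq_of_notMem _ _ _ hy]; exact hΛ
    rw [hibp k, ← hR]
    -- The majorant `R` is nonnegative, so its integral may be extended from `Ω` to the whole space.
    refine le_trans ?_ (setIntegral_le_integral (s := Ω) iR (Eventually.of_forall hR0))
    have hW := memW1Infty_of_lipschitz (Ω := Ω) (lipschitzWith_cutoff Ω (hδ k))
      (norm_cutoff_le (δ k))
    refine integral_mono_ae ?_ iR.integrableOn ?_
    · refine integrable_finsetSum _ fun i _ => ?_
      have hVi : MemLp (fun x => V x i) ∞ (volume.restrict Ω) :=
        (EuclideanSpace.proj (𝕜 := ℝ) i : E d →L[ℝ] ℝ).comp_memLp' hV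
      exact ((hW.2 i).1.mul' hVi (r := ∞)).integrable le_top
    · have hg' : ∀ᵐ x, ∀ F ∈ T.boundaryFaces Ω, x ∈ F.1.1.interior →
          - inner ℝ (V x) (outwardNormal F.1.1 F.2) ≤ g F.1 F.2 x :=
        (Finset.eventually_all _).2 hg
      -- By Rademacher's theorem the cutoff and the distance are differentiable almost everywhere.
      filter_upwards [hVΛ, ae_restrict_of_ae hg',
        ae_restrict_of_ae (lipschitzWith_cutoff Ω (hδ k)).ae_differentiableAt,
        ae_restrict_of_ae (Metric.lipschitz_infDist_pt Ωᶜ).ae_differentiableAt] with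
        x hx1 hx2 hx4 hx5
      refine le_trans (le_of_eq ?_)
        (fderiv_cutoff_apply_le hT (hδ k) hx1 hg0 hx2 hx4 hx5)
      simp only [hx4.lineDeriv_eq_fderiv]
      conv_rhs => rw [← (EuclideanSpace.basisFun (Fin d) ℝ).sum_repr (V x), map_sum]
      refine Finset.sum_congr rfl fun i _ => ?_
      rw [map_smul, smul_eq_mul]
      simp
  have hlim2 : Tendsto (fun k => ∑ F ∈ T.boundaryFaces Ω, A F k +
      ∑ K : T.cells, ∑ i : Fin (d + 1), ∑ j ∈ Finset.univ.erase i, B K i j k) atTop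
      (𝓝 (∑ F ∈ T.boundaryFaces Ω, ∫ x in face F.1.1 F.2, g F.1 F.2 x
        ∂(μHE[d - 1] : Measure (E d)) + ∑ K : T.cells, ∑ i : Fin (d + 1),
          ∑ j ∈ Finset.univ.erase i, (0 : ℝ))) := by
    refine (tendsto_finsetSum _ fun F hF => tendsto_strip _ _ (hgc F hF) Λ hδ hδ0).add
      (tendsto_finsetSum _ fun K _ => tendsto_finsetSum _ fun i _ =>
        tendsto_finsetSum _ fun j hj => ?_)
    simpa using (tendsto_volume_cthickening_edge K.1 (Finset.ne_of_mem_erase hj) hδ hδ0).const_mul Λ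
  simp only [Finset.sum_const_zero, add_zero] at hlim2
  exact le_of_tendsto_of_tendsto' hlim1 hlim2 hbound

end Divergence

/-! ### Polynomials as functions -/

section Polynomial

open MvPolynomial

variable {d : ℕ}

theorem Poly.val_add (f g : Poly d) (x : E d) : Poly.val (f + g) x = Poly.val f x + Poly.val g x := by
  simp [Poly.val]

theorem Poly.val_smul (a : ℝ) (f : Poly d) (x : E d) : Poly.val (a • f) x = a * Poly.val f x := by
  simp [Poly.val]

theorem Poly.val_zero (x : E d) : Poly.val (0 : Poly d) x = 0 := by
  simp [Poly.val]

theorem Poly.hasFDerivAt_val (f : Poly d) (x : E d) :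
    HasFDerivAt (Poly.val f)
      (∑ i, Poly.val (pderiv i f) x • (EuclideanSpace.proj i : E d →L[ℝ] ℝ)) x := by
  induction f using MvPolynomial.induction_on with
  | C a =>
    have : (Poly.val (C a) : E d → ℝ) = fun _ => a := by ext y; simp [Poly.val]
    rw [this]
    exact (hasFDerivAt_const a x).congr_fderiv (by simp [Poly.val])
  | add p q hp hq =>
    have : (Poly.val (p + q) : E d → ℝ) = Poly.val p + Poly.val q := by
      ext y; simp [Poly.val]
    rw [this]
    refine (hp.add hq).congr_fderiv ?_
    rw [← Finset.sum_add_distrib]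
    refine Finset.sum_congr rfl fun i _ => ?_
    rw [map_add, Poly.val_add, add_smul]
  | mul_X p j hp =>
    have : (Poly.val (p * X j) : E d → ℝ) =
        Poly.val p * (EuclideanSpace.proj j : E d →L[ℝ] ℝ) := by
      ext y; simp [Poly.val]
    rw [this]
    refine (hp.mul (EuclideanSpace.proj j : E d →L[ℝ] ℝ).hasFDerivAt).congr_fderiv ?_
    ext v
    have e : ∀ i, Poly.val (pderiv i (p * X j)) x * v i =
        Poly.val p x * ((if j = i then 1 else 0) * v i) + x j * (Poly.val (pderiv i p) x * v i) := by
      intro i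
      by_cases h : j = i
      · subst h
        simp [Poly.val, Derivation.leibniz]; ring
      · simp [Poly.val, Derivation.leibniz, pderiv_X, h]; ring
    simp only [sum_apply, smul_apply, add_apply, PiLp.proj_apply, smul_eq_mul, e,
      Finset.sum_add_distrib, ← Finset.mul_sum]
    congr 2
    rw [Finset.sum_eq_single j]
    · simp
    · intro i _ hi
      simp [hi.symm]
    · simp

theorem Poly.continuous_val (f : Poly d) : Continuous (Poly.val f) :=
  continuous_iff_continuousAt.2 fun x => (Poly.hasFDerivAt_val f x).continuousAt

theorem Poly.partialDeriv_val (f : Poly d) (i : Fin d) (x : E d) :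
    partialDeriv i (Poly.val f) x = Poly.val (pderiv i f) x := by
  rw [partialDeriv, (Poly.hasFDerivAt_val f x).fderiv]
  simp only [sum_apply, smul_apply, PiLp.proj_apply, smul_eq_mul]
  rw [Finset.sum_eq_single i]
  · simp
  · intro j _ hj
    simp [hj]
  · simp

theorem Poly.contDiff_val (f : Poly d) : ContDiff ℝ 1 (Poly.val f) := by
  rw [contDiff_one_iff_hasFDerivAt]
  refine ⟨_, ?_, Poly.hasFDerivAt_val f⟩
  exact continuous_finsetSum _ fun i _ => (Poly.continuous_val _).smul continuous_const

theorem continuous_vecVal (f : Fin d → Poly d) : Continuous (vecVal f) := by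
  unfold vecVal
  exact (PiLp.continuous_toLp 2 _).comp (continuous_pi fun i => Poly.continuous_val _)

theorem continuous_gradVal (f : Poly d) : Continuous (gradVal f) :=
  continuous_vecVal fun i => pderiv i f

theorem continuous_divVal (f : Fin d → Poly d) : Continuous (divVal f) :=
  continuous_finsetSum _ fun _ _ => Poly.continuous_val _

/-- A polynomial that vanishes on a nonempty open set is zero. -/
theorem Poly.eq_zero_of_isOpen {f : Poly d} {U : Set (E d)} (hU : IsOpen U) {x : E d} (hx : x ∈ U)
    (h : ∀ y ∈ U, Poly.val f y = 0) : f = 0 := by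
  have hopen : IsOpen ((fun v : Fin d → ℝ => (WithLp.toLp 2 v : E d)) ⁻¹' U) :=
    hU.preimage (PiLp.continuous_toLp 2 _)
  have hx' : (fun i => x i) ∈ ((fun v : Fin d → ℝ => (WithLp.toLp 2 v : E d)) ⁻¹' U) := hx
  obtain ⟨ε, hε, hsub⟩ := Metric.isOpen_iff.1 hopen _ hx'
  -- The open set contains a cube, that is, a product of infinite sets of reals.
  refine MvPolynomial.funext_set (fun i => Metric.ball (x i) ε) (fun i => ?_) fun v hv => ?_
  · rw [Real.ball_eq_Ioo]
    exact Set.Ioo_infinite (by linarith)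
  · have hv' : v ∈ Metric.ball (fun i => x i) ε := by
      rw [ball_pi _ hε]; exact hv
    have := h _ (hsub hv')
    simpa [Poly.val] using this

/-- The composition of a polynomial with `y ↦ x + r y`. -/
def Poly.rescale (x : E d) (r : ℝ) (f : Poly d) : Poly d :=
  aeval (fun i => C (x i) + C r * X i) f

theorem Poly.val_rescale (x : E d) (r : ℝ) (f : Poly d) (y : E d) :
    Poly.val (f.rescale x r) y = Poly.val f (x + r • y) := by
  rw [Poly.val, Poly.rescale, MvPolynomial.aeval_def, MvPolynomial.eval_eval₂, Poly.val]
  simp only [algebraMap_eq, map_add, map_mul, eval_C, eval_X, PiLp.add_apply, PiLp.smul_apply,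
    smul_eq_mul]
  rw [show (eval fun i => y i).comp C = RingHom.id ℝ by ext; simp]
  rfl

theorem Poly.totalDegree_rescale_le (x : E d) (r : ℝ) (f : Poly d) :
    (f.rescale x r).totalDegree ≤ f.totalDegree := by
  rw [Poly.rescale, MvPolynomial.aeval_def, MvPolynomial.eval₂_eq']
  refine totalDegree_finsetSum_le fun e he => ?_
  refine (totalDegree_mul _ _).trans ?_
  rw [algebraMap_eq, totalDegree_C, zero_add]
  refine (totalDegree_finsetProd _ _).trans (le_trans ?_ (le_totalDegree he))
  rw [Finsupp.sum_fintype _ _ fun _ => rfl]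
  refine Finset.sum_le_sum fun i _ => (totalDegree_pow _ _).trans ?_
  have : (C (x i) + C r * X i : MvPolynomial (Fin d) ℝ).totalDegree ≤ 1 := by
    refine (totalDegree_add _ _).trans (max_le (by simp) ((totalDegree_mul _ _).trans ?_))
    simp
  calc _ ≤ e i * 1 := Nat.mul_le_mul_left _ this
    _ = e i := mul_one _

theorem Poly.val_pderiv_rescale (x : E d) (r : ℝ) (f : Poly d) (i : Fin d) (y : E d) :
    Poly.val (pderiv i (f.rescale x r)) y = r * Poly.val (pderiv i f) (x + r • y) := by
  rw [← Poly.partialDeriv_val, ← Poly.partialDeriv_val]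
  have h1 : (Poly.val (f.rescale x r)) = Poly.val f ∘ fun y => x + r • y := by
    ext y; exact Poly.val_rescale x r f y
  have h2 : HasFDerivAt (fun y : E d => x + r • y) (r • ContinuousLinearMap.id ℝ (E d)) y :=
    ((hasFDerivAt_id y).const_smul r).const_add x
  rw [partialDeriv, h1, ((Poly.hasFDerivAt_val f (x + r • y)).comp y h2).fderiv, partialDeriv,
    (Poly.hasFDerivAt_val f (x + r • y)).fderiv]
  simp

end Polynomial

/-! ### Inverse estimates -/

section Inverse

open MvPolynomial Filter

variable {d : ℕ}

/-- On a finite-dimensional space every linear map is bounded with respect to a positive definite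
form. -/
theorem exists_norm_sq_le_of_posDef {V W : Type*} [AddCommGroup V] [Module ℝ V]
    [FiniteDimensional ℝ V] [NormedAddCommGroup W] [NormedSpace ℝ W] (B : V →ₗ[ℝ] V →ₗ[ℝ] ℝ)
    (hsymm : ∀ x y, B x y = B y x) (hpos : ∀ x, x ≠ 0 → 0 < B x x) (f : V →ₗ[ℝ] W) :
    ∃ C, 0 < C ∧ ∀ v, ‖f v‖ ^ 2 ≤ C * B v v := by
  have hnn : ∀ x, 0 ≤ B x x := fun x => by
    by_cases hx : x = 0
    · simp [hx]
    · exact (hpos x hx).le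
  -- The form is made the inner product of `V`, so that continuity of linear maps in finite
  -- dimension gives the bound.
  let core : InnerProductSpace.Core ℝ V :=
    { inner := fun x y => B x y
      conj_inner_symm := fun x y => by simpa using hsymm y x
      re_inner_nonneg := fun x => by simpa using hnn x
      add_left := fun x y z => by simp
      smul_left := fun x y r => by simp
      definite := fun x hx => by
        by_contra h
        exact (hpos x h).ne' hx }
  let _ : NormedAddCommGroup V := core.toNormedAddCommGroup
  let _ : InnerProductSpace ℝ V := InnerProductSpace.ofCore core.toCore
  have hB : ∀ v, ‖v‖ ^ 2 = B v v := fun v => (real_inner_self_eq_norm_sq v).symm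
  let F := LinearMap.toContinuousLinearMap f
  refine ⟨‖F‖ ^ 2 + 1, by positivity, fun v => ?_⟩
  have h1 : ‖f v‖ ≤ ‖F‖ * ‖v‖ := F.le_opNorm v
  calc ‖f v‖ ^ 2 ≤ (‖F‖ * ‖v‖) ^ 2 := pow_le_pow_left₀ (norm_nonneg _) h1 2
    _ = ‖F‖ ^ 2 * B v v := by rw [mul_pow, hB]
    _ ≤ _ := by nlinarith [hnn v]

theorem integrableOn_ball_of_continuous {f : E d → ℝ} (hf : Continuous f) (x : E d) (r : ℝ) :
    IntegrableOn f (Metric.ball x r) :=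
  (hf.continuousOn.integrableOn_compact (isCompact_closedBall x r)).mono_set
    Metric.ball_subset_closedBall

theorem integrableOn_ball_val_mul (p q : Poly d) (x : E d) (r : ℝ) :
    IntegrableOn (fun y => Poly.val p y * Poly.val q y) (Metric.ball x r) :=
  integrableOn_ball_of_continuous ((Poly.continuous_val p).mul (Poly.continuous_val q)) x r

/-- A continuous nonnegative integrand with vanishing integral is zero on the open set, and then so
is the polynomial. -/
theorem integral_sq_pos_of_ne_zero {f : Poly d} (hf : f ≠ 0) {U : Set (E d)} (hU : IsOpen U)
    (hne : U.Nonempty) (hinteg : IntegrableOn (fun y => Poly.val f y * Poly.val f y) U) :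
    0 < ∫ y in U, Poly.val f y * Poly.val f y := by
  have hnn : ∀ y, 0 ≤ Poly.val f y * Poly.val f y := fun y => mul_self_nonneg _
  refine lt_of_le_of_ne (integral_nonneg hnn) fun h0 => hf ?_
  obtain ⟨x, hx⟩ := hne
  have hae := (integral_eq_zero_iff_of_nonneg hnn hinteg).1 h0.symm
  have heq := Measure.eqOn_open_of_ae_eq hae hU
    ((Poly.continuous_val f).mul (Poly.continuous_val f)).continuousOn continuousOn_const
  exact Poly.eq_zero_of_isOpen hU hx fun y hy => mul_self_eq_zero.1 (heq hy)

/-- The `L²` form of the unit ball on polynomials of bounded degree. -/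
def ballForm (d m : ℕ) : restrictTotalDegree (Fin d) ℝ m →ₗ[ℝ]
    restrictTotalDegree (Fin d) ℝ m →ₗ[ℝ] ℝ :=
  LinearMap.mk₂ ℝ (fun p q => ∫ y in Metric.ball (0 : E d) 1,
      Poly.val (p : Poly d) y * Poly.val (q : Poly d) y)
    (by
      intro p p' q
      simp only [Submodule.coe_add, Poly.val_add, add_mul]
      exact integral_add (integrableOn_ball_val_mul _ _ _ _) (integrableOn_ball_val_mul _ _ _ _))
    (by
      intro a p q
      simp only [Submodule.coe_smul, Poly.val_smul, mul_assoc]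
      exact integral_const_mul _ _)
    (by
      intro p q q'
      simp only [Submodule.coe_add, Poly.val_add, mul_add]
      exact integral_add (integrableOn_ball_val_mul _ _ _ _) (integrableOn_ball_val_mul _ _ _ _))
    (by
      intro a p q
      simp only [Submodule.coe_smul, Poly.val_smul, mul_left_comm]
      exact integral_const_mul _ _)

/-- Boundedness of a linear map on the finite-dimensional space of polynomials of degree at most
`m`, with the supremum norm on the larger ball in the target. The operator `D` is later the identity
or a partial derivative. -/
theorem exists_sup_bound_unit_ball (d m : ℕ) (R : ℝ) (D : Poly d →ₗ[ℝ] Poly d) :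
    ∃ C, 0 < C ∧ ∀ p : Poly d, p.totalDegree ≤ m → ∀ y ∈ Metric.closedBall (0 : E d) R,
      Poly.val (D p) y ^ 2 ≤ C * ∫ y in Metric.ball (0 : E d) 1, Poly.val p y * Poly.val p y := by
  have : CompactSpace (Metric.closedBall (0 : E d) R) :=
    isCompact_iff_compactSpace.1 (isCompact_closedBall 0 R)
  let f : restrictTotalDegree (Fin d) ℝ m →ₗ[ℝ] C(Metric.closedBall (0 : E d) R, ℝ) :=
    { toFun := fun p => ⟨fun y => Poly.val (D p) y,
        (Poly.continuous_val _).comp continuous_subtype_val⟩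
      map_add' := fun p q => by
        ext y
        simp [Poly.val_add]
      map_smul' := fun a p => by
        ext y
        simp [Poly.val_smul] }
  obtain ⟨C, hC, h⟩ := exists_norm_sq_le_of_posDef (ballForm d m)
    (fun p q => by
      change ∫ y in Metric.ball (0 : E d) 1, _ = ∫ y in Metric.ball (0 : E d) 1, _
      congr 1; ext y; exact mul_comm _ _)
    (fun p hp => integral_sq_pos_of_ne_zero (fun h => hp (Subtype.ext h)) Metric.isOpen_ball
      ⟨0, Metric.mem_ball_self one_pos⟩ (integrableOn_ball_val_mul _ _ _ _)) f
  refine ⟨C, hC, fun p hp y hy => ?_⟩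
  have h1 := h ⟨p, (mem_restrictTotalDegree (Fin d) m p).2 hp⟩
  refine le_trans ?_ h1
  rw [← sq_abs]
  refine pow_le_pow_left₀ (abs_nonneg _) ?_ 2
  exact (f ⟨p, _⟩).norm_coe_le_norm ⟨y, hy⟩

theorem setIntegral_ball_rescale (f : E d → ℝ) (x : E d) {r : ℝ} (hr : 0 < r) :
    r ^ d * ∫ y in Metric.ball (0 : E d) 1, f (x + r • y) = ∫ y in Metric.ball x r, f y := by
  have h1 := Measure.setIntegral_comp_smul_of_pos (volume : Measure (E d)) (fun y => f (x + y))
    (Metric.ball (0 : E d) 1) hr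
  rw [h1, smul_unitBall_of_pos hr, finrank_euclideanSpace, Fintype.card_fin, smul_eq_mul,
    ← mul_assoc, mul_inv_cancel₀ (pow_pos hr d).ne', one_mul]
  have h2 := (measurePreserving_add_left (volume : Measure (E d)) x).setIntegral_preimage_emb
    (MeasurableEquiv.addLeft x).measurableEmbedding f (Metric.ball x r)
  rw [← h2]
  congr 2
  ext y
  simp [dist_eq_norm]

/-- Bounds of a polynomial and its derivatives on a ball by the `L²` norm on a smaller ball. -/
theorem exists_inverse_estimate (d m : ℕ) (R : ℝ) :
    ∃ C, 0 < C ∧ ∀ (x : E d) (r : ℝ), 0 < r → ∀ p : Poly d, p.totalDegree ≤ m →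
      ∀ y ∈ Metric.closedBall x (R * r),
        r ^ d * Poly.val p y ^ 2 ≤ C * ∫ z in Metric.ball x r, Poly.val p z ^ 2 ∧
        ∀ i, r ^ d * (r * Poly.val (pderiv i p) y) ^ 2 ≤
          C * ∫ z in Metric.ball x r, Poly.val p z ^ 2 := by
  obtain ⟨C, hC, h⟩ := exists_sup_bound_unit_ball d m R LinearMap.id
  choose C' hC' h' using fun i : Fin d =>
    exists_sup_bound_unit_ball d m R (pderiv i : Derivation ℝ (Poly d) (Poly d)).toLinearMap
  have hCs : ∀ i, C' i ≤ ∑ i, C' i := fun i =>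
    Finset.single_le_sum (fun j _ => (hC' j).le) (Finset.mem_univ i)
  have hCs0 : 0 ≤ ∑ i, C' i := Finset.sum_nonneg fun j _ => (hC' j).le
  refine ⟨C + ∑ i, C' i, by positivity, fun x r hr p hp y hy => ?_⟩
  -- Pulling back to the unit ball: the integral scales with `r ^ d`, and each derivative brings a
  -- factor `r`.
  set z : E d := r⁻¹ • (y - x) with hz
  have hyz : x + r • z = y := by
    rw [hz, smul_smul, mul_inv_cancel₀ hr.ne', one_smul]; abel
  have hzR : z ∈ Metric.closedBall (0 : E d) R := by
    rw [mem_closedBall_zero_iff, hz, norm_smul, norm_inv, Real.norm_of_nonneg hr.le,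
      inv_mul_le_iff₀ hr, ← dist_eq_norm, mul_comm]
    exact hy
  have hdeg := (Poly.totalDegree_rescale_le x r p).trans hp
  have hinteg : r ^ d * ∫ y in Metric.ball (0 : E d) 1,
      Poly.val (p.rescale x r) y * Poly.val (p.rescale x r) y =
        ∫ z in Metric.ball x r, Poly.val p z ^ 2 := by
    rw [← setIntegral_ball_rescale _ x hr]
    simp only [Poly.val_rescale, sq]
  have hI : 0 ≤ ∫ z in Metric.ball x r, Poly.val p z ^ 2 := integral_nonneg fun z => sq_nonneg _
  have hrd : 0 ≤ r ^ d := (pow_pos hr d).le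
  constructor
  · have h1 := h (p.rescale x r) hdeg z hzR
    rw [LinearMap.id_apply, Poly.val_rescale, hyz] at h1
    calc _ ≤ r ^ d * (C * ∫ y in Metric.ball (0 : E d) 1,
          Poly.val (p.rescale x r) y * Poly.val (p.rescale x r) y) :=
          mul_le_mul_of_nonneg_left h1 hrd
      _ = C * ∫ z in Metric.ball x r, Poly.val p z ^ 2 := by rw [← hinteg]; ring
      _ ≤ _ := mul_le_mul_of_nonneg_right (by linarith) hI
  · intro i
    have h1 := h' i (p.rescale x r) hdeg z hzR
    change Poly.val (pderiv i (p.rescale x r)) z ^ 2 ≤ _ at h1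
    rw [Poly.val_pderiv_rescale, hyz] at h1
    calc _ ≤ r ^ d * (C' i * ∫ y in Metric.ball (0 : E d) 1,
          Poly.val (p.rescale x r) y * Poly.val (p.rescale x r) y) :=
          mul_le_mul_of_nonneg_left h1 hrd
      _ = C' i * ∫ z in Metric.ball x r, Poly.val p z ^ 2 := by rw [← hinteg]; ring
      _ ≤ _ := mul_le_mul_of_nonneg_right (by linarith [hCs i]) hI

end Inverse

/-! ### Functions glued from cells -/

section Glue

open Filter

variable {d : ℕ} [NeZero d] {T : Mesh d} {Ω : Set (E d)}

theorem Mesh.glue_of_mem {F : Type} [AddCommMonoid F] (f : T.cells → E d → F) {K : T.cells}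
    {x : E d} (hx : x ∈ K.1.interior) : T.glue f x = f K x := by
  rw [Mesh.glue, Finset.sum_eq_single K]
  · rw [Set.indicator_of_mem hx]
  · intro K' _ hne
    refine Set.indicator_of_notMem (fun hx' => hne ?_) _
    exact (Subtype.ext (Mesh.eq_of_mem_interior K.2 K'.2 hx
      (K'.1.interior_subset_closedInterior hx'))).symm
  · simp

theorem Mesh.pairwise_disjoint_interior :
    Pairwise fun K K' : T.cells => Disjoint K.1.interior K'.1.interior := by
  intro K K' hne
  refine Set.disjoint_left.2 fun x hx hx' => hne ?_
  exact Subtype.ext (Mesh.eq_of_mem_interior K.2 K'.2 hx (K'.1.interior_subset_closedInterior hx'))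

/-- The boundary of a cell is that of a convex set, hence null. -/
theorem Mesh.Triangulates.ae_eq_iUnion (hT : T.Triangulates Ω) :
    Ω =ᵐ[volume] ⋃ K : T.cells, K.1.interior := by
  refine Filter.EventuallyLE.antisymm ?_
    (Set.iUnion_subset fun K : T.cells => hT.interior_cell_subset K.2).eventuallyLE
  · have h0 : volume (⋃ K : T.cells, K.1.closedInterior \ K.1.interior) = 0 :=
      measure_iUnion_null fun K => volume_closedInterior_diff_interior K.1
    filter_upwards [compl_mem_ae_iff.2 h0] with x hx hxΩ
    have hxT := hT.closure_subset (subset_closure hxΩ)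
    simp only [Mesh.space, Set.mem_iUnion] at hxT
    obtain ⟨K, hK, hxK⟩ := hxT
    refine Set.mem_iUnion.2 ⟨⟨K, hK⟩, ?_⟩
    by_contra hc
    exact hx (Set.mem_iUnion.2 ⟨⟨K, hK⟩, hxK, hc⟩)

theorem Mesh.Triangulates.ae_mem_interior (hT : T.Triangulates Ω) :
    ∀ᵐ x ∂(volume.restrict Ω), ∃ K : T.cells, x ∈ K.1.interior := by
  rw [Measure.restrict_congr_set hT.ae_eq_iUnion]
  filter_upwards [ae_restrict_mem (MeasurableSet.iUnion fun K : T.cells =>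
    (isOpen_interior K.1).measurableSet)] with x hx
  exact Set.mem_iUnion.1 hx

theorem Mesh.Triangulates.setIntegral_eq_sum (hT : T.Triangulates Ω) {f : E d → ℝ}
    (hf : IntegrableOn f Ω) : ∫ x in Ω, f x = ∑ K : T.cells, ∫ x in K.1.interior, f x := by
  rw [setIntegral_congr_set hT.ae_eq_iUnion]
  exact integral_iUnion_fintype (fun K => (isOpen_interior K.1).measurableSet)
    Mesh.pairwise_disjoint_interior fun K => hf.mono_set (hT.interior_cell_subset K.2)

theorem Mesh.memLp_glue {F : Type} [NormedAddCommGroup F] {f : T.cells → E d → F}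
    (hf : ∀ K, Continuous (f K)) (Ω : Set (E d)) : MemLp (T.glue f) ∞ (volume.restrict Ω) := by
  have : T.glue f = fun x => ∑ K : T.cells, K.1.interior.indicator (f K) x := rfl
  rw [this]
  refine memLp_finsetSum _ fun K _ => ?_
  obtain ⟨B, hB⟩ := (isCompact_closedInterior K.1).exists_bound_of_continuousOn (hf K).continuousOn
  refine memLp_top_of_bound ((hf K).aestronglyMeasurable.indicator
    (isOpen_interior K.1).measurableSet) (max B 0) (Eventually.of_forall fun x => ?_)
  by_cases hx : x ∈ K.1.interior
  · rw [Set.indicator_of_mem hx]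
    exact (hB x (K.1.interior_subset_closedInterior hx)).trans (le_max_left _ _)
  · rw [Set.indicator_of_notMem hx, norm_zero]
    exact le_max_right _ _

theorem Mesh.memLp_vec (u : T.Piecewise) : MemLp (T.vec u) ∞ (volume.restrict Ω) :=
  Mesh.memLp_glue (fun _ => continuous_vecVal _) Ω

theorem Mesh.memLp_div (u : T.Piecewise) : MemLp (T.div u) ∞ (volume.restrict Ω) :=
  Mesh.memLp_glue (fun _ => continuous_divVal _) Ω

theorem Mesh.memLp_scal (u : T.Piecewise) : MemLp (T.scal u) ∞ (volume.restrict Ω) :=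
  Mesh.memLp_glue (fun _ => Poly.continuous_val _) Ω

theorem Mesh.memLp_grad (u : T.Piecewise) : MemLp (T.grad u) ∞ (volume.restrict Ω) :=
  Mesh.memLp_glue (fun _ => continuous_gradVal _) Ω

theorem memLp_coord {V : E d → E d} {p : ℝ≥0∞} {μ : Measure (E d)} (hV : MemLp V p μ) (i : Fin d) :
    MemLp (fun x => V x i) p μ :=
  (EuclideanSpace.proj (𝕜 := ℝ) i : E d →L[ℝ] ℝ).comp_memLp' hV

/-- The weak divergence of a piecewise polynomial field in `H(div)` is the cellwise one. -/
theorem Mesh.Triangulates.hasWeakDiv_vec (hT : T.Triangulates Ω) {u : T.Piecewise}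
    (hu : MemHdiv Ω (T.vec u)) : HasWeakDiv Ω (T.vec u) (T.div u) := by
  obtain ⟨-, g, -, hg⟩ := hu
  have hae : ∀ᵐ x ∂(volume.restrict Ω), g x = T.div u x := by
    -- A weak divergence exists by assumption, and it is local: inside a cell the field is a
    -- polynomial, which forces the classical value.
    have h1 : ∀ K : T.cells, ∀ᵐ x, x ∈ K.1.interior →
        g x = ∑ i, partialDeriv i (Poly.val (u.1 K i)) x := fun K =>
      hg.ae_eq_of_contDiff (isOpen_interior K.1) (hT.interior_cell_subset K.2)
        (fun i => Poly.contDiff_val _) fun x hx i => by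
          rw [Mesh.vec, Mesh.glue_of_mem _ hx]; rfl
    filter_upwards [hT.ae_mem_interior, ae_restrict_of_ae (ae_all_iff.2 h1)] with x ⟨K, hx⟩ h
    rw [h K hx, Mesh.div, Mesh.glue_of_mem _ hx, divVal]
    exact Finset.sum_congr rfl fun i _ => Poly.partialDeriv_val _ _ _
  refine ⟨hg.1, MemLp.locallyIntegrableOn_of_top le_top (Mesh.memLp_div u), fun φ hφ => ?_⟩
  rw [hg.2.2 φ hφ]
  congr 1
  refine integral_congr_ae ?_
  filter_upwards [hae] with x hx
  rw [hx]

/-- The weak gradient of a piecewise polynomial in `H¹` is the cellwise one. -/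
theorem Mesh.Triangulates.memW1Infty_scal (hT : T.Triangulates Ω) {u : T.Piecewise}
    (hu : MemH1 Ω (T.scal u)) : MemW1Infty Ω (T.scal u) (fun i x => T.grad u x i) := by
  refine ⟨Mesh.memLp_scal u, fun i => ⟨memLp_coord (Mesh.memLp_grad u) i, ?_⟩⟩
  obtain ⟨g, -, hg⟩ := hu.2 i
  have hae : ∀ᵐ x ∂(volume.restrict Ω), g x = T.grad u x i := by
    have h1 : ∀ K : T.cells, ∀ᵐ x, x ∈ K.1.interior →
        g x = ∑ j, partialDeriv j (if j = i then Poly.val (u.2 K) else 0) x := fun K =>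
      hg.hasWeakDiv_single.ae_eq_of_contDiff (isOpen_interior K.1) (hT.interior_cell_subset K.2)
        (fun j => by
          split_ifs
          · exact Poly.contDiff_val _
          · exact contDiff_const) fun x hx j => by
          rw [Mesh.scal, Mesh.glue_of_mem _ hx]
          by_cases hj : j = i
          · simp [hj]
          · simp [hj]
    filter_upwards [hT.ae_mem_interior, ae_restrict_of_ae (ae_all_iff.2 h1)] with x ⟨K, hx⟩ h
    rw [h K hx, Mesh.grad, Mesh.glue_of_mem _ hx, Finset.sum_eq_single i]
    · rw [if_pos rfl, Poly.partialDeriv_val]; rfl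
    · intro j _ hj
      rw [if_neg hj]
      simp [partialDeriv]
    · simp
  refine ⟨hg.1, MemLp.locallyIntegrableOn_of_top le_top (memLp_coord (Mesh.memLp_grad u) i),
    fun φ hφ => ?_⟩
  rw [hg.2.2 φ hφ]
  congr 1
  refine integral_congr_ae ?_
  filter_upwards [hae] with x hx
  rw [hx]

end Glue

/-! ### Scaling on shape regular, quasi-uniform meshes -/

section Scaling

open Filter MvPolynomial

variable {d : ℕ} [NeZero d]

/-- The estimates on the cells of a mesh, with a common constant. -/
structure MeshBounds (T : Mesh d) (m : ℕ) (C : ℝ) : Prop where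
  h_pos : 0 < T.h
  volume_le : ∀ K ∈ T.cells, volume.real K.closedInterior ≤ C * T.h ^ d
  le_volume : ∀ K ∈ T.cells, T.h ^ d ≤ C * volume.real K.closedInterior
  diam_le : ∀ K ∈ T.cells, Metric.diam K.closedInterior ≤ C * T.h
  ball_subset : ∀ K ∈ T.cells, ∃ x r, 0 < r ∧ T.h ≤ C * r ∧ Metric.ball x r ⊆ K.closedInterior
  measure_face_le : ∀ K ∈ T.cells, ∀ i,
    (μHE[d - 1] : Measure (E d)).real (face K i) ≤ C * T.h ^ (d - 1)
  faceSize_le : ∀ K ∈ T.cells, ∀ i, faceSize K i ≤ C * T.h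
  val_sq_le : ∀ K ∈ T.cells, ∀ p : Poly d, p.totalDegree ≤ m → ∀ y ∈ K.closedInterior,
    T.h ^ d * Poly.val p y ^ 2 ≤ C * ∫ z in K.interior, Poly.val p z ^ 2
  pderiv_sq_le : ∀ K ∈ T.cells, ∀ p : Poly d, p.totalDegree ≤ m → ∀ y ∈ K.closedInterior, ∀ i,
    T.h ^ d * (T.h * Poly.val (pderiv i p) y) ^ 2 ≤ C * ∫ z in K.interior, Poly.val p z ^ 2

theorem cellSize_pow (K : Affine.Simplex ℝ (E d) d) :
    cellSize K ^ d = volume.real K.closedInterior := by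
  rw [cellSize]
  exact Real.rpow_inv_natCast_pow measureReal_nonneg (NeZero.ne d)

theorem cellSize_nonneg (K : Affine.Simplex ℝ (E d) d) : 0 ≤ cellSize K :=
  Real.rpow_nonneg measureReal_nonneg _

theorem cellSize_le_h (T : Mesh d) {K : Affine.Simplex ℝ (E d) d} (hK : K ∈ T.cells) :
    cellSize K ≤ T.h :=
  le_ciSup (f := fun K : T.cells => cellSize K.1) (Set.finite_range _).bddAbove ⟨K, hK⟩

theorem integrableOn_interior_of_continuous {f : E d → ℝ} (hf : Continuous f)
    (K : Affine.Simplex ℝ (E d) d) : IntegrableOn f K.interior :=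
  (hf.continuousOn.integrableOn_compact (isCompact_closedInterior K)).mono_set
    K.interior_subset_closedInterior

theorem ball_subset_interior {K : Affine.Simplex ℝ (E d) d} {x : E d} {r : ℝ}
    (h : Metric.ball x r ⊆ K.closedInterior) : Metric.ball x r ⊆ K.interior := by
  rw [← interior_closedInterior]
  exact interior_maximal h Metric.isOpen_ball

/-- Each cell lies between the balls of radius `r` and `s * r` around one point, so volume, diameter
and inverse estimates are governed by `r`, and face sizes have the corresponding upper bounds.
Quasi-uniformity makes every `r` comparable with `h`. -/
theorem exists_meshBounds (d : ℕ) [NeZero d] (hd : 2 ≤ d) (σ ρ : ℝ) (m : ℕ) :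
    ∃ C, 1 ≤ C ∧ ∀ T : Mesh d, T.cells.Nonempty → T.ShapeRegular σ → T.QuasiUniform ρ →
      MeshBounds T m C := by
  -- Absolute values and the summand one keep the constants positive for arbitrary real `σ` and `ρ`.
  set s := |σ| + 1 with hs
  set q := |ρ| + 1 with hq
  have hs0 : 0 < s := by positivity
  have hq0 : 0 < q := by positivity
  set ω := volume.real (Metric.ball (0 : E d) 1) with hω
  have hω0 : 0 < ω := by
    rw [hω, Measure.real, ENNReal.toReal_pos_iff]
    exact ⟨Metric.measure_ball_pos _ _ one_pos, measure_ball_lt_top⟩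
  set ω' := volume.real (Metric.ball (0 : E (d - 1)) 1) with hω'
  have hω'0 : 0 ≤ ω' := measureReal_nonneg
  set a := ω ^ ((d : ℝ)⁻¹) with ha
  have ha0 : 0 < a := Real.rpow_pos_of_pos hω0 _
  have had : a ^ d = ω := Real.rpow_inv_natCast_pow hω0.le (NeZero.ne d)
  -- A ball of radius `r` has size `a * r`, so `h ≤ q * h_K ≤ q * (s * (a * r)) = b * r`.
  set b := q * (s * a) with hb
  have hb0 : 0 < b := by positivity
  obtain ⟨C₀, hC₀, hinv⟩ := exists_inverse_estimate d m s
  set c₁ := (s / a) ^ (d - 1) * ω' with hc₁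
  have hc₁0 : 0 ≤ c₁ := by positivity
  set c₂ := c₁ ^ (((d : ℝ) - 1)⁻¹) with hc₂
  have hc₂0 : 0 ≤ c₂ := Real.rpow_nonneg hc₁0 _
  -- One summand for each estimate. The powers of `b` replace `r` by `h` in the inverse estimates,
  -- where the one for derivatives has two more factors.
  set C := 1 + s ^ d + q ^ d + s / a + b + c₁ + c₂ + b ^ d * C₀ + b ^ (d + 2) * C₀ with hC
  have p1 : 0 ≤ s ^ d := by positivity
  have p2 : 0 ≤ q ^ d := by positivity
  have p3 : 0 ≤ s / a := by positivity
  have p4 : 0 ≤ b ^ d * C₀ := by positivity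
  have p5 : 0 ≤ b ^ (d + 2) * C₀ := by positivity
  refine ⟨C, by linarith, fun T hne hsr hqu => ?_⟩
  have key : ∀ K ∈ T.cells, ∃ (x : E d) (r : ℝ), 0 < r ∧ Metric.ball x r ⊆ K.closedInterior ∧
      K.closedInterior ⊆ Metric.closedBall x (s * r) ∧ Metric.diam K.closedInterior ≤ s * r ∧
      a * r ≤ T.h ∧ T.h ≤ b * r ∧ T.h ≤ q * cellSize K ∧ cellSize K ≤ s * (a * r) := by
    intro K hK
    obtain ⟨x, r, hr, hball, hdiam⟩ := hsr K hK
    have hdiam' : Metric.diam K.closedInterior ≤ s * r :=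
      hdiam.trans (mul_le_mul_of_nonneg_right (by rw [hs]; linarith [le_abs_self σ]) hr.le)
    have hsub : K.closedInterior ⊆ Metric.closedBall x (s * r) := by
      intro y hy
      exact (Metric.dist_le_diam_of_mem (isCompact_closedInterior K).isBounded hy
        (hball (Metric.mem_ball_self hr))).trans hdiam'
    have hfin : volume K.closedInterior ≠ ∞ := (isCompact_closedInterior K).measure_lt_top.ne
    have hv1 : (a * r) ^ d ≤ volume.real K.closedInterior := by
      have h1 : volume.real (Metric.ball x r) = r ^ d * ω := by
        rw [Measure.real, Measure.addHaar_ball _ _ hr.le, ENNReal.toReal_mul,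
          ENNReal.toReal_ofReal (by positivity)]
        simp [hω, Measure.real]
      rw [mul_pow, had, mul_comm, ← h1]
      exact measureReal_mono hball hfin
    have hv2 : volume.real K.closedInterior ≤ (s * (a * r)) ^ d := by
      have h1 : volume.real (Metric.closedBall x (s * r)) = (s * r) ^ d * ω := by
        rw [Measure.real, Measure.addHaar_closedBall _ _ (by positivity), ENNReal.toReal_mul,
          ENNReal.toReal_ofReal (by positivity)]
        simp [hω, Measure.real]
      have h2 : (s * (a * r)) ^ d = (s * r) ^ d * ω := by rw [← had]; ring
      rw [h2, ← h1]
      exact measureReal_mono hsub measure_closedBall_lt_top.ne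
    have hc1 : a * r ≤ cellSize K := by
      refine le_of_pow_le_pow_left₀ (NeZero.ne d) (cellSize_nonneg K) ?_
      rw [cellSize_pow]; exact hv1
    have hc2 : cellSize K ≤ s * (a * r) := by
      refine le_of_pow_le_pow_left₀ (NeZero.ne d) (by positivity) ?_
      rw [cellSize_pow]; exact hv2
    have hhq : T.h ≤ q * cellSize K :=
      (hqu K hK).trans (mul_le_mul_of_nonneg_right (by rw [hq]; linarith [le_abs_self ρ])
        (cellSize_nonneg K))
    refine ⟨x, r, hr, hball, hsub, hdiam', hc1.trans (cellSize_le_h T hK), ?_, hhq, hc2⟩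
    calc T.h ≤ q * cellSize K := hhq
      _ ≤ q * (s * (a * r)) := mul_le_mul_of_nonneg_left hc2 hq0.le
      _ = b * r := by rw [hb]; ring
  have hpos : 0 < T.h := by
    obtain ⟨K, hK⟩ := hne
    obtain ⟨x, r, hr, -, -, -, h1, -⟩ := key K hK
    exact (mul_pos ha0 hr).trans_le h1
  have hdiam : ∀ K ∈ T.cells, Metric.diam K.closedInterior ≤ s / a * T.h := by
    intro K hK
    obtain ⟨x, r, hr, -, -, hdm, h1, -⟩ := key K hK
    calc _ ≤ s * r := hdm
      _ = s / a * (a * r) := by field_simp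
      _ ≤ _ := mul_le_mul_of_nonneg_left h1 p3
  have hface : ∀ K ∈ T.cells, ∀ i,
      (μHE[d - 1] : Measure (E d)).real (face K i) ≤ c₁ * T.h ^ (d - 1) := by
    intro K hK i
    have h1 := ENNReal.toReal_mono (ENNReal.mul_lt_top ENNReal.ofReal_lt_top
      measure_ball_lt_top).ne (measure_face_le K i)
    rw [ENNReal.toReal_mul, ENNReal.toReal_ofReal (pow_nonneg Metric.diam_nonneg _)] at h1
    calc _ ≤ Metric.diam K.closedInterior ^ (d - 1) * ω' := h1
      _ ≤ (s / a * T.h) ^ (d - 1) * ω' := mul_le_mul_of_nonneg_right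
          (pow_le_pow_left₀ Metric.diam_nonneg (hdiam K hK) _) hω'0
      _ = _ := by rw [hc₁]; ring
  have hI : ∀ (K : Affine.Simplex ℝ (E d) d) (x : E d) (r : ℝ) (p : Poly d),
      Metric.ball x r ⊆ K.closedInterior →
      ∫ z in Metric.ball x r, Poly.val p z ^ 2 ≤ ∫ z in K.interior, Poly.val p z ^ 2 := by
    intro K x r p hsub
    exact setIntegral_mono_set (integrableOn_interior_of_continuous
      ((Poly.continuous_val p).pow 2) K) (Eventually.of_forall fun z => sq_nonneg _)
      (ball_subset_interior hsub).eventuallyLE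
  have hI0 : ∀ (K : Affine.Simplex ℝ (E d) d) (p : Poly d),
      0 ≤ ∫ z in K.interior, Poly.val p z ^ 2 := fun K p => integral_nonneg fun z => sq_nonneg _
  have hhd : 0 ≤ T.h ^ d := (pow_pos hpos d).le
  have hhd' : 0 ≤ T.h ^ (d - 1) := (pow_pos hpos _).le
  refine ⟨hpos, fun K hK => ?_, fun K hK => ?_, fun K hK => ?_, fun K hK => ?_, fun K hK i => ?_,
    fun K hK i => ?_, fun K hK p hp y hy => ?_, fun K hK p hp y hy i => ?_⟩
  · obtain ⟨x, r, hr, -, -, -, h1, -, -, h2⟩ := key K hK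
    rw [← cellSize_pow]
    calc cellSize K ^ d ≤ (s * (a * r)) ^ d := pow_le_pow_left₀ (cellSize_nonneg K) h2 d
      _ ≤ (s * T.h) ^ d := pow_le_pow_left₀ (by positivity)
          (mul_le_mul_of_nonneg_left h1 hs0.le) d
      _ = s ^ d * T.h ^ d := mul_pow _ _ _
      _ ≤ C * T.h ^ d := mul_le_mul_of_nonneg_right (by linarith) hhd
  · obtain ⟨x, r, hr, -, -, -, -, -, h1, -⟩ := key K hK
    calc T.h ^ d ≤ (q * cellSize K) ^ d := pow_le_pow_left₀ hpos.le h1 d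
      _ = q ^ d * volume.real K.closedInterior := by rw [mul_pow, cellSize_pow]
      _ ≤ _ := mul_le_mul_of_nonneg_right (by linarith) measureReal_nonneg
  · exact (hdiam K hK).trans (mul_le_mul_of_nonneg_right (by linarith) hpos.le)
  · obtain ⟨x, r, hr, hball, -, -, -, h1, -⟩ := key K hK
    exact ⟨x, r, hr, h1.trans (mul_le_mul_of_nonneg_right (by linarith) hr.le), hball⟩
  · exact (hface K hK i).trans (mul_le_mul_of_nonneg_right (by linarith) hhd')
  · have h1 : faceSize K i ≤ c₂ * T.h := by
      have hd1 : ((d - 1 : ℕ) : ℝ) = (d : ℝ) - 1 := by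
        rw [Nat.cast_sub (by omega)]; simp
      have hd0 : d - 1 ≠ 0 := by omega
      rw [faceSize, hc₂, ← hd1]
      calc _ ≤ (c₁ * T.h ^ (d - 1)) ^ (((d - 1 : ℕ) : ℝ)⁻¹) :=
            Real.rpow_le_rpow measureReal_nonneg (hface K hK i) (by positivity)
        _ = _ := by
          rw [Real.mul_rpow hc₁0 hhd', Real.pow_rpow_inv_natCast hpos.le hd0]
    exact h1.trans (mul_le_mul_of_nonneg_right (by linarith) hpos.le)
  · obtain ⟨x, r, hr, hball, hsub, -, -, h1, -⟩ := key K hK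
    have h2 := (hinv x r hr p hp y (hsub hy)).1
    calc T.h ^ d * Poly.val p y ^ 2 ≤ (b * r) ^ d * Poly.val p y ^ 2 :=
          mul_le_mul_of_nonneg_right (pow_le_pow_left₀ hpos.le h1 d) (sq_nonneg _)
      _ = b ^ d * (r ^ d * Poly.val p y ^ 2) := by ring
      _ ≤ b ^ d * (C₀ * ∫ z in K.interior, Poly.val p z ^ 2) :=
          mul_le_mul_of_nonneg_left (h2.trans (mul_le_mul_of_nonneg_left (hI K x r p hball) hC₀.le))
            (by positivity)
      _ = b ^ d * C₀ * ∫ z in K.interior, Poly.val p z ^ 2 := by ring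
      _ ≤ _ := mul_le_mul_of_nonneg_right (by linarith) (hI0 K p)
  · obtain ⟨x, r, hr, hball, hsub, -, -, h1, -⟩ := key K hK
    have h2 := (hinv x r hr p hp y (hsub hy)).2 i
    set D := Poly.val (pderiv i p) y
    calc T.h ^ d * (T.h * D) ^ 2 = T.h ^ (d + 2) * D ^ 2 := by ring
      _ ≤ (b * r) ^ (d + 2) * D ^ 2 :=
          mul_le_mul_of_nonneg_right (pow_le_pow_left₀ hpos.le h1 _) (sq_nonneg _)
      _ = b ^ (d + 2) * (r ^ d * (r * D) ^ 2) := by ring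
      _ ≤ b ^ (d + 2) * (C₀ * ∫ z in K.interior, Poly.val p z ^ 2) :=
          mul_le_mul_of_nonneg_left (h2.trans (mul_le_mul_of_nonneg_left (hI K x r p hball) hC₀.le))
            (by positivity)
      _ = b ^ (d + 2) * C₀ * ∫ z in K.interior, Poly.val p z ^ 2 := by ring
      _ ≤ _ := mul_le_mul_of_nonneg_right (by linarith) (hI0 K p)

end Scaling

/-! ### Boundedness of the least squares form -/

section Upper

open Filter MvPolynomial

variable {d : ℕ} {T : Mesh d} {Ω : Set (E d)}

/-- The squared `L²` norm of the vector component on the cell `K`. -/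
def vecNormSq (u : T.Piecewise) (K : T.cells) : ℝ :=
  ∑ i, ∫ z in K.1.interior, Poly.val (u.1 K i) z ^ 2

/-- The squared `L²` norm of the scalar component on the cell `K`. -/
def scalNormSq (u : T.Piecewise) (K : T.cells) : ℝ :=
  ∫ z in K.1.interior, Poly.val (u.2 K) z ^ 2

theorem vecNormSq_nonneg (u : T.Piecewise) (K : T.cells) : 0 ≤ vecNormSq u K :=
  Finset.sum_nonneg fun _ _ => integral_nonneg fun _ => sq_nonneg _

theorem scalNormSq_nonneg (u : T.Piecewise) (K : T.cells) : 0 ≤ scalNormSq u K :=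
  integral_nonneg fun _ => sq_nonneg _

/-- All polynomials that make up `u` have degree at most `m`. -/
def DegreeLE (m : ℕ) (u : T.Piecewise) : Prop :=
  ∀ K, (∀ i, (u.1 K i).totalDegree ≤ m) ∧ (u.2 K).totalDegree ≤ m

/-- The Raviart–Thomas part `x P_{k+1}` raises the degree to `k + 2`. -/
theorem Mesh.MemFESpace.degreeLE {k : ℕ} {u : T.Piecewise} (hu : T.MemFESpace Ω k u) :
    DegreeLE (k + 2) u := by
  intro K
  refine ⟨fun i => ?_, (hu.2.2 K).trans (by omega)⟩
  obtain ⟨a, b, ha, hb, h⟩ := hu.1.2 K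
  rw [h i]
  refine totalDegree_add_le' ((ha i).trans (by omega)) ((totalDegree_mul _ _).trans ?_)
  rw [totalDegree_X]
  omega

theorem sq_norm_vecVal (f : Fin d → Poly d) (x : E d) :
    ‖vecVal f x‖ ^ 2 = ∑ i, Poly.val (f i) x ^ 2 := by
  rw [EuclideanSpace.real_norm_sq_eq]; rfl

theorem sq_norm_gradVal (f : Poly d) (x : E d) :
    ‖gradVal f x‖ ^ 2 = ∑ i, Poly.val (pderiv i f) x ^ 2 := by
  rw [EuclideanSpace.real_norm_sq_eq]; rfl

variable [NeZero d]

theorem integrableOn_of_memLp_top (hT : T.Triangulates Ω) {f : E d → ℝ}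
    (hf : MemLp f ∞ (volume.restrict Ω)) : IntegrableOn f Ω := by
  have : IsFiniteMeasure (volume.restrict Ω) :=
    ⟨by rw [Measure.restrict_apply_univ]; exact hT.isBounded.measure_lt_top⟩
  exact hf.integrable le_top

theorem memLp_top_inner {V W : E d → E d} {μ : Measure (E d)} (hV : MemLp V ∞ μ)
    (hW : MemLp W ∞ μ) : MemLp (fun x => inner ℝ (V x) (W x)) ∞ μ := by
  obtain ⟨A, hA0, hA⟩ := exists_bound_of_memLp_top hV
  obtain ⟨B, hB0, hB⟩ := exists_bound_of_memLp_top hW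
  refine memLp_top_of_bound (hV.1.inner hW.1) (A * B) ?_
  filter_upwards [hA, hB] with x h1 h2
  exact (norm_inner_le_norm _ _).trans (mul_le_mul h1 h2 (norm_nonneg _) hA0)

theorem memLp_top_mul {f g : E d → ℝ} {μ : Measure (E d)} (hf : MemLp f ∞ μ)
    (hg : MemLp g ∞ μ) : MemLp (fun x => f x * g x) ∞ μ := by
  obtain ⟨A, hA0, hA⟩ := exists_bound_of_memLp_top hf
  obtain ⟨B, hB0, hB⟩ := exists_bound_of_memLp_top hg
  refine memLp_top_of_bound (hf.1.mul hg.1) (A * B) ?_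
  filter_upwards [hA, hB] with x h1 h2
  exact (norm_mul_le _ _).trans (mul_le_mul h1 h2 (norm_nonneg _) hA0)

theorem vecNormSq_eq (u : T.Piecewise) (K : T.cells) :
    vecNormSq u K = ∫ z in K.1.interior, ‖vecVal (u.1 K) z‖ ^ 2 := by
  have hi : ∀ i ∈ (Finset.univ : Finset (Fin d)),
      IntegrableOn (fun z => Poly.val (u.1 K i) z ^ 2) K.1.interior := fun i _ =>
    integrableOn_interior_of_continuous ((Poly.continuous_val _).pow 2) K.1
  simp only [sq_norm_vecVal]
  rw [vecNormSq, integral_finsetSum _ hi]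

theorem integral_sq_norm_vec (hT : T.Triangulates Ω) (u : T.Piecewise) :
    ∫ x in Ω, ‖T.vec u x‖ ^ 2 = ∑ K, vecNormSq u K := by
  rw [hT.setIntegral_eq_sum]
  · refine Finset.sum_congr rfl fun K _ => ?_
    rw [vecNormSq_eq]
    refine setIntegral_congr_fun (isOpen_interior K.1).measurableSet fun x hx => ?_
    simp only [Mesh.vec, Mesh.glue_of_mem _ hx]
  · refine integrableOn_of_memLp_top hT ?_
    simpa only [real_inner_self_eq_norm_sq] using
      memLp_top_inner (Mesh.memLp_vec (Ω := Ω) u) (Mesh.memLp_vec u)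

theorem integral_sq_scal (hT : T.Triangulates Ω) (u : T.Piecewise) :
    ∫ x in Ω, T.scal u x ^ 2 = ∑ K, scalNormSq u K := by
  rw [hT.setIntegral_eq_sum]
  · refine Finset.sum_congr rfl fun K _ => ?_
    refine setIntegral_congr_fun (isOpen_interior K.1).measurableSet fun x hx => ?_
    simp only [Mesh.scal, Mesh.glue_of_mem _ hx]
  · refine integrableOn_of_memLp_top hT ?_
    simpa only [pow_two] using memLp_top_mul (Mesh.memLp_scal (Ω := Ω) u) (Mesh.memLp_scal u)

theorem l2Form_self (u : T.Piecewise) :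
    l2Form Ω T u u = (∫ x in Ω, ‖T.vec u x‖ ^ 2) + ∫ x in Ω, T.scal u x ^ 2 := by
  simp only [l2Form, real_inner_self_eq_norm_sq, pow_two]

theorem l2Form_self_eq_sum (hT : T.Triangulates Ω) (u : T.Piecewise) :
    l2Form Ω T u u = ∑ K, (vecNormSq u K + scalNormSq u K) := by
  rw [l2Form_self, integral_sq_norm_vec hT, integral_sq_scal hT, Finset.sum_add_distrib]

section PointBounds

variable {m : ℕ} {C : ℝ} {u : T.Piecewise} {x : E d}

theorem MeshBounds.vec_le (hB : MeshBounds T m C) (hu : DegreeLE m u) (K : T.cells)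
    (hx : x ∈ K.1.closedInterior) : T.h ^ d * ‖vecVal (u.1 K) x‖ ^ 2 ≤ C * vecNormSq u K := by
  rw [sq_norm_vecVal, vecNormSq, Finset.mul_sum, Finset.mul_sum]
  exact Finset.sum_le_sum fun i _ => hB.val_sq_le K.1 K.2 _ ((hu K).1 i) x hx

theorem MeshBounds.scal_le (hB : MeshBounds T m C) (hu : DegreeLE m u) (K : T.cells)
    (hx : x ∈ K.1.closedInterior) : T.h ^ d * Poly.val (u.2 K) x ^ 2 ≤ C * scalNormSq u K :=
  hB.val_sq_le K.1 K.2 _ (hu K).2 x hx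

theorem MeshBounds.grad_le (hB : MeshBounds T m C) (hu : DegreeLE m u) (K : T.cells)
    (hx : x ∈ K.1.closedInterior) :
    T.h ^ d * (T.h ^ 2 * ‖gradVal (u.2 K) x‖ ^ 2) ≤ d * C * scalNormSq u K := by
  rw [sq_norm_gradVal, Finset.mul_sum, Finset.mul_sum]
  calc _ ≤ ∑ i : Fin d, C * scalNormSq u K := Finset.sum_le_sum fun i _ => by
        rw [← mul_pow]; exact hB.pderiv_sq_le K.1 K.2 _ (hu K).2 x hx i
    _ = _ := by simp [mul_assoc]

theorem MeshBounds.div_le (hB : MeshBounds T m C) (hu : DegreeLE m u) (K : T.cells)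
    (hx : x ∈ K.1.closedInterior) :
    T.h ^ d * (T.h ^ 2 * divVal (u.1 K) x ^ 2) ≤ d * C * vecNormSq u K := by
  have h1 : divVal (u.1 K) x ^ 2 ≤ d * ∑ i, Poly.val (pderiv i (u.1 K i)) x ^ 2 := by
    have := sq_sum_le_card_mul_sum_sq (s := Finset.univ)
      (f := fun i : Fin d => Poly.val (pderiv i (u.1 K i)) x)
    simpa [divVal] using this
  have h2 : T.h ^ d * (T.h ^ 2 * ∑ i, Poly.val (pderiv i (u.1 K i)) x ^ 2) ≤ C * vecNormSq u K := by
    rw [vecNormSq, Finset.mul_sum, Finset.mul_sum, Finset.mul_sum]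
    refine Finset.sum_le_sum fun i _ => ?_
    rw [← mul_pow]
    exact hB.pderiv_sq_le K.1 K.2 _ ((hu K).1 i) x hx i
  have hh := hB.h_pos
  calc _ ≤ T.h ^ d * (T.h ^ 2 * (d * ∑ i, Poly.val (pderiv i (u.1 K i)) x ^ 2)) := by gcongr
    _ = d * (T.h ^ d * (T.h ^ 2 * ∑ i, Poly.val (pderiv i (u.1 K i)) x ^ 2)) := by ring
    _ ≤ d * (C * vecNormSq u K) := by gcongr
    _ = _ := by ring

end PointBounds

/-- A cell has `d + 1` faces, so it is counted at most that often. -/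
theorem sum_boundaryFaces_le {a : T.cells → ℝ} (ha : ∀ K, 0 ≤ a K) :
    ∑ F ∈ T.boundaryFaces Ω, a F.1 ≤ (d + 1) * ∑ K, a K := by
  calc _ ≤ ∑ F : T.cells × Fin (d + 1), a F.1 :=
        Finset.sum_le_sum_of_subset_of_nonneg (Finset.subset_univ _) fun F _ _ => ha _
    _ = _ := by
      rw [Fintype.sum_prod_type, Finset.mul_sum]
      simp

theorem faceSize_nonneg (K : Affine.Simplex ℝ (E d) d) (i : Fin (d + 1)) : 0 ≤ faceSize K i :=
  Real.rpow_nonneg measureReal_nonneg _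

theorem faceSize_pow (hd : 2 ≤ d) (K : Affine.Simplex ℝ (E d) d) (i : Fin (d + 1)) :
    faceSize K i ^ (d - 1) = (μHE[d - 1] : Measure (E d)).real (face K i) := by
  have hd1 : ((d - 1 : ℕ) : ℝ) = (d : ℝ) - 1 := by
    rw [Nat.cast_sub (by omega)]; simp
  rw [faceSize, ← hd1]
  exact Real.rpow_inv_natCast_pow measureReal_nonneg (by omega)

/-- Since `|F| = h_F ^ (d - 1)`, this is `h_F⁻¹ |F| = h_F ^ (d - 2)`; stated as an inequality it
also covers `h_F = 0`. -/
theorem inv_faceSize_mul_le (hd : 2 ≤ d) (K : Affine.Simplex ℝ (E d) d) (i : Fin (d + 1)) :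
    (faceSize K i)⁻¹ * (μHE[d - 1] : Measure (E d)).real (face K i) ≤ faceSize K i ^ (d - 2) := by
  rw [← faceSize_pow hd]
  have h0 := faceSize_nonneg K i
  rcases h0.eq_or_lt with h | h
  · rw [← h]; simp
  · rw [show d - 1 = (d - 2) + 1 by omega, pow_succ]
    field_simp
    rfl

theorem integrableOn_face {f : E d → ℝ} (K : Affine.Simplex ℝ (E d) d) (i : Fin (d + 1))
    (hf : ContinuousOn f K.closedInterior) :
    IntegrableOn f (face K i) (μHE[d - 1] : Measure (E d)) := by
  obtain ⟨B, hB⟩ := (isCompact_closedInterior K).exists_bound_of_continuousOn hf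
  refine IntegrableOn.of_bound (measure_face_lt_top K i)
    ((hf.mono (face_subset K i)).aestronglyMeasurable (isCompact_face K i).measurableSet) B ?_
  filter_upwards [ae_restrict_mem (isCompact_face K i).measurableSet] with x hx
  exact hB x (face_subset K i hx)

theorem setIntegral_face_le {f : E d → ℝ} (K : Affine.Simplex ℝ (E d) d) (i : Fin (d + 1))
    (hf : ContinuousOn f K.closedInterior) {M : ℝ} (hM : ∀ x ∈ K.closedInterior, f x ≤ M) :
    ∫ x in face K i, f x ∂(μHE[d - 1] : Measure (E d)) ≤
      M * (μHE[d - 1] : Measure (E d)).real (face K i) := by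
  calc _ ≤ ∫ x in face K i, M ∂(μHE[d - 1] : Measure (E d)) :=
        setIntegral_mono_on (integrableOn_face K i hf) (integrableOn_face K i continuousOn_const)
          (isCompact_face K i).measurableSet fun x hx => hM x (face_subset K i hx)
    _ = _ := by simp [mul_comm]

theorem setIntegral_interior_le {f : E d → ℝ} (K : Affine.Simplex ℝ (E d) d)
    (hf : IntegrableOn f K.interior) {M : ℝ}
    (hM : ∀ᵐ x ∂(volume.restrict K.interior), f x ≤ M) (hM0 : 0 ≤ M) :
    ∫ x in K.interior, f x ≤ M * volume.real K.closedInterior := by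
  have hfin : volume K.closedInterior ≠ ∞ := (isCompact_closedInterior K).measure_lt_top.ne
  calc _ ≤ ∫ x in K.interior, M := integral_mono_ae hf
        (integrableOn_interior_of_continuous continuous_const K) hM
    _ = M * volume.real K.interior := by simp [mul_comm]
    _ ≤ _ := mul_le_mul_of_nonneg_left (measureReal_mono K.interior_subset_closedInterior hfin) hM0

theorem continuousOn_weight {β : E d → E d} (hT : T.Triangulates Ω)
    (hβ : ContinuousOn β (closure Ω)) (K : T.cells) (n : E d) :
    ContinuousOn (fun x => max (-inner ℝ (β x) n) 0) K.1.closedInterior :=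
  (((hβ.mono (hT.cell_subset_closure K.2)).inner (𝕜 := ℝ) continuousOn_const).neg).sup
    continuousOn_const

/-- The diagonal of the least squares form. -/
theorem lsForm_self (β : E d → E d) (c : E d → ℝ) (ε : ℝ) (u : T.Piecewise) :
    lsForm Ω β c ε T u u = (∫ x in Ω, ‖T.vec u x + √ε • T.grad u x‖ ^ 2) +
      (∫ x in Ω, (√ε * T.div u x + inner ℝ (β x) (T.grad u x) + c x * T.scal u x) ^ 2) +
      ∑ F ∈ T.boundaryFaces Ω, (faceSize F.1.1 F.2)⁻¹ * ∫ x in face F.1.1 F.2,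
        (ε + max (-inner ℝ (β x) (outwardNormal F.1.1 F.2)) 0) * Poly.val (u.2 F.1) x ^ 2
          ∂(μHE[d - 1] : Measure (E d)) := by
  simp only [lsForm, real_inner_self_eq_norm_sq, pow_two, mul_assoc]

theorem memLp_beta {β : E d → E d} {B : ℝ} (hT : T.Triangulates Ω)
    (hβ : ContinuousOn β (closure Ω)) (hβB : ∀ x ∈ closure Ω, ‖β x‖ ≤ B) :
    MemLp β ∞ (volume.restrict Ω) := by
  refine memLp_top_of_bound ((hβ.mono subset_closure).aestronglyMeasurable
    hT.isOpen.measurableSet) B ?_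
  filter_upwards [ae_restrict_mem hT.isOpen.measurableSet] with x hx
  exact hβB x (subset_closure hx)

theorem memLp_flux_residual (u : T.Piecewise) (s : ℝ) :
    MemLp (fun x => T.vec u x + s • T.grad u x) ∞ (volume.restrict Ω) :=
  (Mesh.memLp_vec u).add ((Mesh.memLp_grad u).const_smul s)

theorem memLp_residual {β : E d → E d} {c : E d → ℝ} (hβ : MemLp β ∞ (volume.restrict Ω))
    (hc : MemLp c ∞ (volume.restrict Ω)) (u : T.Piecewise) (s : ℝ) :
    MemLp (fun x => s * T.div u x + inner ℝ (β x) (T.grad u x) + c x * T.scal u x) ∞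
      (volume.restrict Ω) :=
  (((Mesh.memLp_div u).const_mul s).add (memLp_top_inner hβ (Mesh.memLp_grad u))).add
    (memLp_top_mul hc (Mesh.memLp_scal u))

/-- The inverse estimate for the least squares form. -/
theorem exists_lsForm_le (hd : 2 ≤ d) (m : ℕ) {C H B : ℝ} (hC : 1 ≤ C) (hB0 : 0 ≤ B)
    {β : E d → E d} {c : E d → ℝ} (hβ : ContinuousOn β (closure Ω))
    (hβB : ∀ x ∈ closure Ω, ‖β x‖ ≤ B) (hc : MemLp c ∞ (volume.restrict Ω))
    (hcB : ∀ᵐ x ∂(volume.restrict Ω), |c x| ≤ B) :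
    ∃ C', 0 < C' ∧ ∀ (T : Mesh d) (ε : ℝ) (u : T.Piecewise), T.Triangulates Ω →
      MeshBounds T m C → T.h ≤ H → 0 < ε → ε ≤ 1 → DegreeLE m u →
      T.h ^ 2 * lsForm Ω β c ε T u u ≤ C' * l2Form Ω T u u := by
  -- The first two summands come from the flux residual, the other three from the square of the
  -- three-term residual. Terms without derivatives have two powers of `h` to spare, which become `H
  -- ^ 2`.
  set K₁ : ℝ := 2 * H ^ 2 * C + 2 * d * C + 3 * d * C + 3 * B ^ 2 * d * C + 3 * B ^ 2 * H ^ 2 * C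
    with hK₁
  set K₂ : ℝ := (1 + B) * C * C ^ (d - 2) with hK₂
  have hC0 : 0 ≤ C := by linarith
  have hK₁0 : 0 ≤ K₁ := by positivity
  have hK₂0 : 0 ≤ K₂ := by positivity
  refine ⟨K₁ * C + (d + 1) * K₂ + 1, by positivity, fun T ε u hT hM hh hε hε1 hu => ?_⟩
  have hh0 := hM.h_pos
  set s := √ε with hs
  have hs0 : 0 ≤ s := Real.sqrt_nonneg _
  have hs1 : s ^ 2 ≤ 1 := by rw [hs, Real.sq_sqrt hε.le]; exact hε1
  have hβL := memLp_beta hT hβ hβB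
  set N : T.cells → ℝ := fun K => vecNormSq u K + scalNormSq u K with hN
  have hN0 : ∀ K, 0 ≤ N K := fun K => add_nonneg (vecNormSq_nonneg u K) (scalNormSq_nonneg u K)
  have hvN : ∀ K, vecNormSq u K ≤ N K := fun K => by
    have := scalNormSq_nonneg u K; simp only [hN]; linarith
  have hsN : ∀ K, scalNormSq u K ≤ N K := fun K => by
    have := vecNormSq_nonneg u K; simp only [hN]; linarith
  set f : E d → ℝ := fun x => ‖T.vec u x + s • T.grad u x‖ ^ 2 +
    (s * T.div u x + inner ℝ (β x) (T.grad u x) + c x * T.scal u x) ^ 2 with hf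
  have hf1 : IntegrableOn (fun x => ‖T.vec u x + s • T.grad u x‖ ^ 2) Ω := by
    refine integrableOn_of_memLp_top hT ?_
    simpa only [real_inner_self_eq_norm_sq] using
      memLp_top_inner (memLp_flux_residual (Ω := Ω) u s) (memLp_flux_residual u s)
  have hf2 : IntegrableOn (fun x =>
      (s * T.div u x + inner ℝ (β x) (T.grad u x) + c x * T.scal u x) ^ 2) Ω := by
    refine integrableOn_of_memLp_top hT ?_
    simpa only [pow_two] using
      memLp_top_mul (memLp_residual hβL hc u s) (memLp_residual hβL hc u s)
  have hfI : IntegrableOn f Ω := hf1.add hf2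
  have hvol : T.h ^ 2 * ∫ x in Ω, f x ≤ K₁ * C * ∑ K, N K := by
    rw [hT.setIntegral_eq_sum hfI, Finset.mul_sum, Finset.mul_sum]
    refine Finset.sum_le_sum fun K _ => ?_
    have hpt : ∀ᵐ x ∂(volume.restrict K.1.interior), f x ≤ K₁ * N K / (T.h ^ d * T.h ^ 2) := by
      have hsub := hT.interior_cell_subset K.2
      filter_upwards [ae_restrict_of_ae_restrict_of_subset hsub hcB,
        ae_restrict_mem (isOpen_interior K.1).measurableSet] with x hcx hx
      have hxc := K.1.interior_subset_closedInterior hx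
      have b1 := hM.vec_le hu K hxc
      have b2 := hM.scal_le hu K hxc
      have b3 := hM.grad_le hu K hxc
      have b4 := hM.div_le hu K hxc
      have hβx := hβB x (subset_closure (hsub hx))
      rw [le_div_iff₀ (by positivity)]
      simp only [hf, Mesh.vec, Mesh.grad, Mesh.div, Mesh.scal, Mesh.glue_of_mem _ hx]
      set q := vecVal (u.1 K) x
      set D := gradVal (u.2 K) x
      set δ := divVal (u.1 K) x
      set w := Poly.val (u.2 K) x
      have e1 : ‖q + s • D‖ ^ 2 ≤ 2 * ‖q‖ ^ 2 + 2 * ‖D‖ ^ 2 := by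
        have h1 : ‖q + s • D‖ ≤ ‖q‖ + s * ‖D‖ := by
          refine (norm_add_le _ _).trans_eq ?_
          rw [norm_smul, Real.norm_of_nonneg hs0]
        have h2 : s ^ 2 * ‖D‖ ^ 2 ≤ ‖D‖ ^ 2 :=
          mul_le_of_le_one_left (sq_nonneg _) hs1
        have h3 : ‖q + s • D‖ ^ 2 ≤ (‖q‖ + s * ‖D‖) ^ 2 := pow_le_pow_left₀ (norm_nonneg _) h1 2
        nlinarith [sq_nonneg (‖q‖ - s * ‖D‖)]
      have e2 : (s * δ + inner ℝ (β x) D + c x * w) ^ 2 ≤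
          3 * δ ^ 2 + 3 * B ^ 2 * ‖D‖ ^ 2 + 3 * B ^ 2 * w ^ 2 := by
        have h1 : (s * δ) ^ 2 ≤ δ ^ 2 := by
          rw [mul_pow]; exact mul_le_of_le_one_left (sq_nonneg _) hs1
        have h2 : (inner ℝ (β x) D) ^ 2 ≤ B ^ 2 * ‖D‖ ^ 2 := by
          rw [← mul_pow, ← sq_abs]
          refine pow_le_pow_left₀ (abs_nonneg _) ((abs_real_inner_le_norm _ _).trans ?_) 2
          exact mul_le_mul_of_nonneg_right hβx (norm_nonneg _)
        have h3 : (c x * w) ^ 2 ≤ B ^ 2 * w ^ 2 := by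
          rw [mul_pow, ← sq_abs (c x)]
          exact mul_le_mul_of_nonneg_right (pow_le_pow_left₀ (abs_nonneg _) hcx 2) (sq_nonneg _)
        set A₁ := s * δ
        set A₂ := inner ℝ (β x) D
        set A₃ := c x * w
        nlinarith [sq_nonneg (A₁ - A₂), sq_nonneg (A₂ - A₃), sq_nonneg (A₁ - A₃)]
      have hhH : T.h ^ 2 ≤ H ^ 2 := pow_le_pow_left₀ hh0.le hh 2
      have g1 : T.h ^ d * T.h ^ 2 * ‖q‖ ^ 2 ≤ H ^ 2 * C * N K := by
        calc _ = T.h ^ 2 * (T.h ^ d * ‖q‖ ^ 2) := by ring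
          _ ≤ H ^ 2 * (C * N K) := mul_le_mul hhH
            (b1.trans (mul_le_mul_of_nonneg_left (hvN K) hC0)) (by positivity) (by positivity)
          _ = _ := by ring
      have g2 : T.h ^ d * T.h ^ 2 * w ^ 2 ≤ H ^ 2 * C * N K := by
        calc _ = T.h ^ 2 * (T.h ^ d * w ^ 2) := by ring
          _ ≤ H ^ 2 * (C * N K) := mul_le_mul hhH
            (b2.trans (mul_le_mul_of_nonneg_left (hsN K) hC0)) (by positivity) (by positivity)
          _ = _ := by ring
      have g3 : T.h ^ d * T.h ^ 2 * ‖D‖ ^ 2 ≤ d * C * N K := by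
        rw [mul_assoc]
        exact b3.trans (mul_le_mul_of_nonneg_left (hsN K) (by positivity))
      have g4 : T.h ^ d * T.h ^ 2 * δ ^ 2 ≤ d * C * N K := by
        rw [mul_assoc]
        exact b4.trans (mul_le_mul_of_nonneg_left (hvN K) (by positivity))
      calc _ ≤ (2 * ‖q‖ ^ 2 + 2 * ‖D‖ ^ 2 +
            (3 * δ ^ 2 + 3 * B ^ 2 * ‖D‖ ^ 2 + 3 * B ^ 2 * w ^ 2)) * (T.h ^ d * T.h ^ 2) :=
            mul_le_mul_of_nonneg_right (add_le_add e1 e2) (by positivity)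
        _ = 2 * (T.h ^ d * T.h ^ 2 * ‖q‖ ^ 2) + 2 * (T.h ^ d * T.h ^ 2 * ‖D‖ ^ 2) +
            3 * (T.h ^ d * T.h ^ 2 * δ ^ 2) + 3 * B ^ 2 * (T.h ^ d * T.h ^ 2 * ‖D‖ ^ 2) +
            3 * B ^ 2 * (T.h ^ d * T.h ^ 2 * w ^ 2) := by ring
        _ ≤ 2 * (H ^ 2 * C * N K) + 2 * (d * C * N K) +
            3 * (d * C * N K) + 3 * B ^ 2 * (d * C * N K) +
            3 * B ^ 2 * (H ^ 2 * C * N K) := by gcongr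
        _ = K₁ * N K := by rw [hK₁]; ring
    have hle := setIntegral_interior_le K.1 (hfI.mono_set (hT.interior_cell_subset K.2)) hpt
      (by have := hN0 K; positivity)
    have hv := hM.volume_le K.1 K.2
    calc _ ≤ T.h ^ 2 * (K₁ * N K / (T.h ^ d * T.h ^ 2) * (C * T.h ^ d)) := by
          refine mul_le_mul_of_nonneg_left (hle.trans (mul_le_mul_of_nonneg_left hv ?_))
            (by positivity)
          have := hN0 K; positivity
      _ = _ := by field_simp
  have hface : ∀ F : T.cells × Fin (d + 1), T.h ^ 2 * ((faceSize F.1.1 F.2)⁻¹ *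
      ∫ x in face F.1.1 F.2, (ε + max (-inner ℝ (β x) (outwardNormal F.1.1 F.2)) 0) *
        Poly.val (u.2 F.1) x ^ 2 ∂(μHE[d - 1] : Measure (E d))) ≤ K₂ * N F.1 := by
    intro F
    have hcont : ContinuousOn (fun x => (ε + max (-inner ℝ (β x) (outwardNormal F.1.1 F.2)) 0) *
        Poly.val (u.2 F.1) x ^ 2) F.1.1.closedInterior :=
      (continuousOn_const.add (continuousOn_weight hT hβ F.1 _)).mul
        ((Poly.continuous_val _).pow 2).continuousOn
    have hle := setIntegral_face_le F.1.1 F.2 hcont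
      (M := (1 + B) * (C * N F.1 / T.h ^ d)) (fun x hx => by
        have b2 : Poly.val (u.2 F.1) x ^ 2 ≤ C * N F.1 / T.h ^ d := by
          rw [le_div_iff₀ (by positivity), mul_comm]
          exact (hM.scal_le hu F.1 hx).trans (mul_le_mul_of_nonneg_left (hsN _) hC0)
        refine mul_le_mul ?_ b2 (sq_nonneg _) (by positivity)
        refine add_le_add hε1 (max_le ?_ hB0)
        have h1 := abs_real_inner_le_norm (β x) (outwardNormal F.1.1 F.2)
        rw [norm_outwardNormal, mul_one] at h1
        exact ((neg_le_abs _).trans h1).trans (hβB x (hT.cell_subset_closure F.1.2 hx)))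
    have hNF := hN0 F.1
    have hi0 : 0 ≤ (faceSize F.1.1 F.2)⁻¹ := inv_nonneg.2 (faceSize_nonneg _ _)
    -- The powers of `h` in a face term are `h ^ 2 * h ^ (d - 2) / h ^ d = 1`.
    have hfs : (faceSize F.1.1 F.2)⁻¹ * (μHE[d - 1] : Measure (E d)).real (face F.1.1 F.2) ≤
        C ^ (d - 2) * T.h ^ (d - 2) := by
      rw [← mul_pow]
      exact (inv_faceSize_mul_le hd _ _).trans
        (pow_le_pow_left₀ (faceSize_nonneg _ _) (hM.faceSize_le _ F.1.2 _) _)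
    calc _ ≤ T.h ^ 2 * ((faceSize F.1.1 F.2)⁻¹ * ((1 + B) * (C * N F.1 / T.h ^ d) *
          (μHE[d - 1] : Measure (E d)).real (face F.1.1 F.2))) := by gcongr
      _ = T.h ^ 2 * ((1 + B) * (C * N F.1 / T.h ^ d)) * ((faceSize F.1.1 F.2)⁻¹ *
          (μHE[d - 1] : Measure (E d)).real (face F.1.1 F.2)) := by ring
      _ ≤ T.h ^ 2 * ((1 + B) * (C * N F.1 / T.h ^ d)) * (C ^ (d - 2) * T.h ^ (d - 2)) := by gcongr
      _ = (1 + B) * C * C ^ (d - 2) * N F.1 * (T.h ^ (d - 2) * T.h ^ 2 / T.h ^ d) := by ring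
      _ = K₂ * N F.1 := by
        rw [← pow_add, show d - 2 + 2 = d by omega, div_self (by positivity), mul_one, hK₂]
  have hS0 : 0 ≤ ∑ K, N K := Finset.sum_nonneg fun K _ => hN0 K
  rw [lsForm_self, ← integral_add hf1 hf2, mul_add, Finset.mul_sum, l2Form_self_eq_sum hT]
  calc _ ≤ K₁ * C * (∑ K, N K) + ∑ F ∈ T.boundaryFaces Ω, K₂ * N F.1 :=
        add_le_add hvol (Finset.sum_le_sum fun F _ => hface F)
    _ ≤ K₁ * C * (∑ K, N K) + K₂ * ((d + 1) * ∑ K, N K) := by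
        rw [← Finset.mul_sum]
        gcongr
        exact sum_boundaryFaces_le hN0
    _ ≤ (K₁ * C + (d + 1) * K₂ + 1) * ∑ K, N K := by nlinarith

end Upper

/-! ### Coercivity of the least squares form -/

section Coercivity

open Filter

/-- Here `s`, `D`, `e` stand for √ε, ∇u, ∇ψ, and ∇χ = -e. The two subtracted brackets are the
divergences of `χ u q` and `χ u² β`, so that after integration they become boundary terms. Expanding
the residual times `χ u` leaves the identity `main`, in which `q` is replaced by `f - g` with `g = s
• D`. Its good terms are `χ ‖g‖²`, half of `⟨β, e⟩ u²`, and the nonnegative term with `c - ½ dβ`. -/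
theorem pointwise_coercivity {F : Type*} [NormedAddCommGroup F] [InnerProductSpace ℝ F]
    {q D e β : F} {u δ dβ c χ s b₀ Γ X : ℝ} (hs : 0 ≤ s) (hs1 : s ≤ 1) (hb₀ : 0 < b₀)
    (he : ‖e‖ ^ 2 ≤ Γ) (hχ : 1 + 4 * Γ / b₀ ≤ χ) (hχX : χ ≤ X) (hc : 0 ≤ c - 1 / 2 * dβ)
    (hβ : b₀ ≤ inner ℝ β e) :
    1 / 2 * ‖s • D‖ ^ 2 + b₀ / 8 * u ^ 2 ≤
      (X / 2 + 2 * Γ / b₀) * ‖q + s • D‖ ^ 2 +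
        2 * X ^ 2 / b₀ * (s * δ + inner ℝ β D + c * u) ^ 2 -
        s * (χ * (u * δ + inner ℝ q D) - u * inner ℝ q e) -
        1 / 2 * (χ * (u * (u * dβ + inner ℝ β D) + u * inner ℝ β D) -
          u * (u * inner ℝ β e)) := by
  have hΓ : 0 ≤ Γ := (sq_nonneg _).trans he
  have hΓb : 0 ≤ 4 * Γ / b₀ := by positivity
  have hχ0 : 0 ≤ χ := by linarith
  -- Three products are estimated with `b₀ / 8 * u²` each, which leaves `b₀ / 8` of `b₀ / 2`. The
  -- term `2 * Γ / b₀ * ‖g‖²` is absorbed by half of the summand `4 * Γ / b₀` in the lower bound of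
  -- `χ`; the other half of `χ` pays for `inner f g`.
  have young : ∀ v : F, |u| * |inner ℝ v e| ≤ b₀ / 8 * u ^ 2 + 2 * Γ / b₀ * ‖v‖ ^ 2 := by
    intro v
    have h1 : |inner ℝ v e| ≤ ‖v‖ * ‖e‖ := abs_real_inner_le_norm v e
    have h2 : |u| * |inner ℝ v e| ≤ |u| * (‖v‖ * ‖e‖) :=
      mul_le_mul_of_nonneg_left h1 (abs_nonneg _)
    have h3 : ‖v‖ ^ 2 * ‖e‖ ^ 2 ≤ ‖v‖ ^ 2 * Γ := mul_le_mul_of_nonneg_left he (sq_nonneg _)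
    have h4 : |u| * (‖v‖ * ‖e‖) ≤ b₀ / 8 * |u| ^ 2 + 2 / b₀ * (‖v‖ ^ 2 * ‖e‖ ^ 2) := by
      have : 0 ≤ 2 / b₀ * (b₀ / 4 * |u| - ‖v‖ * ‖e‖) ^ 2 := by positivity
      have e1 : 2 / b₀ * (b₀ / 4 * |u| - ‖v‖ * ‖e‖) ^ 2 =
        b₀ / 8 * |u| ^ 2 + 2 / b₀ * (‖v‖ ^ 2 * ‖e‖ ^ 2) - |u| * (‖v‖ * ‖e‖) := by
        field_simp; ring
      linarith
    have h5 : 2 / b₀ * (‖v‖ ^ 2 * ‖e‖ ^ 2) ≤ 2 / b₀ * (‖v‖ ^ 2 * Γ) :=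
      mul_le_mul_of_nonneg_left h3 (by positivity)
    rw [sq_abs] at h4
    calc _ ≤ b₀ / 8 * u ^ 2 + 2 / b₀ * (‖v‖ ^ 2 * Γ) := by linarith
      _ = _ := by ring
  set g := s • D with hg
  set f := q + g with hf
  have hq : q = f - g := by rw [hf]; abel
  have i1 : s * inner ℝ q D = inner ℝ f g - ‖g‖ ^ 2 := by
    rw [← real_inner_self_eq_norm_sq, ← inner_sub_left, ← hq, hg, real_inner_smul_right]
  have i2 : inner ℝ q e = inner ℝ f e - inner ℝ g e := by rw [hq, inner_sub_left]
  have i3 : inner ℝ f g ≤ 1 / 2 * ‖f‖ ^ 2 + 1 / 2 * ‖g‖ ^ 2 := by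
    have := norm_sub_sq_real f g
    nlinarith [sq_nonneg ‖f - g‖]
  have y1 := young f
  have y2 := young g
  have y3 : (s * δ + inner ℝ β D + c * u) * χ * u ≤
      b₀ / 8 * u ^ 2 + 2 * X ^ 2 / b₀ * (s * δ + inner ℝ β D + c * u) ^ 2 := by
    set r := s * δ + inner ℝ β D + c * u
    have h1 : 0 ≤ 2 / b₀ * (b₀ / 4 * u - r * χ) ^ 2 := by positivity
    have e1 : 2 / b₀ * (b₀ / 4 * u - r * χ) ^ 2 =
        b₀ / 8 * u ^ 2 + 2 / b₀ * (r ^ 2 * χ ^ 2) - r * χ * u := by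
      field_simp; ring
    have h2 : r ^ 2 * χ ^ 2 ≤ r ^ 2 * X ^ 2 :=
      mul_le_mul_of_nonneg_left (pow_le_pow_left₀ hχ0 hχX 2) (sq_nonneg _)
    have h3 : 2 / b₀ * (r ^ 2 * χ ^ 2) ≤ 2 / b₀ * (r ^ 2 * X ^ 2) :=
      mul_le_mul_of_nonneg_left h2 (by positivity)
    calc _ ≤ b₀ / 8 * u ^ 2 + 2 / b₀ * (r ^ 2 * X ^ 2) := by linarith
      _ = _ := by ring
  have z1 : -(s * u * inner ℝ f e) ≤ |u| * |inner ℝ f e| := by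
    rw [← abs_mul]
    calc _ ≤ |s * (u * inner ℝ f e)| := by rw [← mul_assoc]; exact neg_le_abs _
      _ = s * |u * inner ℝ f e| := by rw [abs_mul, abs_of_nonneg hs]
      _ ≤ _ := mul_le_of_le_one_left (abs_nonneg _) hs1
  have z2 : s * u * inner ℝ g e ≤ |u| * |inner ℝ g e| := by
    rw [← abs_mul]
    calc _ ≤ |s * (u * inner ℝ g e)| := by rw [← mul_assoc]; exact le_abs_self _
      _ = s * |u * inner ℝ g e| := by rw [abs_mul, abs_of_nonneg hs]
      _ ≤ _ := mul_le_of_le_one_left (abs_nonneg _) hs1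
  have w1 : 0 ≤ χ * u ^ 2 * (c - 1 / 2 * dβ) := by positivity
  have w2 : b₀ * u ^ 2 ≤ inner ℝ β e * u ^ 2 := mul_le_mul_of_nonneg_right hβ (sq_nonneg _)
  have w3 : χ * inner ℝ f g ≤ χ * (1 / 2 * ‖f‖ ^ 2 + 1 / 2 * ‖g‖ ^ 2) :=
    mul_le_mul_of_nonneg_left i3 hχ0
  have w4 : (1 + 4 * Γ / b₀) * ‖g‖ ^ 2 ≤ χ * ‖g‖ ^ 2 := mul_le_mul_of_nonneg_right hχ (sq_nonneg _)
  have w5 : χ * ‖f‖ ^ 2 ≤ X * ‖f‖ ^ 2 := mul_le_mul_of_nonneg_right hχX (sq_nonneg _)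
  have main : (s * δ + inner ℝ β D + c * u) * χ * u -
        s * (χ * (u * δ + inner ℝ q D) - u * inner ℝ q e) -
        1 / 2 * (χ * (u * (u * dβ + inner ℝ β D) + u * inner ℝ β D) - u * (u * inner ℝ β e)) =
      χ * u ^ 2 * (c - 1 / 2 * dβ) - χ * (s * inner ℝ q D) + s * u * inner ℝ q e +
        1 / 2 * (inner ℝ β e * u ^ 2) := by ring
  rw [i1, i2] at main
  have hΓg : (1 + 4 * Γ / b₀) * ‖g‖ ^ 2 = ‖g‖ ^ 2 + 2 * (2 * Γ / b₀ * ‖g‖ ^ 2) := by ring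
  rw [i2]
  linarith

theorem integral_combination_le {α : Type*} [MeasurableSpace α] {μ : Measure α}
    {f₁ f₂ f₃ f₄ f₅ f₆ : α → ℝ} (h₁ : Integrable f₁ μ) (h₂ : Integrable f₂ μ)
    (h₃ : Integrable f₃ μ) (h₄ : Integrable f₄ μ) (h₅ : Integrable f₅ μ) (h₆ : Integrable f₆ μ)
    {a₁ a₂ a₃ a₄ a₅ a₆ : ℝ} (h : ∀ᵐ x ∂μ, a₁ * f₁ x + a₂ * f₂ x ≤
      a₃ * f₃ x + a₄ * f₄ x - a₅ * f₅ x - a₆ * f₆ x) :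
    a₁ * (∫ x, f₁ x ∂μ) + a₂ * (∫ x, f₂ x ∂μ) ≤ a₃ * (∫ x, f₃ x ∂μ) + a₄ * (∫ x, f₄ x ∂μ) -
      a₅ * (∫ x, f₅ x ∂μ) - a₆ * (∫ x, f₆ x ∂μ) := by
  have j : ∀ {f : α → ℝ}, Integrable f μ → ∀ a : ℝ, Integrable (fun x => a * f x) μ :=
    fun hf a => hf.const_mul a
  have j12 : Integrable (fun x => a₁ * f₁ x + a₂ * f₂ x) μ := (j h₁ a₁).add (j h₂ a₂)
  have j34 : Integrable (fun x => a₃ * f₃ x + a₄ * f₄ x) μ := (j h₃ a₃).add (j h₄ a₄)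
  have j35 : Integrable (fun x => a₃ * f₃ x + a₄ * f₄ x - a₅ * f₅ x) μ := j34.sub (j h₅ a₅)
  have j36 : Integrable (fun x => a₃ * f₃ x + a₄ * f₄ x - a₅ * f₅ x - a₆ * f₆ x) μ :=
    j35.sub (j h₆ a₆)
  have := integral_mono_ae j12 j36 h
  rw [integral_add (j h₁ a₁) (j h₂ a₂), integral_sub j35 (j h₆ a₆), integral_sub j34 (j h₅ a₅),
    integral_add (j h₃ a₃) (j h₄ a₄)] at this
  simpa only [integral_const_mul] using this

variable {d : ℕ} {T : Mesh d} {Ω : Set (E d)}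

theorem sum_mul_eq_inner (v w : E d) : ∑ i, v i * w i = inner ℝ v w := by
  simp [PiLp.inner_apply, mul_comm]

variable [NeZero d]

/-- A bounded field with a bounded weak divergence. -/
structure HasBddDiv (Ω : Set (E d)) (V : E d → E d) (G : E d → ℝ) : Prop where
  field : MemLp V ∞ (volume.restrict Ω)
  div : MemLp G ∞ (volume.restrict Ω)
  hasWeakDiv : HasWeakDiv Ω V G

/-- Bounded fields with bounded divergence are stable under multiplication by `W^{1,∞}` functions.
Iteration reaches `χ u q` and `χ u² β`. -/
theorem HasBddDiv.mul {V : E d → E d} {G v : E d → ℝ} {Dv : E d → E d} (hV : HasBddDiv Ω V G)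
    (hΩ : IsOpen Ω) (hv : MemW1Infty Ω v (fun i x => Dv x i)) :
    HasBddDiv Ω (fun x => v x • V x) (fun x => v x * G x + inner ℝ (V x) (Dv x)) := by
  have h := hV.hasWeakDiv.mul hΩ hV.field hV.div hv
  simp only [sum_mul_eq_inner] at h
  refine ⟨hV.field.smul hv.1, (memLp_top_mul hv.1 hV.div).add ?_, h⟩
  simp only [← sum_mul_eq_inner]
  exact memLp_finsetSum _ fun i _ => memLp_top_mul (memLp_coord hV.field i) (hv.2 i).1

theorem MemW1Infty.const_sub {ψ : E d → ℝ} {Dψ : Fin d → E d → ℝ} (h : MemW1Infty Ω ψ Dψ) (M : ℝ) :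
    MemW1Infty Ω (fun x => M - ψ x) (fun i x => -Dψ i x) := by
  have hc : MemW1Infty Ω (fun _ : E d => M) _ :=
    memW1Infty_of_lipschitz (LipschitzWith.const M) (M := ‖M‖) fun _ => le_rfl
  refine ⟨hc.1.sub h.1, fun i => ⟨(h.2 i).1.neg, ?_⟩⟩
  have h1 := (hc.2 i).2.add ((h.2 i).2.smul (-1))
  have e1 : ((fun _ : E d => M) + (-1 : ℝ) • ψ) = fun x => M - ψ x := by
    funext x; simp [sub_eq_add_neg]
  have e2 : ((fun x : E d => lineDeriv ℝ (fun _ : E d => M) x (EuclideanSpace.single i 1)) +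
      (-1 : ℝ) • Dψ i) = fun x => -Dψ i x := by
    funext x; simp [lineDeriv]
  rwa [e1, e2] at h1

/-- Testing the residuals with `χ u` for a weight `χ` that decreases along `β`. -/
theorem exists_volume_estimate {β : E d → E d} {c : E d → ℝ} (hβc : IsAdmissible Ω β c) {B : ℝ}
    (hβB : ∀ x ∈ closure Ω, ‖β x‖ ≤ B) :
    ∃ b₀ X K₁ K₂, 0 < b₀ ∧ 0 ≤ X ∧ 0 ≤ K₁ ∧ 0 ≤ K₂ ∧ ∀ (T : Mesh d) (ε : ℝ) (u : T.Piecewise),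
      T.Triangulates Ω → 0 < ε → ε ≤ 1 → MemHdiv Ω (T.vec u) → MemH1 Ω (T.scal u) →
      1 / 2 * (∫ x in Ω, ‖√ε • T.grad u x‖ ^ 2) + b₀ / 8 * (∫ x in Ω, T.scal u x ^ 2) ≤
        K₁ * (∫ x in Ω, ‖T.vec u x + √ε • T.grad u x‖ ^ 2) +
        K₂ * (∫ x in Ω, (√ε * T.div u x + inner ℝ (β x) (T.grad u x) + c x * T.scal u x) ^ 2) +
        √ε * (∑ F ∈ T.boundaryFaces Ω, ∫ x in face F.1.1 F.2,
          X * (|Poly.val (u.2 F.1) x| * ‖vecVal (u.1 F.1) x‖) ∂(μHE[d - 1] : Measure (E d))) +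
        1 / 2 * (∑ F ∈ T.boundaryFaces Ω, ∫ x in face F.1.1 F.2,
          X * (max (-inner ℝ (β x) (outwardNormal F.1.1 F.2)) 0 * Poly.val (u.2 F.1) x ^ 2)
            ∂(μHE[d - 1] : Measure (E d))) := by
  obtain ⟨ψ, Dψ, b₀, hψ, hb₀, hβψ⟩ := hβc.exists_psi
  obtain ⟨Dβ, hDβ, hcβ⟩ := hβc.exists_jacobian
  set e : E d → E d := fun x => WithLp.toLp 2 fun i => Dψ i x with he
  obtain ⟨P, hP0, hP⟩ := exists_bound_of_memLp_top hψ.1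
  choose Q hQ0 hQ using fun i => exists_bound_of_memLp_top (hψ.2 i).1
  set Γ : ℝ := ∑ i, Q i ^ 2 with hΓ
  have hΓ0 : 0 ≤ Γ := Finset.sum_nonneg fun i _ => sq_nonneg _
  -- The lower bound of the weight required by `pointwise_coercivity`. Adding `P ≥ |ψ|` to the
  -- constant in `χ` below guarantees it, with the upper bound `X`.
  set N : ℝ := 1 + 4 * Γ / b₀ with hN
  have hN0 : 0 ≤ N := by positivity
  set X : ℝ := N + 2 * P with hX
  have hX0 : 0 ≤ X := by positivity
  refine ⟨b₀, X, X / 2 + 2 * Γ / b₀, 2 * X ^ 2 / b₀, hb₀, hX0, by positivity, by positivity,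
    fun T ε u hT hε hε1 huq huw => ?_⟩
  set s := √ε with hs
  have hs0 : 0 ≤ s := Real.sqrt_nonneg _
  have hs1 : s ≤ 1 := Real.sqrt_le_one.2 hε1
  have hΩ := hT.isOpen
  have hβL := memLp_beta hT hβc.continuousOn hβB
  set χ : E d → ℝ := fun x => (N + P) - ψ x with hχ
  have hχW : MemW1Infty Ω χ (fun i x => (-e x) i) := hψ.const_sub (N + P)
  have hχ1 : ∀ᵐ x ∂(volume.restrict Ω), N ≤ χ x ∧ χ x ≤ X := by
    filter_upwards [hP] with x hx
    rw [Real.norm_eq_abs, abs_le] at hx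
    constructor <;> simp only [hχ, hX] <;> linarith [hx.1, hx.2]
  have hwW := hT.memW1Infty_scal huw
  have hqD : HasBddDiv Ω (T.vec u) (T.div u) :=
    ⟨Mesh.memLp_vec u, Mesh.memLp_div u, hT.hasWeakDiv_vec huq⟩
  have hβD : HasBddDiv Ω β (fun x => ∑ i, Dβ i i x) :=
    ⟨hβL, memLp_finsetSum _ fun i _ => ((hDβ i).2 i).1, hasWeakDiv_of_partial
      (MemLp.locallyIntegrableOn_of_top le_top hβL) fun i => ((hDβ i).2 i).2⟩
  have hV1 := (hqD.mul hΩ hwW).mul hΩ hχW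
  have hV2 := ((hβD.mul hΩ hwW).mul hΩ hwW).mul hΩ hχW
  set V1 : E d → E d := fun x => χ x • (T.scal u x • T.vec u x) with hV1d
  set V2 : E d → E d := fun x => χ x • (T.scal u x • (T.scal u x • β x)) with hV2d
  set G1 : E d → ℝ := fun x => χ x * (T.scal u x * T.div u x + inner ℝ (T.vec u x) (T.grad u x)) +
    inner ℝ (T.scal u x • T.vec u x) (-e x) with hG1
  set G2 : E d → ℝ := fun x => χ x * (T.scal u x * (T.scal u x * (∑ i, Dβ i i x) +
    inner ℝ (β x) (T.grad u x)) + inner ℝ (T.scal u x • β x) (T.grad u x)) +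
    inner ℝ (T.scal u x • (T.scal u x • β x)) (-e x) with hG2
  have hcell : ∀ (K : T.cells) {p : E d → Prop}, (∀ᵐ x ∂(volume.restrict Ω), p x) →
      ∀ᵐ x, x ∈ K.1.interior → p x := fun K p hp =>
    (ae_restrict_iff' (isOpen_interior K.1).measurableSet).1
      (ae_restrict_of_ae_restrict_of_subset (hT.interior_cell_subset K.2) hp)
  -- The normal component of `q` is estimated by its norm; the product is treated later with the
  -- inverse estimate.
  have hbd1 : -∫ x in Ω, G1 x ≤ ∑ F ∈ T.boundaryFaces Ω, ∫ x in face F.1.1 F.2,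
      X * (|Poly.val (u.2 F.1) x| * ‖vecVal (u.1 F.1) x‖) ∂(μHE[d - 1] : Measure (E d)) := by
    refine neg_integral_div_le (g := fun K _ x =>
      X * (|Poly.val (u.2 K) x| * ‖vecVal (u.1 K) x‖)) hT hV1.field hV1.div hV1.hasWeakDiv
      (fun F _ => ?_) (fun F _ x _ => by positivity) fun F _ => ?_
    · exact (continuous_const.mul ((Poly.continuous_val _).abs.mul
        (continuous_vecVal _).norm)).continuousOn
    · filter_upwards [hcell F.1 hχ1] with x hx hxK
      obtain ⟨hx1, hx2⟩ := hx hxK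
      simp only [hV1d, Mesh.scal, Mesh.vec, Mesh.glue_of_mem _ hxK]
      refine (neg_le_abs _).trans ((abs_real_inner_le_norm _ _).trans ?_)
      rw [norm_outwardNormal, mul_one, norm_smul, norm_smul, Real.norm_eq_abs, Real.norm_eq_abs,
        abs_of_nonneg (hN0.trans hx1)]
      exact mul_le_mul_of_nonneg_right hx2 (by positivity)
  -- Only the inflow part of `β · n` enters: outflow contributes with the favourable sign and is
  -- dropped by the one-sided inequality.
  have hbd2 : -∫ x in Ω, G2 x ≤ ∑ F ∈ T.boundaryFaces Ω, ∫ x in face F.1.1 F.2,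
      X * (max (-inner ℝ (β x) (outwardNormal F.1.1 F.2)) 0 * Poly.val (u.2 F.1) x ^ 2)
        ∂(μHE[d - 1] : Measure (E d)) := by
    refine neg_integral_div_le (g := fun K i x =>
      X * (max (-inner ℝ (β x) (outwardNormal K.1 i)) 0 * Poly.val (u.2 K) x ^ 2)) hT hV2.field
      hV2.div hV2.hasWeakDiv
      (fun F _ => ?_) (fun F _ x _ => by positivity) fun F _ => ?_
    · exact continuousOn_const.mul ((continuousOn_weight hT hβc.continuousOn F.1 _).mul
        ((Poly.continuous_val _).pow 2).continuousOn)
    · filter_upwards [hcell F.1 hχ1] with x hx hxK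
      obtain ⟨hx1, hx2⟩ := hx hxK
      simp only [hV2d, Mesh.scal, Mesh.glue_of_mem _ hxK, real_inner_smul_left]
      set w := Poly.val (u.2 F.1) x
      set r := inner ℝ (β x) (outwardNormal F.1.1 F.2)
      calc -(χ x * (w * (w * r))) = χ x * w ^ 2 * (-r) := by ring
        _ ≤ χ x * w ^ 2 * max (-r) 0 := mul_le_mul_of_nonneg_left (le_max_left _ _)
            (mul_nonneg (hN0.trans hx1) (sq_nonneg _))
        _ ≤ X * w ^ 2 * max (-r) 0 := by gcongr
        _ = _ := by ring
  have hpt : ∀ᵐ x ∂(volume.restrict Ω),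
      1 / 2 * ‖s • T.grad u x‖ ^ 2 + b₀ / 8 * T.scal u x ^ 2 ≤
      (X / 2 + 2 * Γ / b₀) * ‖T.vec u x + s • T.grad u x‖ ^ 2 + 2 * X ^ 2 / b₀ *
        (s * T.div u x + inner ℝ (β x) (T.grad u x) + c x * T.scal u x) ^ 2 -
        s * G1 x - 1 / 2 * G2 x := by
    filter_upwards [hχ1, hcβ, hβψ, ae_all_iff.2 hQ] with x h1 h2 h3 h4
    have he2 : ‖e x‖ ^ 2 ≤ Γ := by
      rw [EuclideanSpace.real_norm_sq_eq, hΓ]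
      refine Finset.sum_le_sum fun i _ => ?_
      rw [← sq_abs]
      exact pow_le_pow_left₀ (abs_nonneg _) (h4 i) 2
    have h3' : b₀ ≤ inner ℝ (β x) (e x) := by rw [← sum_mul_eq_inner]; exact h3
    have := pointwise_coercivity (q := T.vec u x) (D := T.grad u x) (u := T.scal u x)
      (δ := T.div u x) hs0 hs1 hb₀ he2 h1.1 h1.2 h2 h3'
    refine this.trans_eq ?_
    simp only [hG1, hG2, real_inner_smul_left, inner_neg_right]
    ring
  have hI : ∀ {V : E d → E d}, MemLp V ∞ (volume.restrict Ω) →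
      IntegrableOn (fun x => ‖V x‖ ^ 2) Ω := fun {V} hV => by
    refine integrableOn_of_memLp_top hT ?_
    simpa only [real_inner_self_eq_norm_sq] using memLp_top_inner hV hV
  have hI' : ∀ {f : E d → ℝ}, MemLp f ∞ (volume.restrict Ω) →
      IntegrableOn (fun x => f x ^ 2) Ω := fun {f} hf => by
    refine integrableOn_of_memLp_top hT ?_
    simpa only [pow_two] using memLp_top_mul hf hf
  have hinteg := integral_combination_le (hI ((Mesh.memLp_grad (Ω := Ω) u).const_smul s))
    (hI' (Mesh.memLp_scal (Ω := Ω) u)) (hI (memLp_flux_residual (Ω := Ω) u s))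
    (hI' (memLp_residual hβL hβc.c_mem u s)) (integrableOn_of_memLp_top hT hV1.div)
    (integrableOn_of_memLp_top hT hV2.div) hpt
  simp only [Pi.smul_apply] at hinteg
  have hb1 := mul_le_mul_of_nonneg_left hbd1 hs0
  linarith


/-- The convention `0⁻¹ = 0` would lose a face of size zero; such a face is null. -/
theorem setIntegral_face_eq_zero {K : Affine.Simplex ℝ (E d) d} {i : Fin (d + 1)} (hd : 2 ≤ d)
    (h : faceSize K i = 0) (f : E d → ℝ) :
    ∫ x in face K i, f x ∂(μHE[d - 1] : Measure (E d)) = 0 := by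
  have h1 := faceSize_pow hd K i
  rw [h, zero_pow (by omega), eq_comm, measureReal_eq_zero_iff (measure_face_lt_top K i).ne] at h1
  exact setIntegral_measure_zero _ h1

/-- `h⁻¹ ∫_F f ≤ C h_F⁻¹ ∫_F f`, in multiplied form. -/
theorem MeshBounds.setIntegral_face_le_inv {m : ℕ} {C : ℝ} (hM : MeshBounds T m C) (hd : 2 ≤ d)
    (K : T.cells) (i : Fin (d + 1)) {f : E d → ℝ} (hf : ∀ x ∈ K.1.closedInterior, 0 ≤ f x) :
    ∫ x in face K.1 i, f x ∂(μHE[d - 1] : Measure (E d)) ≤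
      C * T.h * ((faceSize K.1 i)⁻¹ * ∫ x in face K.1 i, f x ∂(μHE[d - 1] : Measure (E d))) := by
  rcases (faceSize_nonneg K.1 i).eq_or_lt with h | h
  · rw [setIntegral_face_eq_zero hd h.symm]; simp
  · have h0 : 0 ≤ ∫ x in face K.1 i, f x ∂(μHE[d - 1] : Measure (E d)) :=
      setIntegral_nonneg (isCompact_face K.1 i).measurableSet fun x hx => hf x (face_subset _ _ hx)
    rw [← mul_assoc]
    refine le_mul_of_one_le_left h0 ?_
    rw [← div_eq_mul_inv, one_le_div h]
    exact hM.faceSize_le K.1 K.2 i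

/-- Coercivity of the least squares form in `L²`, uniformly in `ε` and the mesh. -/
theorem exists_l2Form_le (hd : 2 ≤ d) (m : ℕ) {C H B : ℝ} (hC : 1 ≤ C) (hH : 0 ≤ H)
    {β : E d → E d} {c : E d → ℝ} (hβc : IsAdmissible Ω β c)
    (hβB : ∀ x ∈ closure Ω, ‖β x‖ ≤ B) :
    ∃ C', 0 < C' ∧ ∀ (T : Mesh d) (ε : ℝ) (u : T.Piecewise), T.Triangulates Ω →
      MeshBounds T m C → T.h ≤ H → 0 < ε → ε ≤ 1 → DegreeLE m u → MemHdiv Ω (T.vec u) →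
      MemH1 Ω (T.scal u) → l2Form Ω T u u ≤ C' * lsForm Ω β c ε T u u := by
  obtain ⟨b₀, X, K₁, K₂, hb₀, hX, hK₁, hK₂, hvol⟩ := exists_volume_estimate hβc hβB
  have hC0 : 0 < C := by linarith
  -- Chosen so that the flux terms, each cell being counted at most `d + 1` times, add up to at most
  -- `1 / 8` of the squared norm of `q`.
  set α : ℝ := 1 / (8 * (d + 1) * C ^ 2) with hα
  have hα0 : 0 < α := by positivity
  -- The two contributions to the boundary form: the flux term, after `h⁻¹` has cancelled against
  -- `h_F ≤ C h`, and the inflow term, which has a factor `h ≤ H` to spare.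
  set K₃ : ℝ := X ^ 2 / (4 * α) * C + 1 / 2 * X * (C * H) with hK₃
  have hK₃0 : 0 ≤ K₃ := by positivity
  set K : ℝ := K₁ + K₂ + K₃ + 1 / 4 with hK
  have hK0 : 0 < K := by positivity
  refine ⟨2 + 8 * K + 8 * K / b₀, by positivity, fun T ε u hT hM hh hε hε1 hu huq huw => ?_⟩
  have hmain := hvol T ε u hT hε hε1 huq huw
  have hh0 := hM.h_pos
  set s := √ε with hs
  have hs0 : 0 ≤ s := Real.sqrt_nonneg _
  have hs2 : s ^ 2 = ε := Real.sq_sqrt hε.le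
  rw [lsForm_self, l2Form_self]
  set ν : T.cells × Fin (d + 1) → E d → ℝ :=
    fun F x => max (-inner ℝ (β x) (outwardNormal F.1.1 F.2)) 0 with hν
  set w : T.cells × Fin (d + 1) → E d → ℝ := fun F x => Poly.val (u.2 F.1) x with hw
  set Φ : T.cells × Fin (d + 1) → ℝ := fun F => (faceSize F.1.1 F.2)⁻¹ *
    ∫ x in face F.1.1 F.2, (ε + ν F x) * w F x ^ 2 ∂(μHE[d - 1] : Measure (E d)) with hΦ
  have hν0 : ∀ F x, 0 ≤ ν F x := fun F x => le_max_right _ _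
  have hνc : ∀ F, ContinuousOn (ν F) F.1.1.closedInterior := fun F =>
    continuousOn_weight hT hβc.continuousOn F.1 _
  have hwc : ∀ F, ContinuousOn (w F) F.1.1.closedInterior := fun F =>
    (Poly.continuous_val _).continuousOn
  have hqc : ∀ F : T.cells × Fin (d + 1), ContinuousOn (vecVal (u.1 F.1)) F.1.1.closedInterior :=
    fun F => (continuous_vecVal _).continuousOn
  have hΦi : ∀ F : T.cells × Fin (d + 1), ContinuousOn (fun x => (ε + ν F x) * w F x ^ 2)
      F.1.1.closedInterior := fun F => (continuousOn_const.add (hνc F)).mul ((hwc F).pow 2)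
  have hΦn : ∀ F : T.cells × Fin (d + 1), ∀ x ∈ F.1.1.closedInterior,
      0 ≤ (ε + ν F x) * w F x ^ 2 := fun F x _ => by have := hν0 F x; positivity
  have hΦle : ∀ F : T.cells × Fin (d + 1),
      ∫ x in face F.1.1 F.2, (ε + ν F x) * w F x ^ 2 ∂(μHE[d - 1] : Measure (E d)) ≤
        C * T.h * Φ F := fun F => hM.setIntegral_face_le_inv hd F.1 F.2 (hΦn F)
  have hΦ0 : ∀ F, 0 ≤ Φ F := fun F => mul_nonneg (inv_nonneg.2 (faceSize_nonneg _ _))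
    (setIntegral_nonneg (isCompact_face _ _).measurableSet
      fun x hx => hΦn F x (face_subset _ _ hx))
  have hmono : ∀ (F : T.cells × Fin (d + 1)) {f g : E d → ℝ},
      ContinuousOn f F.1.1.closedInterior → ContinuousOn g F.1.1.closedInterior →
      (∀ x ∈ F.1.1.closedInterior, f x ≤ g x) →
      ∫ x in face F.1.1 F.2, f x ∂(μHE[d - 1] : Measure (E d)) ≤
        ∫ x in face F.1.1 F.2, g x ∂(μHE[d - 1] : Measure (E d)) := fun F f g hf hg h =>
    setIntegral_mono_on (integrableOn_face _ _ hf) (integrableOn_face _ _ hg)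
      (isCompact_face _ _).measurableSet fun x hx => h x (face_subset _ _ hx)
  have hin : ∀ F : T.cells × Fin (d + 1), ∫ x in face F.1.1 F.2, X * (ν F x * w F x ^ 2)
      ∂(μHE[d - 1] : Measure (E d)) ≤ X * (C * H) * Φ F := by
    intro F
    rw [integral_const_mul, mul_assoc]
    refine mul_le_mul_of_nonneg_left ?_ hX
    calc _ ≤ ∫ x in face F.1.1 F.2, (ε + ν F x) * w F x ^ 2 ∂(μHE[d - 1] : Measure (E d)) :=
          hmono F ((hνc F).mul ((hwc F).pow 2)) (hΦi F) fun x _ =>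
            mul_le_mul_of_nonneg_right (by linarith) (sq_nonneg _)
      _ ≤ C * T.h * Φ F := hΦle F
      _ ≤ C * H * Φ F := by have := hΦ0 F; gcongr
  have hfl : ∀ F : T.cells × Fin (d + 1), s * ∫ x in face F.1.1 F.2,
      X * (|w F x| * ‖vecVal (u.1 F.1) x‖) ∂(μHE[d - 1] : Measure (E d)) ≤
        α * C ^ 2 * vecNormSq u F.1 + X ^ 2 / (4 * α) * C * Φ F := by
    intro F
    have hN := vecNormSq_nonneg u F.1
    have hq : ∀ x ∈ F.1.1.closedInterior,
        ‖vecVal (u.1 F.1) x‖ ^ 2 ≤ C * vecNormSq u F.1 / T.h ^ d := fun x hx => by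
      rw [le_div_iff₀ (by positivity), mul_comm]
      exact hM.vec_le hu F.1 hx
    set Q := C * vecNormSq u F.1 / T.h ^ d with hQ
    -- Young's inequality with weight `α * h`. The factor `s` is squared together with `|w|`, which
    -- gives the weight `ε` of the boundary form.
    have hpt : ∀ x ∈ F.1.1.closedInterior, s * (X * (|w F x| * ‖vecVal (u.1 F.1) x‖)) ≤
        α * T.h * Q + X ^ 2 / (4 * α * T.h) * ((ε + ν F x) * w F x ^ 2) := by
      intro x hx
      have y : s * (X * (|w F x| * ‖vecVal (u.1 F.1) x‖)) ≤
          α * T.h * ‖vecVal (u.1 F.1) x‖ ^ 2 + X ^ 2 / (4 * α * T.h) * (ε * w F x ^ 2) := by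
        rw [← hs2, ← sq_abs (w F x)]
        set p := ‖vecVal (u.1 F.1) x‖
        set r := |w F x|
        have h1 : 0 ≤ α * T.h * (p - s * X * r / (2 * (α * T.h))) ^ 2 := by positivity
        have e1 : α * T.h * (p - s * X * r / (2 * (α * T.h))) ^ 2 =
            α * T.h * p ^ 2 + X ^ 2 / (4 * α * T.h) * (s ^ 2 * r ^ 2) - s * (X * (r * p)) := by
          field_simp; ring
        linarith
      refine y.trans (add_le_add (mul_le_mul_of_nonneg_left (hq x hx) (by positivity)) ?_)
      refine mul_le_mul_of_nonneg_left ?_ (by positivity)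
      have := hν0 F x
      exact mul_le_mul_of_nonneg_right (by linarith) (sq_nonneg _)
    have i1 := integrableOn_face F.1.1 F.2 (f := fun _ => α * T.h * Q) continuousOn_const
    have i2 := (integrableOn_face F.1.1 F.2 (hΦi F)).const_mul (X ^ 2 / (4 * α * T.h))
    rw [← integral_const_mul]
    calc _ ≤ ∫ x in face F.1.1 F.2, (α * T.h * Q + X ^ 2 / (4 * α * T.h) *
          ((ε + ν F x) * w F x ^ 2)) ∂(μHE[d - 1] : Measure (E d)) :=
          hmono F (continuousOn_const.mul (continuousOn_const.mul ((hwc F).abs.mul (hqc F).norm)))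
            (continuousOn_const.add (continuousOn_const.mul (hΦi F))) hpt
      _ = (∫ x in face F.1.1 F.2, α * T.h * Q ∂(μHE[d - 1] : Measure (E d))) +
          X ^ 2 / (4 * α * T.h) * ∫ x in face F.1.1 F.2, (ε + ν F x) * w F x ^ 2
            ∂(μHE[d - 1] : Measure (E d)) := by
          rw [integral_add i1 i2]
          exact congrArg _ (integral_const_mul _ _)
      _ ≤ α * T.h * Q * (C * T.h ^ (d - 1)) + X ^ 2 / (4 * α * T.h) * (C * T.h * Φ F) := by
          refine add_le_add ((setIntegral_face_le F.1.1 F.2 continuousOn_const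
            fun x _ => le_rfl).trans ?_) (mul_le_mul_of_nonneg_left (hΦle F) (by positivity))
          exact mul_le_mul_of_nonneg_left (hM.measure_face_le _ F.1.2 _) (by positivity)
      _ = _ := by
          have hp : T.h * T.h ^ (d - 1) = T.h ^ d := by
            rw [← pow_succ', show d - 1 + 1 = d by omega]
          rw [hQ, ← hp]
          field_simp
  have hsum1 : s * (∑ F ∈ T.boundaryFaces Ω, ∫ x in face F.1.1 F.2,
      X * (|w F x| * ‖vecVal (u.1 F.1) x‖) ∂(μHE[d - 1] : Measure (E d))) ≤
      1 / 8 * (∫ x in Ω, ‖T.vec u x‖ ^ 2) +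
        X ^ 2 / (4 * α) * C * ∑ F ∈ T.boundaryFaces Ω, Φ F := by
    rw [Finset.mul_sum]
    refine (Finset.sum_le_sum fun F _ => hfl F).trans ?_
    rw [Finset.sum_add_distrib, ← Finset.mul_sum, ← Finset.mul_sum, integral_sq_norm_vec hT]
    refine add_le_add ?_ le_rfl
    calc _ ≤ α * C ^ 2 * ((d + 1) * ∑ K, vecNormSq u K) :=
          mul_le_mul_of_nonneg_left (sum_boundaryFaces_le (vecNormSq_nonneg u)) (by positivity)
      _ = _ := by rw [hα]; field_simp
  have hsum2 : (∑ F ∈ T.boundaryFaces Ω, ∫ x in face F.1.1 F.2, X * (ν F x * w F x ^ 2)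
      ∂(μHE[d - 1] : Measure (E d))) ≤ X * (C * H) * ∑ F ∈ T.boundaryFaces Ω, Φ F := by
    rw [Finset.mul_sum]
    exact Finset.sum_le_sum fun F _ => hin F
  have hI : ∀ {V : E d → E d}, MemLp V ∞ (volume.restrict Ω) →
      IntegrableOn (fun x => ‖V x‖ ^ 2) Ω := fun {V} hV => by
    refine integrableOn_of_memLp_top hT ?_
    simpa only [real_inner_self_eq_norm_sq] using memLp_top_inner hV hV
  -- The flux `q` is the flux residual minus `√ε ∇w`, so it need not be estimated separately.
  have hq2 : ∫ x in Ω, ‖T.vec u x‖ ^ 2 ≤ 2 * (∫ x in Ω, ‖T.vec u x + s • T.grad u x‖ ^ 2) +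
      2 * ∫ x in Ω, ‖s • T.grad u x‖ ^ 2 := by
    have j1 := hI (Mesh.memLp_vec (Ω := Ω) u)
    have j2 : IntegrableOn (fun x => 2 * ‖T.vec u x + s • T.grad u x‖ ^ 2) Ω :=
      (hI (memLp_flux_residual (Ω := Ω) u s)).const_mul 2
    have j3 : IntegrableOn (fun x => 2 * ‖s • T.grad u x‖ ^ 2) Ω :=
      (hI ((Mesh.memLp_grad (Ω := Ω) u).const_smul s)).const_mul 2
    rw [← integral_const_mul, ← integral_const_mul, ← integral_add j2 j3]
    refine integral_mono j1 (j2.add j3) fun x => ?_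
    have h1 : ‖T.vec u x‖ ≤ ‖T.vec u x + s • T.grad u x‖ + ‖s • T.grad u x‖ := by
      have := norm_sub_le (T.vec u x + s • T.grad u x) (s • T.grad u x)
      rwa [add_sub_cancel_right] at this
    have h2 := pow_le_pow_left₀ (norm_nonneg _) h1 2
    simp only [Pi.add_apply]
    nlinarith [sq_nonneg (‖T.vec u x + s • T.grad u x‖ - ‖s • T.grad u x‖)]
  have hP0 : 0 ≤ ∑ F ∈ T.boundaryFaces Ω, Φ F := Finset.sum_nonneg fun F _ => hΦ0 F
  have hr1 : 0 ≤ ∫ x in Ω, ‖T.vec u x + s • T.grad u x‖ ^ 2 :=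
    integral_nonneg fun _ => sq_nonneg _
  have hr2 : 0 ≤ ∫ x in Ω,
      (s * T.div u x + inner ℝ (β x) (T.grad u x) + c x * T.scal u x) ^ 2 :=
    integral_nonneg fun _ => sq_nonneg _
  have hr3 : 0 ≤ ∫ x in Ω, ‖s • T.grad u x‖ ^ 2 := integral_nonneg fun _ => sq_nonneg _
  have hr4 : 0 ≤ ∫ x in Ω, T.scal u x ^ 2 := integral_nonneg fun _ => sq_nonneg _
  set A := ∫ x in Ω, ‖T.vec u x + s • T.grad u x‖ ^ 2
  set R := ∫ x in Ω, (s * T.div u x + inner ℝ (β x) (T.grad u x) + c x * T.scal u x) ^ 2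
  set P := ∑ F ∈ T.boundaryFaces Ω, Φ F
  set g := ∫ x in Ω, ‖s • T.grad u x‖ ^ 2
  set W := ∫ x in Ω, T.scal u x ^ 2
  -- By `hq2` the term `1 / 8 * ‖q‖²` costs `1 / 4 * A + 1 / 4 * g`; the latter is taken from `1 / 2
  -- * g`.
  have hsum : 1 / 4 * g + b₀ / 8 * W ≤ K * (A + R + P) := by
    have h1 : 1 / 4 * g + b₀ / 8 * W ≤ (K₁ + 1 / 4) * A + K₂ * R + K₃ * P := by
      rw [hK₃]; linarith
    have h2 : (K₁ + 1 / 4) * A ≤ K * A := mul_le_mul_of_nonneg_right (by linarith) hr1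
    have h3 : K₂ * R ≤ K * R := mul_le_mul_of_nonneg_right (by linarith) hr2
    have h4 : K₃ * P ≤ K * P := mul_le_mul_of_nonneg_right (by linarith) hP0
    linarith
  have hg : 2 * g ≤ 8 * K * (A + R + P) := by
    have : 0 ≤ b₀ / 8 * W := by positivity
    linarith
  have hW : W ≤ 8 * K / b₀ * (A + R + P) := by
    rw [div_mul_eq_mul_div, le_div_iff₀ hb₀]
    linarith
  calc _ ≤ 2 * A + 2 * g + W := by linarith
    _ ≤ 2 * (A + R + P) + 8 * K * (A + R + P) + 8 * K / b₀ * (A + R + P) := by linarith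
    _ = _ := by ring

end Coercivity

/-! ### Condition numbers -/

section CondNumber

open Matrix

variable {ι : Type} [Fintype ι] [DecidableEq ι]

theorem dotProduct_self_eq_norm_sq (x : ι → ℝ) : x ⬝ᵥ x = ‖WithLp.toLp 2 x‖ ^ 2 := by
  rw [EuclideanSpace.real_norm_sq_eq]
  simp [dotProduct, pow_two]

/-- The Cauchy–Schwarz inequality of the semi-inner product given by `A`. -/
theorem dotProduct_mulVec_sq_le {A : Matrix ι ι ℝ} (hA : A.PosSemidef) (x y : ι → ℝ) :
    (y ⬝ᵥ A *ᵥ x) ^ 2 ≤ (y ⬝ᵥ A *ᵥ y) * (x ⬝ᵥ A *ᵥ x) := by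
  have h0 : ∀ z, 0 ≤ (Matrix.toBilin' A) z z := fun z => by
    rw [Matrix.toBilin'_apply']
    simpa using hA.dotProduct_mulVec_nonneg z
  have hs : y ⬝ᵥ A *ᵥ x = x ⬝ᵥ A *ᵥ y := by
    have hT : Aᵀ = A := by simpa using hA.isHermitian.eq
    rw [dotProduct_comm, dotProduct_mulVec, ← hT, vecMul_transpose]
    rw [hT]
  have := LinearMap.BilinForm.apply_mul_apply_le_of_forall_zero_le (Matrix.toBilin' A) h0 y x
  simp only [Matrix.toBilin'_apply'] at this
  rw [pow_two]
  nth_rewrite 2 [hs]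
  exact this

/-- With `y = A x`, Cauchy–Schwarz for `A` gives `|y|⁴ = (y · A x)² ≤ (y · A y)(x · A x) ≤ μ² |y|²
|x|²`. -/
theorem norm_toEuclideanCLM_le {A : Matrix ι ι ℝ} (hA : A.PosSemidef) {μ : ℝ} (hμ : 0 ≤ μ)
    (h : ∀ x, x ⬝ᵥ A *ᵥ x ≤ μ * (x ⬝ᵥ x)) : ‖toEuclideanCLM (𝕜 := ℝ) A‖ ≤ μ := by
  refine ContinuousLinearMap.opNorm_le_bound _ hμ fun x => ?_
  set y := A *ᵥ x.ofLp with hy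
  have e1 : ‖toEuclideanCLM (𝕜 := ℝ) A x‖ ^ 2 = y ⬝ᵥ y := by
    rw [dotProduct_self_eq_norm_sq]; rfl
  have e2 : ‖x‖ ^ 2 = x.ofLp ⬝ᵥ x.ofLp := by rw [dotProduct_self_eq_norm_sq]
  have h1 := dotProduct_mulVec_sq_le hA x.ofLp y
  have h2 : (y ⬝ᵥ A *ᵥ y) * (x.ofLp ⬝ᵥ A *ᵥ x.ofLp) ≤ (μ * (y ⬝ᵥ y)) * (μ * (x.ofLp ⬝ᵥ x.ofLp)) :=
    mul_le_mul (h y) (h _) (by simpa using hA.dotProduct_mulVec_nonneg x.ofLp)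
      (mul_nonneg hμ (by rw [← e1]; positivity))
  rw [← hy] at h1
  refine le_of_sq_le_sq ?_ (by positivity)
  rw [mul_pow, e1, e2]
  have h3 : (y ⬝ᵥ y) * (y ⬝ᵥ y) ≤ (y ⬝ᵥ y) * (μ ^ 2 * (x.ofLp ⬝ᵥ x.ofLp)) := by
    calc _ = (y ⬝ᵥ y) ^ 2 := by ring
      _ ≤ _ := h1.trans h2
      _ = _ := by ring
  have h0 : 0 ≤ y ⬝ᵥ y := by rw [← e1]; positivity
  rcases h0.eq_or_lt with h | h
  · rw [← h, ← e2]; positivity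
  · exact le_of_mul_le_mul_left h3 h

theorem dotProduct_mulVec_le_norm (A : Matrix ι ι ℝ) (x : ι → ℝ) :
    x ⬝ᵥ A *ᵥ x ≤ ‖toEuclideanCLM (𝕜 := ℝ) A‖ * (x ⬝ᵥ x) := by
  have h := inner_toEuclideanCLM A (WithLp.toLp 2 x) (WithLp.toLp 2 x)
  change _ = x ⬝ᵥ A *ᵥ x at h
  rw [← h, dotProduct_self_eq_norm_sq]
  refine (real_inner_le_norm _ _).trans ?_
  have := (toEuclideanCLM (𝕜 := ℝ) A).le_opNorm (WithLp.toLp 2 x)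
  nlinarith [norm_nonneg (WithLp.toLp 2 x)]

theorem inv_mulVec_mulVec {A : Matrix ι ι ℝ} (hA : A.PosDef) (x : ι → ℝ) :
    A⁻¹ *ᵥ (A *ᵥ x) = x := by
  rw [mulVec_mulVec, nonsing_inv_mul _ ((isUnit_iff_isUnit_det A).1 hA.isUnit), one_mulVec]

theorem mulVec_inv_mulVec {A : Matrix ι ι ℝ} (hA : A.PosDef) (x : ι → ℝ) :
    A *ᵥ (A⁻¹ *ᵥ x) = x := by
  rw [mulVec_mulVec, mul_nonsing_inv _ ((isUnit_iff_isUnit_det A).1 hA.isUnit), one_mulVec]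

/-- Coercivity at `x = A⁻¹ y` reads `|x|² ≤ α (x · y)`, which is at most `α |x| |y|`. -/
theorem norm_toEuclideanCLM_inv_le {A : Matrix ι ι ℝ} (hA : A.PosDef) {α : ℝ} (hα : 0 ≤ α)
    (h : ∀ x, x ⬝ᵥ x ≤ α * (x ⬝ᵥ A *ᵥ x)) : ‖toEuclideanCLM (𝕜 := ℝ) A⁻¹‖ ≤ α := by
  refine ContinuousLinearMap.opNorm_le_bound _ hα fun y => ?_
  set x := A⁻¹ *ᵥ y.ofLp with hx
  have e1 : ‖toEuclideanCLM (𝕜 := ℝ) A⁻¹ y‖ = ‖WithLp.toLp 2 x‖ := rfl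
  have h1 := h x
  rw [hx, mulVec_inv_mulVec hA, ← hx, dotProduct_self_eq_norm_sq] at h1
  have h2 : x ⬝ᵥ y.ofLp ≤ ‖WithLp.toLp 2 x‖ * ‖y‖ := by
    refine le_trans (le_of_eq ?_) (real_inner_le_norm (WithLp.toLp 2 x) y)
    simp [PiLp.inner_apply, dotProduct, mul_comm]
  rw [e1]
  rcases (norm_nonneg (WithLp.toLp 2 x)).eq_or_lt with h0 | h0
  · rw [← h0]; positivity
  · have h3 : ‖WithLp.toLp 2 x‖ * ‖WithLp.toLp 2 x‖ ≤ ‖WithLp.toLp 2 x‖ * (α * ‖y‖) := by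
      calc _ = ‖WithLp.toLp 2 x‖ ^ 2 := by ring
        _ ≤ _ := h1.trans (mul_le_mul_of_nonneg_left h2 hα)
        _ = _ := by ring
    exact le_of_mul_le_mul_left h3 h0

/-- Cauchy–Schwarz for `A⁻¹` at `x` and `A x` gives `|x|⁴ ≤ (x · A⁻¹ x)(x · A x)`. -/
theorem dotProduct_self_le_norm_inv {A : Matrix ι ι ℝ} (hA : A.PosDef) (x : ι → ℝ) :
    x ⬝ᵥ x ≤ ‖toEuclideanCLM (𝕜 := ℝ) A⁻¹‖ * (x ⬝ᵥ A *ᵥ x) := by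
  have h1 := dotProduct_mulVec_sq_le hA.inv.posSemidef (A *ᵥ x) x
  rw [inv_mulVec_mulVec hA, dotProduct_comm (A *ᵥ x)] at h1
  have h2 := dotProduct_mulVec_le_norm A⁻¹ x
  have h3 : 0 ≤ x ⬝ᵥ A *ᵥ x := by simpa using hA.posSemidef.dotProduct_mulVec_nonneg x
  have h4 : 0 ≤ x ⬝ᵥ x := by rw [dotProduct_self_eq_norm_sq]; positivity
  rcases h4.eq_or_lt with h | h
  · rw [← h]; positivity
  · refine le_of_mul_le_mul_left ?_ h
    calc _ = (x ⬝ᵥ x) ^ 2 := by ring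
      _ ≤ _ := h1.trans (mul_le_mul_of_nonneg_right h2 h3)
      _ = _ := by ring

theorem condNumber_le {A : Matrix ι ι ℝ} (hA : A.PosDef) {α μ : ℝ} (hα : 0 ≤ α) (hμ : 0 ≤ μ)
    (h1 : ∀ x, x ⬝ᵥ x ≤ α * (x ⬝ᵥ A *ᵥ x)) (h2 : ∀ x, x ⬝ᵥ A *ᵥ x ≤ μ * (x ⬝ᵥ x)) :
    condNumber A ≤ μ * α :=
  mul_le_mul (norm_toEuclideanCLM_le hA.posSemidef hμ h2) (norm_toEuclideanCLM_inv_le hA hα h1)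
    (norm_nonneg _) hμ

/-- Spectrally equivalent matrices have comparable condition numbers. -/
theorem condNumber_le_of_equiv {A M : Matrix ι ι ℝ} (hA : A.PosDef) (hM : M.PosDef) {c C : ℝ}
    (hc : 0 ≤ c) (hC : 0 ≤ C) (h1 : ∀ x, x ⬝ᵥ M *ᵥ x ≤ c * (x ⬝ᵥ A *ᵥ x))
    (h2 : ∀ x, x ⬝ᵥ A *ᵥ x ≤ C * (x ⬝ᵥ M *ᵥ x)) :
    condNumber A ≤ C * c * condNumber M := by
  refine (condNumber_le hA (α := ‖toEuclideanCLM (𝕜 := ℝ) M⁻¹‖ * c)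
    (μ := C * ‖toEuclideanCLM (𝕜 := ℝ) M‖) (by positivity) (by positivity) (fun x => ?_)
    fun x => ?_).trans_eq ?_
  · rw [mul_assoc]
    exact (dotProduct_self_le_norm_inv hM x).trans
      (mul_le_mul_of_nonneg_left (h1 x) (norm_nonneg _))
  · rw [mul_assoc]
    exact (h2 x).trans (mul_le_mul_of_nonneg_left (dotProduct_mulVec_le_norm M x) hC)
  · rw [condNumber]; ring

end CondNumber

/-! ### Gram matrices of the two forms -/

section Gram

open Matrix

theorem dotProduct_gram_mulVec {ι V : Type*} [Fintype ι] [AddCommGroup V] [Module ℝ V]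
    (a : V →ₗ[ℝ] V →ₗ[ℝ] ℝ) (b : Module.Basis ι ℝ V) (x : ι → ℝ) :
    x ⬝ᵥ (Matrix.of fun i j => a (b j) (b i)) *ᵥ x =
      a (b.equivFun.symm x) (b.equivFun.symm x) := by
  rw [Module.Basis.equivFun_symm_apply]
  simp only [map_sum, map_smul, LinearMap.sum_apply, LinearMap.smul_apply, smul_eq_mul, dotProduct,
    mulVec, Matrix.of_apply, Finset.mul_sum]
  refine Finset.sum_congr rfl fun i _ => Finset.sum_congr rfl fun j _ => ?_
  ring

theorem posDef_gram {ι V : Type*} [Fintype ι] [AddCommGroup V] [Module ℝ V]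
    (a : V →ₗ[ℝ] V →ₗ[ℝ] ℝ) (hs : ∀ u v, a u v = a v u) (hp : ∀ u, u ≠ 0 → 0 < a u u)
    (b : Module.Basis ι ℝ V) : (Matrix.of fun i j => a (b j) (b i)).PosDef := by
  rw [Matrix.posDef_iff_dotProduct_mulVec]
  refine ⟨Matrix.IsHermitian.ext fun i j => by simp [hs (b i)], fun x hx => ?_⟩
  have h := dotProduct_gram_mulVec a b x
  rw [star_trivial, h]
  exact hp _ fun h0 => hx (b.equivFun.symm.map_eq_zero_iff.1 h0)

variable {d : ℕ} {T : Mesh d} {Ω : Set (E d)}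

theorem Mesh.div_add (u v : T.Piecewise) : T.div (u + v) = T.div u + T.div v := by
  ext x
  simp only [Mesh.div, Mesh.glue, Pi.add_apply, ← Finset.sum_add_distrib]
  refine Finset.sum_congr rfl fun K _ => ?_
  by_cases hx : x ∈ K.1.interior
  · simp [hx, divVal, Poly.val, Finset.sum_add_distrib]
  · simp [hx]

theorem Mesh.div_smul (a : ℝ) (u : T.Piecewise) : T.div (a • u) = a • T.div u := by
  ext x
  simp only [Mesh.div, Mesh.glue, Pi.smul_apply, Finset.smul_sum]
  refine Finset.sum_congr rfl fun K _ => ?_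
  by_cases hx : x ∈ K.1.interior
  · simp [hx, divVal, Poly.val, Finset.mul_sum]
  · simp [hx]

theorem Mesh.grad_add (u v : T.Piecewise) : T.grad (u + v) = T.grad u + T.grad v := by
  ext x i
  simp only [Mesh.grad, Mesh.glue, Pi.add_apply, ← Finset.sum_add_distrib]
  refine congrArg (fun y : E d => y i) (Finset.sum_congr rfl fun K _ => ?_)
  by_cases hx : x ∈ K.1.interior
  · ext j; simp [hx, gradVal, Poly.val]
  · simp [hx]

theorem Mesh.grad_smul (a : ℝ) (u : T.Piecewise) : T.grad (a • u) = a • T.grad u := by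
  ext x i
  simp only [Mesh.grad, Mesh.glue, Pi.smul_apply, Finset.smul_sum]
  refine congrArg (fun y : E d => y i) (Finset.sum_congr rfl fun K _ => ?_)
  by_cases hx : x ∈ K.1.interior
  · ext j; simp [hx, gradVal, Poly.val]
  · simp [hx]

theorem l2Form_comm (u v : T.Piecewise) : l2Form Ω T u v = l2Form Ω T v u := by
  simp only [l2Form, real_inner_comm, mul_comm]

theorem l2Form_smul_left (a : ℝ) (u v : T.Piecewise) :
    l2Form Ω T (a • u) v = a * l2Form Ω T u v := by
  simp only [l2Form, T.vec_smul, T.scal_smul, Pi.smul_apply, real_inner_smul_left, smul_eq_mul,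
    mul_assoc, integral_const_mul, mul_add]

variable [NeZero d]

theorem l2Form_add_left (hT : T.Triangulates Ω) (u u' v : T.Piecewise) :
    l2Form Ω T (u + u') v = l2Form Ω T u v + l2Form Ω T u' v := by
  have i1 : ∀ u : T.Piecewise, IntegrableOn (fun x => inner ℝ (T.vec u x) (T.vec v x)) Ω :=
    fun u => integrableOn_of_memLp_top hT (memLp_top_inner (Mesh.memLp_vec u) (Mesh.memLp_vec v))
  have i2 : ∀ u : T.Piecewise, IntegrableOn (fun x => T.scal u x * T.scal v x) Ω :=
    fun u => integrableOn_of_memLp_top hT (memLp_top_mul (Mesh.memLp_scal u) (Mesh.memLp_scal v))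
  simp only [l2Form, T.vec_add, T.scal_add, Pi.add_apply, inner_add_left, add_mul]
  rw [integral_add (i1 u) (i1 u'), integral_add (i2 u) (i2 u')]
  ring

theorem lsForm_comm (β : E d → E d) (c : E d → ℝ) (ε : ℝ) (u v : T.Piecewise) :
    lsForm Ω β c ε T u v = lsForm Ω β c ε T v u := by
  have h : ∀ (F : T.cells × Fin (d + 1)) (x : E d),
      (ε + max (-inner ℝ (β x) (outwardNormal F.1.1 F.2)) 0) *
        Poly.val (u.2 F.1) x * Poly.val (v.2 F.1) x =
      (ε + max (-inner ℝ (β x) (outwardNormal F.1.1 F.2)) 0) *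
        Poly.val (v.2 F.1) x * Poly.val (u.2 F.1) x := fun F x => by ring
  simp only [lsForm, h]
  congr 2
  · simp only [real_inner_comm]
  · simp only [mul_comm]

theorem lsForm_smul_left (β : E d → E d) (c : E d → ℝ) (ε a : ℝ) (u v : T.Piecewise) :
    lsForm Ω β c ε T (a • u) v = a * lsForm Ω β c ε T u v := by
  have e1 : ∀ x, inner ℝ (T.vec (a • u) x + √ε • T.grad (a • u) x) (T.vec v x + √ε • T.grad v x) =
      a * inner ℝ (T.vec u x + √ε • T.grad u x) (T.vec v x + √ε • T.grad v x) := fun x => by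
    rw [T.vec_smul, Mesh.grad_smul, Pi.smul_apply, Pi.smul_apply, smul_comm, ← smul_add,
      real_inner_smul_left]
  have e2 : ∀ x, (√ε * T.div (a • u) x + inner ℝ (β x) (T.grad (a • u) x) + c x * T.scal (a • u) x) *
      (√ε * T.div v x + inner ℝ (β x) (T.grad v x) + c x * T.scal v x) =
      a * ((√ε * T.div u x + inner ℝ (β x) (T.grad u x) + c x * T.scal u x) *
      (√ε * T.div v x + inner ℝ (β x) (T.grad v x) + c x * T.scal v x)) := fun x => by
    rw [Mesh.div_smul, Mesh.grad_smul, T.scal_smul]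
    simp only [Pi.smul_apply, real_inner_smul_right, smul_eq_mul]
    ring
  have e3 : ∀ (F : T.cells × Fin (d + 1)) (x : E d),
      (ε + max (-inner ℝ (β x) (outwardNormal F.1.1 F.2)) 0) *
        Poly.val ((a • u).2 F.1) x * Poly.val (v.2 F.1) x =
      a * ((ε + max (-inner ℝ (β x) (outwardNormal F.1.1 F.2)) 0) *
        Poly.val (u.2 F.1) x * Poly.val (v.2 F.1) x) := fun F x => by
    rw [Prod.smul_snd, Pi.smul_apply, Poly.val_smul]; ring
  simp only [lsForm, e1, e2, e3, integral_const_mul]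
  rw [mul_add, mul_add, Finset.mul_sum]
  exact congrArg _ (Finset.sum_congr rfl fun F _ => mul_left_comm _ _ _)

theorem lsForm_add_left {β : E d → E d} {c : E d → ℝ} (hT : T.Triangulates Ω)
    (hβ : ContinuousOn β (closure Ω)) (hβL : MemLp β ∞ (volume.restrict Ω))
    (hc : MemLp c ∞ (volume.restrict Ω)) (ε : ℝ) (u u' v : T.Piecewise) :
    lsForm Ω β c ε T (u + u') v = lsForm Ω β c ε T u v + lsForm Ω β c ε T u' v := by
  have i1 : ∀ u : T.Piecewise, IntegrableOn
      (fun x => inner ℝ (T.vec u x + √ε • T.grad u x) (T.vec v x + √ε • T.grad v x)) Ω :=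
    fun u => integrableOn_of_memLp_top hT
      (memLp_top_inner (memLp_flux_residual u _) (memLp_flux_residual v _))
  have i2 : ∀ u : T.Piecewise, IntegrableOn
      (fun x => (√ε * T.div u x + inner ℝ (β x) (T.grad u x) + c x * T.scal u x) *
      (√ε * T.div v x + inner ℝ (β x) (T.grad v x) + c x * T.scal v x)) Ω :=
    fun u => integrableOn_of_memLp_top hT
      (memLp_top_mul (memLp_residual hβL hc u _) (memLp_residual hβL hc v _))
  have i3 : ∀ (F : T.cells × Fin (d + 1)) (u : T.Piecewise), IntegrableOn (fun x =>
      (ε + max (-inner ℝ (β x) (outwardNormal F.1.1 F.2)) 0) *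
        Poly.val (u.2 F.1) x * Poly.val (v.2 F.1) x) (face F.1.1 F.2)
        (μHE[d - 1] : Measure (E d)) := fun F u => integrableOn_face _ _
    (((continuousOn_const.add (continuousOn_weight hT hβ F.1 _)).mul
      (Poly.continuous_val _).continuousOn).mul (Poly.continuous_val _).continuousOn)
  have e1 : ∀ x, inner ℝ (T.vec (u + u') x + √ε • T.grad (u + u') x)
      (T.vec v x + √ε • T.grad v x) =
      inner ℝ (T.vec u x + √ε • T.grad u x) (T.vec v x + √ε • T.grad v x) +
      inner ℝ (T.vec u' x + √ε • T.grad u' x) (T.vec v x + √ε • T.grad v x) := fun x => by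
    rw [← inner_add_left, T.vec_add, Mesh.grad_add, Pi.add_apply, Pi.add_apply, smul_add]
    congr 1
    abel
  have e2 : ∀ x, (√ε * T.div (u + u') x + inner ℝ (β x) (T.grad (u + u') x) +
        c x * T.scal (u + u') x) *
      (√ε * T.div v x + inner ℝ (β x) (T.grad v x) + c x * T.scal v x) =
      (√ε * T.div u x + inner ℝ (β x) (T.grad u x) + c x * T.scal u x) *
      (√ε * T.div v x + inner ℝ (β x) (T.grad v x) + c x * T.scal v x) +
      (√ε * T.div u' x + inner ℝ (β x) (T.grad u' x) + c x * T.scal u' x) *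
      (√ε * T.div v x + inner ℝ (β x) (T.grad v x) + c x * T.scal v x) := fun x => by
    rw [Mesh.div_add, Mesh.grad_add, T.scal_add]
    simp only [Pi.add_apply, inner_add_right]
    ring
  have e3 : ∀ (F : T.cells × Fin (d + 1)) (x : E d),
      (ε + max (-inner ℝ (β x) (outwardNormal F.1.1 F.2)) 0) *
        Poly.val ((u + u').2 F.1) x * Poly.val (v.2 F.1) x =
      (ε + max (-inner ℝ (β x) (outwardNormal F.1.1 F.2)) 0) *
        Poly.val (u.2 F.1) x * Poly.val (v.2 F.1) x +
      (ε + max (-inner ℝ (β x) (outwardNormal F.1.1 F.2)) 0) *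
        Poly.val (u'.2 F.1) x * Poly.val (v.2 F.1) x := fun F x => by
    rw [Prod.snd_add, Pi.add_apply, Poly.val_add]; ring
  simp only [lsForm, e1, e2, e3]
  rw [integral_add (i1 u) (i1 u'), integral_add (i2 u) (i2 u')]
  have e4 : ∀ F : T.cells × Fin (d + 1), _ := fun F => integral_add (i3 F u) (i3 F u')
  simp only [e4, mul_add, Finset.sum_add_distrib]
  ring

/-- The `L²` inner product as a bilinear form. -/
def l2Bilin (hT : T.Triangulates Ω) : T.Piecewise →ₗ[ℝ] T.Piecewise →ₗ[ℝ] ℝ :=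
  LinearMap.mk₂ ℝ (l2Form Ω T) (l2Form_add_left hT) l2Form_smul_left
    (fun u v w => by rw [l2Form_comm, l2Form_add_left hT, l2Form_comm v, l2Form_comm w])
    (fun a u v => by rw [l2Form_comm, l2Form_smul_left, l2Form_comm v, smul_eq_mul])

/-- The least squares form as a bilinear form. -/
def lsBilin {β : E d → E d} {c : E d → ℝ} (hT : T.Triangulates Ω)
    (hβ : ContinuousOn β (closure Ω)) (hβL : MemLp β ∞ (volume.restrict Ω))
    (hc : MemLp c ∞ (volume.restrict Ω)) (ε : ℝ) : T.Piecewise →ₗ[ℝ] T.Piecewise →ₗ[ℝ] ℝ :=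
  LinearMap.mk₂ ℝ (lsForm Ω β c ε T) (lsForm_add_left hT hβ hβL hc ε) (lsForm_smul_left β c ε)
    (fun u v w => by
      rw [lsForm_comm, lsForm_add_left hT hβ hβL hc, lsForm_comm _ _ _ v, lsForm_comm _ _ _ w])
    (fun a u v => by rw [lsForm_comm, lsForm_smul_left, lsForm_comm _ _ _ v, smul_eq_mul])

/-- Elements are families of polynomials, and a nonzero polynomial has positive norm on an open
cell. No continuity across cells is needed. -/
theorem l2Form_self_pos (hT : T.Triangulates Ω) {u : T.Piecewise} (hu : u ≠ 0) :
    0 < l2Form Ω T u u := by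
  rw [l2Form_self_eq_sum hT]
  have hnn : ∀ K ∈ Finset.univ, 0 ≤ vecNormSq u K + scalNormSq u K := fun K _ =>
    add_nonneg (vecNormSq_nonneg u K) (scalNormSq_nonneg u K)
  have hpos : ∀ (K : T.cells) {p : Poly d}, p ≠ 0 → 0 < ∫ z in K.1.interior, Poly.val p z ^ 2 := by
    intro K p hp
    simp only [pow_two]
    exact integral_sq_pos_of_ne_zero hp (isOpen_interior K.1) (interior_nonempty K.1)
      (integrableOn_interior_of_continuous ((Poly.continuous_val p).mul (Poly.continuous_val p)) K.1)
  by_contra hle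
  have h0 : ∀ K, vecNormSq u K + scalNormSq u K = 0 := fun K =>
    (Finset.sum_eq_zero_iff_of_nonneg hnn).1
      (le_antisymm (not_lt.1 hle) (Finset.sum_nonneg hnn)) K (Finset.mem_univ K)
  refine hu (Prod.ext (funext fun K => funext fun i => ?_) (funext fun K => ?_))
  · by_contra hne
    have h1 := hpos K hne
    have h2 : ∫ z in K.1.interior, Poly.val (u.1 K i) z ^ 2 ≤ vecNormSq u K :=
      Finset.single_le_sum (f := fun i => ∫ z in K.1.interior, Poly.val (u.1 K i) z ^ 2)
        (fun _ _ => integral_nonneg fun _ => sq_nonneg _) (Finset.mem_univ i)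
    have := h0 K
    have := scalNormSq_nonneg u K
    linarith
  · by_contra hne
    have h1 : 0 < scalNormSq u K := hpos K hne
    have := h0 K
    have := vecNormSq_nonneg u K
    linarith

/-- A form on the finite element space, restricted from all piecewise polynomials. -/
def restrictForm {k : ℕ} (a : T.Piecewise →ₗ[ℝ] T.Piecewise →ₗ[ℝ] ℝ) :
    T.feSpace Ω k →ₗ[ℝ] T.feSpace Ω k →ₗ[ℝ] ℝ :=
  a.compl₁₂ (T.feSpace Ω k).subtype (T.feSpace Ω k).subtype

variable {k : ℕ} {ι : Type} [Fintype ι]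

theorem dotProduct_massMatrix (hT : T.Triangulates Ω) (b : Module.Basis ι ℝ (T.feSpace Ω k))
    (x : ι → ℝ) : x ⬝ᵥ massMatrix b *ᵥ x =
      l2Form Ω T (b.equivFun.symm x : T.Piecewise) (b.equivFun.symm x : T.Piecewise) :=
  dotProduct_gram_mulVec (restrictForm (l2Bilin hT)) b x

theorem posDef_massMatrix (hT : T.Triangulates Ω) (b : Module.Basis ι ℝ (T.feSpace Ω k)) :
    (massMatrix b).PosDef :=
  posDef_gram (restrictForm (l2Bilin hT)) (fun _ _ => l2Form_comm _ _)
    (fun _ hu => l2Form_self_pos hT (by simpa using hu)) b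

theorem dotProduct_stiffnessMatrix {β : E d → E d} {c : E d → ℝ} (hT : T.Triangulates Ω)
    (hβ : ContinuousOn β (closure Ω)) (hβL : MemLp β ∞ (volume.restrict Ω))
    (hc : MemLp c ∞ (volume.restrict Ω)) (ε : ℝ) (b : Module.Basis ι ℝ (T.feSpace Ω k))
    (x : ι → ℝ) : x ⬝ᵥ stiffnessMatrix β c ε b *ᵥ x =
      lsForm Ω β c ε T (b.equivFun.symm x : T.Piecewise) (b.equivFun.symm x : T.Piecewise) :=
  dotProduct_gram_mulVec (restrictForm (lsBilin hT hβ hβL hc ε)) b x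

theorem posDef_stiffnessMatrix {β : E d → E d} {c : E d → ℝ} (hT : T.Triangulates Ω)
    (hβ : ContinuousOn β (closure Ω)) (hβL : MemLp β ∞ (volume.restrict Ω))
    (hc : MemLp c ∞ (volume.restrict Ω)) {ε : ℝ} (b : Module.Basis ι ℝ (T.feSpace Ω k))
    (hp : ∀ u ∈ T.feSpace Ω k, u ≠ 0 → 0 < lsForm Ω β c ε T u u) :
    (stiffnessMatrix β c ε b).PosDef :=
  posDef_gram (restrictForm (lsBilin hT hβ hβL hc ε)) (fun _ _ => lsForm_comm _ _ _ _ _)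
    (fun u hu => hp u u.2 (by simpa using hu)) b

end Gram

/-! ### The reference simplex -/

section Reference

variable {d : ℕ} (K : Affine.Simplex ℝ (E d) d)

/-- The open reference simplex. -/
def refSimplex (d : ℕ) : Set (E d) := {y | (∀ i, 0 < y i) ∧ ∑ i, y i < 1}

theorem isOpen_refSimplex : IsOpen (refSimplex d) := by
  have h1 : IsOpen {y : E d | ∀ i, 0 < y i} := by
    simp only [Set.ofPred_forall]
    exact isOpen_iInter_of_finite fun i => isOpen_lt continuous_const
      (EuclideanSpace.proj (𝕜 := ℝ) i : E d →L[ℝ] ℝ).continuous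
  exact h1.inter (isOpen_lt (continuous_finsetSum _ fun i _ =>
    (EuclideanSpace.proj (𝕜 := ℝ) i : E d →L[ℝ] ℝ).continuous) continuous_const)

theorem refSimplex_nonempty : (refSimplex d).Nonempty := by
  refine ⟨WithLp.toLp 2 fun _ => ((d : ℝ) + 1)⁻¹, fun i => by positivity, ?_⟩
  simp only [Finset.sum_const, Finset.card_univ, Fintype.card_fin, nsmul_eq_mul]
  rw [← div_eq_mul_inv, div_lt_one (by positivity)]
  linarith

theorem isBounded_refSimplex : Bornology.IsBounded (refSimplex d) := by
  refine (Metric.isBounded_closedBall (x := (0 : E d)) (r := √d)).subset fun y hy => ?_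
  rw [mem_closedBall_zero_iff]
  refine Real.le_sqrt_of_sq_le ?_
  rw [EuclideanSpace.real_norm_sq_eq]
  calc ∑ i, y i ^ 2 ≤ ∑ _i : Fin d, (1 : ℝ) := by
        refine Finset.sum_le_sum fun i _ => ?_
        have h1 : y i ≤ ∑ j, y j :=
          Finset.single_le_sum (f := fun j => y j) (fun j _ => (hy.1 j).le) (Finset.mem_univ i)
        have := hy.1 i
        have := hy.2
        nlinarith
    _ = d := by simp

/-- The linear part of the reference map, as a linear map. -/
def refLinearMap : E d →ₗ[ℝ] E d where
  toFun := refLinear K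
  map_add' x y := by simp [refLinear, add_smul, Finset.sum_add_distrib]
  map_smul' a x := by simp [refLinear, mul_smul, Finset.smul_sum]

/-- The Cartesian coordinates on the reference simplex are the barycentric coordinates of the
vertices other than the first. Injectivity and the image of the reference map follow from this. -/
theorem bary_linear_refLinear (v : E d) (i : Fin d) :
    (bary K i.succ).linear (refLinear K v) = v i := by
  have h : ∀ j : Fin d, (bary K i.succ).linear (K.points j.succ - K.points 0) =
      if i = j then 1 else 0 := fun j => by
    rw [← vsub_eq_sub, AffineMap.linearMap_vsub, bary_points, bary_points]
    simp [Fin.succ_inj]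
  simp only [refLinear, map_sum, map_smul, h]
  simp

theorem bary_refMap_succ (y : E d) (i : Fin d) : bary K i.succ (refMap K y) = y i := by
  rw [refMap, add_comm, ← vadd_eq_add, AffineMap.map_vadd, bary_linear_refLinear, bary_points]
  simp

theorem bary_refMap_zero (y : E d) : bary K 0 (refMap K y) = 1 - ∑ i, y i := by
  have h := sum_bary K (refMap K y)
  rw [Fin.sum_univ_succ] at h
  simp only [bary_refMap_succ] at h
  linarith

theorem refLinearMap_injective : Function.Injective (refLinearMap K) := by
  intro v w h
  ext i
  rw [← bary_linear_refLinear K v i, ← bary_linear_refLinear K w i]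
  exact congrArg _ h

theorem refMap_injective : Function.Injective (refMap K) := fun _ _ h =>
  refLinearMap_injective K (add_left_cancel h)

theorem refMap_image [NeZero d] : refMap K '' refSimplex d = K.interior := by
  ext x
  constructor
  · rintro ⟨y, hy, rfl⟩
    rw [mem_interior_iff]
    intro i
    refine Fin.cases ?_ (fun j => ?_) i
    · rw [bary_refMap_zero]; linarith [hy.2]
    · rw [bary_refMap_succ]; exact hy.1 j
  · intro hx
    obtain ⟨y, hy⟩ := (LinearMap.injective_iff_surjective.1 (refLinearMap_injective K))
      (x - K.points 0)
    have hyx : refMap K y = x := by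
      change K.points 0 + refLinearMap K y = x
      rw [hy]; abel
    rw [mem_interior_iff] at hx
    refine ⟨y, ⟨fun i => ?_, ?_⟩, hyx⟩
    · rw [← bary_refMap_succ K, hyx]; exact hx _
    · have := hx 0
      rw [← hyx, bary_refMap_zero] at this
      linarith

/-- The absolute value of the Jacobian determinant of the reference map. -/
def refJacobian : ℝ := |(LinearMap.toContinuousLinearMap (refLinearMap K)).det|

theorem hasFDerivAt_refMap (y : E d) :
    HasFDerivAt (refMap K) (LinearMap.toContinuousLinearMap (refLinearMap K)) y :=
  (LinearMap.toContinuousLinearMap (refLinearMap K)).hasFDerivAt.const_add _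

theorem setIntegral_interior_eq [NeZero d] (f : E d → ℝ) :
    ∫ x in K.interior, f x = refJacobian K * ∫ y in refSimplex d, f (refMap K y) := by
  rw [← refMap_image, integral_image_eq_integral_abs_det_fderiv_smul volume
    isOpen_refSimplex.measurableSet (fun y _ => (hasFDerivAt_refMap K y).hasFDerivWithinAt)
    (refMap_injective K).injOn]
  simp only [smul_eq_mul, integral_const_mul]
  rfl

theorem volume_interior_eq [NeZero d] : volume.real K.interior = volume.real K.closedInterior := by
  refine measureReal_congr (Filter.EventuallyLE.antisymm
    K.interior_subset_closedInterior.eventuallyLE ?_)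
  exact ae_le_set.2 (volume_closedInterior_diff_interior K)

theorem refJacobian_eq [NeZero d] :
    refJacobian K * volume.real (refSimplex d) = volume.real K.closedInterior := by
  have := setIntegral_interior_eq K fun _ => (1 : ℝ)
  simp only [integral_const, smul_eq_mul, mul_one, measureReal_restrict_apply_univ] at this
  rw [← this, volume_interior_eq]

theorem volume_refSimplex_pos : 0 < volume.real (refSimplex d) :=
  ENNReal.toReal_pos (isOpen_refSimplex.measure_pos volume refSimplex_nonempty).ne'
    isBounded_refSimplex.measure_lt_top.ne

/-- The columns of the linear part are edges of the cell. -/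
theorem norm_refLinear_sq_le (v : E d) :
    ‖refLinear K v‖ ^ 2 ≤ d * Metric.diam K.closedInterior ^ 2 * ‖v‖ ^ 2 := by
  have h1 : ‖refLinear K v‖ ≤ ∑ i, |v i| * Metric.diam K.closedInterior := by
    refine (norm_sum_le _ _).trans (Finset.sum_le_sum fun i _ => ?_)
    rw [norm_smul, Real.norm_eq_abs, ← dist_eq_norm]
    refine mul_le_mul_of_nonneg_left (Metric.dist_le_diam_of_mem
      (isCompact_closedInterior K).isBounded ?_ ?_) (abs_nonneg _) <;>
    · exact K.point_mem_closedInterior _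
  rw [← Finset.sum_mul] at h1
  have h2 : (∑ i, |v i|) ^ 2 ≤ d * ‖v‖ ^ 2 := by
    have := sq_sum_le_card_mul_sum_sq (s := Finset.univ) (f := fun i : Fin d => |v i|)
    rw [EuclideanSpace.real_norm_sq_eq]
    simpa using this
  calc _ ≤ ((∑ i, |v i|) * Metric.diam K.closedInterior) ^ 2 :=
        pow_le_pow_left₀ (norm_nonneg _) h1 2
    _ = (∑ i, |v i|) ^ 2 * Metric.diam K.closedInterior ^ 2 := by ring
    _ ≤ d * ‖v‖ ^ 2 * Metric.diam K.closedInterior ^ 2 := by gcongr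
    _ = _ := by ring

/-- A step of length `r / 2` in the direction of `refLinear K v` stays in the cell, where
barycentric coordinates vary by at most one. As they change at the rate `v i`, each `|v i|` is
bounded. -/
theorem le_norm_refLinear_sq {x : E d} {r : ℝ} (hr : 0 < r)
    (hball : Metric.ball x r ⊆ K.closedInterior) (v : E d) :
    r ^ 2 * ‖v‖ ^ 2 ≤ 4 * d * ‖refLinear K v‖ ^ 2 := by
  have hb : ∀ i z, z ∈ K.closedInterior → 0 ≤ bary K i z ∧ bary K i z ≤ 1 := by
    intro i z hz
    rw [mem_closedInterior_iff] at hz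
    refine ⟨hz i, ?_⟩
    rw [← sum_bary K z]
    exact Finset.single_le_sum (f := fun j => bary K j z) (fun j _ => hz j) (Finset.mem_univ i)
  have hi : ∀ i, r * |v i| ≤ 2 * ‖refLinear K v‖ := by
    intro i
    set e := refLinear K v with he
    have hv : (bary K i.succ).linear e = v i := bary_linear_refLinear K v i
    rcases (norm_nonneg e).eq_or_lt with h0 | h0
    · rw [eq_comm, norm_eq_zero] at h0
      rw [← hv, h0]; simp
    · set t := r / 2 / ‖e‖ with ht
      have ht0 : 0 < t := by positivity
      have hx := hb i.succ x (hball (Metric.mem_ball_self hr))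
      have hy := hb i.succ (t • e +ᵥ x) (hball (by
        rw [vadd_eq_add, Metric.mem_ball, dist_eq_norm, add_sub_cancel_right, norm_smul,
          Real.norm_of_nonneg ht0.le, ht, div_mul_cancel₀ _ h0.ne']
        linarith))
      rw [AffineMap.map_vadd, map_smul, hv, vadd_eq_add, smul_eq_mul] at hy
      have h1 : t * |v i| ≤ 1 := by
        rw [← abs_of_pos ht0, ← abs_mul, abs_le]
        constructor <;> linarith [hx.1, hx.2, hy.1, hy.2]
      have h2 : t * ‖e‖ = r / 2 := by rw [ht, div_mul_cancel₀ _ h0.ne']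
      have h3 : t * |v i| * ‖e‖ ≤ 1 * ‖e‖ := mul_le_mul_of_nonneg_right h1 h0.le
      have h4 : t * |v i| * ‖e‖ = r / 2 * |v i| := by rw [← h2]; ring
      linarith
  rw [EuclideanSpace.real_norm_sq_eq, Finset.mul_sum]
  calc _ ≤ ∑ _i : Fin d, (2 * ‖refLinear K v‖) ^ 2 := by
        refine Finset.sum_le_sum fun i _ => ?_
        rw [← sq_abs (v i), ← mul_pow]
        exact pow_le_pow_left₀ (by positivity) (hi i) 2
    _ = _ := by simp; ring

theorem integrableOn_refSimplex {f : E d → ℝ} (hf : Continuous f) :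
    IntegrableOn f (refSimplex d) :=
  (hf.continuousOn.integrableOn_compact isBounded_refSimplex.isCompact_closure).mono_set
    subset_closure

end Reference

/-! ### Gram matrices of shape functions -/

section Shape

variable {d n : ℕ} {J : Type} [Fintype J]

/-- The combination of shape functions with coefficients `z`, evaluated at `y`. -/
def shapeSum (P : Fin n → J → Poly d) (z : Fin n → ℝ) (j : J) (y : E d) : ℝ :=
  ∑ a, z a * Poly.val (P a j) y

theorem shapeSum_eq_val (P : Fin n → J → Poly d) (z : Fin n → ℝ) (j : J) (y : E d) :
    shapeSum P z j y = Poly.val (∑ a, z a • P a j) y := by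
  simp [shapeSum, Poly.val, MvPolynomial.smul_eval]

theorem continuous_shapeSum (P : Fin n → J → Poly d) (z : Fin n → ℝ) (j : J) :
    Continuous (shapeSum P z j) :=
  continuous_finsetSum _ fun _ _ => continuous_const.mul (Poly.continuous_val _)

theorem integrableOn_shapeSum_mul (P : Fin n → J → Poly d) (z w : Fin n → ℝ) (j : J) :
    IntegrableOn (fun y => shapeSum P z j y * shapeSum P w j y) (refSimplex d) :=
  integrableOn_refSimplex ((continuous_shapeSum P z j).mul (continuous_shapeSum P w j))

/-- The `L²` form of the reference simplex on the coefficients of shape functions. -/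
def shapeForm (P : Fin n → J → Poly d) : (Fin n → ℝ) →ₗ[ℝ] (Fin n → ℝ) →ₗ[ℝ] ℝ :=
  LinearMap.mk₂ ℝ
    (fun z w => ∑ j, ∫ y in refSimplex d, shapeSum P z j y * shapeSum P w j y)
    (fun z z' w => by
      rw [← Finset.sum_add_distrib]
      refine Finset.sum_congr rfl fun j _ => ?_
      rw [← integral_add
        (integrableOn_shapeSum_mul P z w j)
        (integrableOn_shapeSum_mul P z' w j)]
      simp only [shapeSum, Pi.add_apply, add_mul, Finset.sum_add_distrib])
    (fun r z w => by
      rw [smul_eq_mul, Finset.mul_sum]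
      refine Finset.sum_congr rfl fun j _ => ?_
      rw [← integral_const_mul]
      simp only [shapeSum, Pi.smul_apply, smul_eq_mul, mul_assoc, Finset.mul_sum, Finset.sum_mul])
    (fun z w w' => by
      rw [← Finset.sum_add_distrib]
      refine Finset.sum_congr rfl fun j _ => ?_
      rw [← integral_add
        (integrableOn_shapeSum_mul P z w j)
        (integrableOn_shapeSum_mul P z w' j)]
      simp only [shapeSum, Pi.add_apply, add_mul, mul_add, Finset.sum_add_distrib])
    (fun r z w => by
      rw [smul_eq_mul, Finset.mul_sum]
      refine Finset.sum_congr rfl fun j _ => ?_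
      rw [← integral_const_mul]
      refine integral_congr_ae (Filter.Eventually.of_forall fun y => ?_)
      simp only [shapeSum, Pi.smul_apply, smul_eq_mul, mul_assoc, ← Finset.mul_sum]
      ring)

theorem shapeForm_self (P : Fin n → J → Poly d) (z : Fin n → ℝ) :
    shapeForm P z z = ∑ j, ∫ y in refSimplex d, shapeSum P z j y ^ 2 := by
  simp only [pow_two]; rfl

/-- Independence as polynomials suffices, since a nonzero polynomial does not vanish on the open
reference simplex. -/
theorem shapeForm_self_pos {P : Fin n → J → Poly d} (hP : LinearIndependent ℝ P) {z : Fin n → ℝ}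
    (hz : z ≠ 0) : 0 < shapeForm P z z := by
  have hne : ∑ a, z a • P a ≠ 0 := fun h0 =>
    hz (funext (Fintype.linearIndependent_iff.1 hP z h0))
  obtain ⟨j, hj⟩ := Function.ne_iff.1 hne
  rw [shapeForm_self]
  refine Finset.sum_pos' (fun j _ => integral_nonneg fun _ => sq_nonneg _) ⟨j, Finset.mem_univ j, ?_⟩
  simp only [shapeSum_eq_val, pow_two]
  refine integral_sq_pos_of_ne_zero ?_ isOpen_refSimplex refSimplex_nonempty
    (integrableOn_refSimplex ((Poly.continuous_val _).mul (Poly.continuous_val _)))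
  simpa using hj

/-- Linearly independent shape functions are a stable basis on the reference simplex. -/
theorem exists_shapeForm_bounds {P : Fin n → J → Poly d} (hP : LinearIndependent ℝ P) :
    ∃ C, 1 ≤ C ∧ ∀ z : Fin n → ℝ, ∑ a, z a ^ 2 ≤ C * shapeForm P z z ∧
      shapeForm P z z ≤ C * ∑ a, z a ^ 2 := by
  obtain ⟨C₁, hC₁, h₁⟩ := exists_norm_sq_le_of_posDef (shapeForm P)
    (fun z w => by
      change ∑ j, ∫ y in refSimplex d, shapeSum P z j y * shapeSum P w j y =
        ∑ j, ∫ y in refSimplex d, shapeSum P w j y * shapeSum P z j y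
      simp only [mul_comm])
    (fun z hz => shapeForm_self_pos hP hz) (WithLp.linearEquiv 2 ℝ (Fin n → ℝ)).symm.toLinearMap
  set C₂ : ℝ := ∑ j, ∫ y in refSimplex d, ∑ a, Poly.val (P a j) y ^ 2 with hC₂
  have hC₂0 : 0 ≤ C₂ := Finset.sum_nonneg fun j _ =>
    integral_nonneg fun y => Finset.sum_nonneg fun _ _ => sq_nonneg _
  have h0 : ∀ z, 0 ≤ shapeForm P z z := fun z => by
    rw [shapeForm_self]
    exact Finset.sum_nonneg fun j _ => integral_nonneg fun y => sq_nonneg _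
  refine ⟨1 + C₁ + C₂, by linarith, fun z => ⟨?_, ?_⟩⟩
  · have h := h₁ z
    rw [EuclideanSpace.real_norm_sq_eq] at h
    calc _ ≤ C₁ * shapeForm P z z := h
      _ ≤ _ := mul_le_mul_of_nonneg_right (by linarith) (h0 z)
  · have hz : 0 ≤ ∑ a, z a ^ 2 := Finset.sum_nonneg fun _ _ => sq_nonneg _
    calc shapeForm P z z ≤ C₂ * ∑ a, z a ^ 2 := by
          rw [shapeForm_self, hC₂, Finset.sum_mul]
          refine Finset.sum_le_sum fun j _ => ?_
          rw [← integral_mul_const]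
          refine integral_mono (integrableOn_refSimplex ((continuous_shapeSum P z j).pow 2))
            ((integrableOn_refSimplex (continuous_finsetSum _ fun a _ =>
              (Poly.continuous_val (P a j)).pow 2)).mul_const _) fun y => ?_
          have := Finset.sum_mul_sq_le_sq_mul_sq Finset.univ z fun a => Poly.val (P a j) y
          simp only [shapeSum]
          rw [mul_comm]
          exact this
      _ ≤ _ := mul_le_mul_of_nonneg_right (by linarith) hz

end Shape

/-! ### The number of cells at a vertex -/

section Counting

variable {d : ℕ} [NeZero d] {T : Mesh d}

/-- The cells at `v` are disjoint up to null sets, have volume at least `h ^ d / C`, and all lie in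
the ball of radius `C * h` around `v`. -/
theorem MeshBounds.card_le {m : ℕ} {C : ℝ} (hM : MeshBounds T m C) (hC : 0 ≤ C) (v : E d)
    (s : Finset T.cells) (hs : ∀ K ∈ s, v ∈ Set.range K.1.points) :
    (s.card : ℝ) ≤ C ^ (d + 1) * volume.real (Metric.closedBall (0 : E d) 1) := by
  have hh := hM.h_pos
  have hsub : ∀ K ∈ s, K.1.interior ⊆ Metric.closedBall v (C * T.h) := by
    intro K hK x hx
    obtain ⟨i, hi⟩ := hs K hK
    refine (Metric.dist_le_diam_of_mem (isCompact_closedInterior K.1).isBounded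
      (K.1.interior_subset_closedInterior hx) ?_).trans (hM.diam_le K.1 K.2)
    rw [← hi]
    exact K.1.point_mem_closedInterior i
  have h1 : ∑ K ∈ s, volume.real K.1.interior ≤ volume.real (Metric.closedBall v (C * T.h)) := by
    have hdisj : (s : Set T.cells).PairwiseDisjoint fun K : T.cells => K.1.interior :=
      fun K _ K' _ hne => Mesh.pairwise_disjoint_interior (T := T) hne
    have hmeas : ∀ K ∈ s, MeasurableSet K.1.interior := fun K _ =>
      (isOpen_interior K.1).measurableSet
    have hfin : ∀ K ∈ s, volume K.1.interior ≠ ∞ := fun K _ =>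
      ((isCompact_closedInterior K.1).isBounded.subset
        K.1.interior_subset_closedInterior).measure_lt_top.ne
    rw [← measureReal_biUnion_finset hdisj hmeas hfin]
    exact measureReal_mono (Set.iUnion₂_subset hsub) measure_closedBall_lt_top.ne
  have h2 : volume.real (Metric.closedBall v (C * T.h)) =
      (C * T.h) ^ d * volume.real (Metric.closedBall (0 : E d) 1) := by
    rw [Measure.real, Measure.addHaar_closedBall' _ _ (by positivity), ENNReal.toReal_mul,
      ENNReal.toReal_ofReal (by positivity)]
    simp [Measure.real]
  have h3 : s.card * T.h ^ d ≤ C * ∑ K ∈ s, volume.real K.1.interior := by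
    rw [Finset.mul_sum, ← nsmul_eq_mul, ← Finset.sum_const]
    refine Finset.sum_le_sum fun K _ => ?_
    rw [volume_interior_eq]
    exact hM.le_volume K.1 K.2
  refine le_of_mul_le_mul_right ?_ (pow_pos hh d)
  calc _ ≤ C * ((C * T.h) ^ d * volume.real (Metric.closedBall (0 : E d) 1)) :=
        h3.trans (mul_le_mul_of_nonneg_left (h1.trans_eq h2) hC)
    _ = _ := by rw [mul_pow]; ring

end Counting

/-! ### Mass matrices of assembled bases -/

section Assembled

open Matrix

variable {d : ℕ} [NeZero d] {T : Mesh d} {Ω : Set (E d)}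

theorem sum_smul_refLinear {n : ℕ} (K : Affine.Simplex ℝ (E d) d) (S : Fin n → Fin d → Poly d)
    (z : Fin n → ℝ) (y : E d) :
    ∑ a, z a • refLinear K (vecVal (S a) y) =
      refLinear K (WithLp.toLp 2 fun j => shapeSum S z j y) := by
  have h : (WithLp.toLp 2 fun j => shapeSum S z j y : E d) = ∑ a, z a • vecVal (S a) y := by
    ext j
    simp [shapeSum, vecVal]
  rw [h]
  change _ = refLinearMap K _
  simp only [map_sum, map_smul]
  rfl

/-- On a cell, the `L²` norm of a combination of assembled functions is equivalent to the scaled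
norm of its coefficients. -/
theorem exists_cell_bounds {n m m' : ℕ} {S : Fin n → Fin d → Poly d} {R : Fin m → Poly d}
    (hS : LinearIndependent ℝ S) (hR : LinearIndependent ℝ R) {τ C : ℝ} (hτ : 0 < τ)
    (hC : 1 ≤ C) :
    ∃ C₂, 0 < C₂ ∧ ∀ (T : Mesh d), MeshBounds T m' C → ∀ (K : T.cells) (u : T.Piecewise)
      (x t : Fin n → ℝ) (y : Fin m → ℝ), (∀ a, τ⁻¹ ≤ T.h * |t a| ∧ T.h * |t a| ≤ τ) →
      (∀ z, vecVal (u.1 K) (refMap K.1 z) =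
        ∑ a, (x a * t a) • refLinear K.1 (vecVal (S a) z)) →
      (∀ z, Poly.val (u.2 K) (refMap K.1 z) = ∑ a, y a * Poly.val (R a) z) →
      T.h ^ d * (∑ a, x a ^ 2 + ∑ a, y a ^ 2) ≤ C₂ * (vecNormSq u K + scalNormSq u K) ∧
      vecNormSq u K + scalNormSq u K ≤ C₂ * (T.h ^ d * (∑ a, x a ^ 2 + ∑ a, y a ^ 2)) := by
  -- Scalar shape functions are treated as fields with one component.
  have hR' : LinearIndependent ℝ fun a (_ : Unit) => R a :=
    hR.map' (LinearEquiv.funUnique Unit ℝ (Poly d)).symm.toLinearMap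
      (LinearEquiv.funUnique Unit ℝ (Poly d)).symm.ker
  obtain ⟨A, hA, hAb⟩ := exists_shapeForm_bounds hS
  obtain ⟨B, hB, hBb⟩ := exists_shapeForm_bounds hR'
  set V := volume.real (refSimplex d) with hV
  have hV0 : 0 < V := volume_refSimplex_pos
  have hC0 : 0 < C := by linarith
  have hA0 : 0 < A := by linarith
  have hB0 : 0 < B := by linarith
  set c₁ : ℝ := C * V * τ ^ 2 * A * (4 * d * C ^ 2) with hc₁
  set c₂ : ℝ := C * V * B with hc₂
  set c₃ : ℝ := C / V * (d * C ^ 2 * A * τ ^ 2) with hc₃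
  set c₄ : ℝ := C / V * B with hc₄
  have p1 : 0 ≤ c₁ := by positivity
  have p2 : 0 < c₂ := by positivity
  have p3 : 0 ≤ c₃ := by positivity
  have p4 : 0 < c₄ := by positivity
  refine ⟨c₁ + c₂ + c₃ + c₄, by positivity, fun T hM K u x t y ht hvec hscal => ?_⟩
  have hh := hM.h_pos
  set j := refJacobian K.1 with hj
  have hj0 : 0 ≤ j := abs_nonneg _
  have hjV : j * V = volume.real K.1.closedInterior := refJacobian_eq K.1
  have hj1 : T.h ^ d ≤ C * (j * V) := by rw [hjV]; exact hM.le_volume K.1 K.2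
  have hj2 : j ≤ C / V * T.h ^ d := by
    rw [div_mul_eq_mul_div, le_div_iff₀ hV0, hjV]
    exact hM.volume_le K.1 K.2
  -- The coefficients with the scalars `t` included. Since `|t|` is of the order of `h⁻¹` and the
  -- linear part of the reference map of the order of `h`, the two scalings cancel; the Jacobian
  -- contributes `h ^ d`.
  set z : Fin n → ℝ := fun a => x a * t a with hz
  set W : E d → E d := fun s => WithLp.toLp 2 fun i => shapeSum S z i s with hW
  have hWsq : ∀ s, ‖W s‖ ^ 2 = ∑ i, shapeSum S z i s ^ 2 := fun s => by
    rw [EuclideanSpace.real_norm_sq_eq]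
  have hWi : ∀ i ∈ (Finset.univ : Finset (Fin d)),
      IntegrableOn (fun s => shapeSum S z i s ^ 2) (refSimplex d) := fun i _ =>
    integrableOn_refSimplex ((continuous_shapeSum S z i).pow 2)
  have hWint : IntegrableOn (fun s => ‖W s‖ ^ 2) (refSimplex d) := by
    simp only [hWsq]
    exact integrable_finsetSum _ hWi
  have hWform : ∫ s in refSimplex d, ‖W s‖ ^ 2 = shapeForm S z z := by
    simp only [hWsq]
    rw [shapeForm_self, integral_finsetSum _ hWi]
  have hLW : ∀ s, vecVal (u.1 K) (refMap K.1 s) = refLinear K.1 (W s) := fun s => by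
    rw [hvec s, hW, ← sum_smul_refLinear]
  have hLint : IntegrableOn (fun s => ‖refLinear K.1 (W s)‖ ^ 2) (refSimplex d) := by
    simp only [← hLW]
    refine integrableOn_refSimplex (((continuous_vecVal _).comp ?_).norm.pow 2)
    exact continuous_iff_continuousAt.2 fun s => (hasFDerivAt_refMap K.1 s).continuousAt
  have hvN : vecNormSq u K = j * ∫ s in refSimplex d, ‖refLinear K.1 (W s)‖ ^ 2 := by
    rw [vecNormSq_eq, setIntegral_interior_eq]
    simp only [hLW]
    rfl
  have hsN : scalNormSq u K = j * shapeForm (fun a (_ : Unit) => R a) y y := by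
    rw [scalNormSq, setIntegral_interior_eq, shapeForm_self]
    simp only [hscal, Finset.univ_unique, Finset.sum_singleton]
    rfl
  set I := ∫ s in refSimplex d, ‖refLinear K.1 (W s)‖ ^ 2 with hI
  have hI0 : 0 ≤ I := integral_nonneg fun _ => sq_nonneg _
  have hup : I ≤ d * (C * T.h) ^ 2 * shapeForm S z z := by
    rw [← hWform, ← integral_const_mul]
    refine integral_mono hLint (hWint.const_mul _) fun s => ?_
    refine (norm_refLinear_sq_le K.1 (W s)).trans ?_
    have := hM.diam_le K.1 K.2
    have h0 : 0 ≤ Metric.diam K.1.closedInterior := Metric.diam_nonneg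
    gcongr
  have hlo : T.h ^ 2 * shapeForm S z z ≤ 4 * d * C ^ 2 * I := by
    obtain ⟨p, r, hr, hhr, hball⟩ := hM.ball_subset K.1 K.2
    rw [← hWform, hI, ← integral_const_mul, ← integral_const_mul]
    refine integral_mono (hWint.const_mul _) (hLint.const_mul _) fun s => ?_
    have h1 := le_norm_refLinear_sq K.1 hr hball (W s)
    calc T.h ^ 2 * ‖W s‖ ^ 2 ≤ (C * r) ^ 2 * ‖W s‖ ^ 2 := by gcongr
      _ = C ^ 2 * (r ^ 2 * ‖W s‖ ^ 2) := by ring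
      _ ≤ C ^ 2 * (4 * d * ‖refLinear K.1 (W s)‖ ^ 2) := by gcongr
      _ = _ := by ring
  have hz1 : ∑ a, x a ^ 2 ≤ τ ^ 2 * (T.h ^ 2 * ∑ a, z a ^ 2) := by
    rw [Finset.mul_sum, Finset.mul_sum]
    refine Finset.sum_le_sum fun a _ => ?_
    have h1 : 1 ≤ τ * (T.h * |t a|) := by
      have := mul_le_mul_of_nonneg_left (ht a).1 hτ.le
      rwa [mul_inv_cancel₀ hτ.ne'] at this
    have h2 : 1 ≤ (τ * (T.h * |t a|)) ^ 2 := one_le_pow₀ h1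
    calc x a ^ 2 ≤ (τ * (T.h * |t a|)) ^ 2 * x a ^ 2 := le_mul_of_one_le_left (sq_nonneg _) h2
      _ = τ ^ 2 * (T.h ^ 2 * (x a ^ 2 * |t a| ^ 2)) := by ring
      _ = _ := by rw [sq_abs, hz]; ring
  have hz2 : T.h ^ 2 * ∑ a, z a ^ 2 ≤ τ ^ 2 * ∑ a, x a ^ 2 := by
    rw [Finset.mul_sum, Finset.mul_sum]
    refine Finset.sum_le_sum fun a _ => ?_
    calc T.h ^ 2 * z a ^ 2 = (T.h * |t a|) ^ 2 * x a ^ 2 := by rw [mul_pow T.h, sq_abs, hz]; ring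
      _ ≤ τ ^ 2 * x a ^ 2 := mul_le_mul_of_nonneg_right
          (pow_le_pow_left₀ (by positivity) (ht a).2 2) (sq_nonneg _)
  have hx0 : 0 ≤ ∑ a, x a ^ 2 := Finset.sum_nonneg fun _ _ => sq_nonneg _
  have hy0 : 0 ≤ ∑ a, y a ^ 2 := Finset.sum_nonneg fun _ _ => sq_nonneg _
  have hv0 := vecNormSq_nonneg u K
  have hs0 := scalNormSq_nonneg u K
  have b1 : T.h ^ d * ∑ a, x a ^ 2 ≤ c₁ * vecNormSq u K := by
    calc _ ≤ C * (j * V) * (τ ^ 2 * (T.h ^ 2 * ∑ a, z a ^ 2)) :=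
          mul_le_mul hj1 hz1 hx0 (by positivity)
      _ ≤ C * (j * V) * (τ ^ 2 * (T.h ^ 2 * (A * shapeForm S z z))) := by
          gcongr; exact (hAb z).1
      _ = C * (j * V) * τ ^ 2 * A * (T.h ^ 2 * shapeForm S z z) := by ring
      _ ≤ C * (j * V) * τ ^ 2 * A * (4 * d * C ^ 2 * I) := by gcongr
      _ = _ := by rw [hvN, hc₁]; ring
  have b2 : T.h ^ d * ∑ a, y a ^ 2 ≤ c₂ * scalNormSq u K := by
    calc _ ≤ C * (j * V) * (B * shapeForm (fun a (_ : Unit) => R a) y y) :=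
          mul_le_mul hj1 (hBb y).1 hy0 (by positivity)
      _ = _ := by rw [hsN, hc₂]; ring
  have b3 : vecNormSq u K ≤ c₃ * (T.h ^ d * ∑ a, x a ^ 2) := by
    calc _ ≤ C / V * T.h ^ d * (d * (C * T.h) ^ 2 * shapeForm S z z) := by
          rw [hvN]; exact mul_le_mul hj2 hup hI0 (by positivity)
      _ ≤ C / V * T.h ^ d * (d * (C * T.h) ^ 2 * (A * ∑ a, z a ^ 2)) := by
          gcongr; exact (hAb z).2
      _ = C / V * T.h ^ d * (d * C ^ 2 * A) * (T.h ^ 2 * ∑ a, z a ^ 2) := by ring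
      _ ≤ C / V * T.h ^ d * (d * C ^ 2 * A) * (τ ^ 2 * ∑ a, x a ^ 2) := by gcongr
      _ = _ := by rw [hc₃]; ring
  have b4 : scalNormSq u K ≤ c₄ * (T.h ^ d * ∑ a, y a ^ 2) := by
    have h0 : 0 ≤ shapeForm (fun a (_ : Unit) => R a) y y := by
      rw [shapeForm_self]
      exact Finset.sum_nonneg fun _ _ => integral_nonneg fun _ => sq_nonneg _
    calc _ ≤ C / V * T.h ^ d * (B * ∑ a, y a ^ 2) := by
          rw [hsN]; exact mul_le_mul hj2 (hBb y).2 h0 (by positivity)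
      _ = _ := by rw [hc₄]; ring
  have hd0 : 0 ≤ T.h ^ d := by positivity
  constructor
  · calc _ ≤ c₁ * vecNormSq u K + c₂ * scalNormSq u K := by rw [mul_add]; exact add_le_add b1 b2
      _ ≤ (c₁ + c₂ + c₃ + c₄) * vecNormSq u K + (c₁ + c₂ + c₃ + c₄) * scalNormSq u K := by
          gcongr <;> linarith
      _ = _ := by ring
  · calc _ ≤ c₃ * (T.h ^ d * ∑ a, x a ^ 2) + c₄ * (T.h ^ d * ∑ a, y a ^ 2) := add_le_add b3 b4
      _ ≤ (c₁ + c₂ + c₃ + c₄) * (T.h ^ d * ∑ a, x a ^ 2) +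
          (c₁ + c₂ + c₃ + c₄) * (T.h ^ d * ∑ a, y a ^ 2) := by
          gcongr <;> linarith
      _ = _ := by ring

variable {k : ℕ} {ι : Type} [Fintype ι]

theorem vecVal_equivFun_symm (b : Module.Basis ι ℝ (T.feSpace Ω k)) (x : ι → ℝ) (K : T.cells)
    (p : E d) : vecVal ((b.equivFun.symm x : T.Piecewise).1 K) p =
      ∑ i, x i • vecVal ((b i : T.Piecewise).1 K) p := by
  rw [Module.Basis.equivFun_symm_apply]
  ext j
  simp [vecVal, Poly.val, Prod.fst_sum, MvPolynomial.smul_eval]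

theorem val_equivFun_symm (b : Module.Basis ι ℝ (T.feSpace Ω k)) (x : ι → ℝ) (K : T.cells)
    (p : E d) : Poly.val ((b.equivFun.symm x : T.Piecewise).2 K) p =
      ∑ i, x i * Poly.val ((b i : T.Piecewise).2 K) p := by
  rw [Module.Basis.equivFun_symm_apply]
  simp [Poly.val, Prod.snd_sum, MvPolynomial.smul_eval]

/-- The mass matrix of an assembled basis is equivalent to `h ^ d` times the identity. -/
theorem exists_mass_bounds {n m m' : ℕ} {S : Fin n → Fin d → Poly d} {R : Fin m → Poly d}
    (hS : LinearIndependent ℝ S) (hR : LinearIndependent ℝ R) {τ C : ℝ} (hτ : 0 < τ)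
    (hC : 1 ≤ C) (Ω : Set (E d)) (k : ℕ) :
    ∃ C₃, 0 < C₃ ∧ ∀ (T : Mesh d), T.Triangulates Ω → MeshBounds T m' C →
      ∀ (ι : Type) [Fintype ι] (b : Module.Basis ι ℝ (T.feSpace Ω k)), IsAssembledBasis S R τ b →
      ∀ x : ι → ℝ, T.h ^ d * (x ⬝ᵥ x) ≤ C₃ * (x ⬝ᵥ massMatrix b *ᵥ x) ∧
        x ⬝ᵥ massMatrix b *ᵥ x ≤ C₃ * (T.h ^ d * (x ⬝ᵥ x)) := by
  classical
  obtain ⟨C₂, hC₂, hcell⟩ := exists_cell_bounds (m' := m') hS hR hτ hC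
  set N : ℝ := C ^ (d + 1) * volume.real (Metric.closedBall (0 : E d) 1) with hN
  have hN0 : 0 ≤ N := by positivity
  refine ⟨C₂ * (1 + N), by positivity, fun T hT hM ι _ b hb x => ?_⟩
  obtain ⟨g, hg, hvec, hscal, hzero, hvert⟩ := hb
  choose hvec0 t ht1 ht2 hvec1 using hvec
  have hh := hM.h_pos
  set u : T.Piecewise := (b.equivFun.symm x : T.Piecewise) with hu
  have hloc : ∀ K : T.cells,
      T.h ^ d * (∑ a, x (g K a) ^ 2) ≤ C₂ * (vecNormSq u K + scalNormSq u K) ∧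
      vecNormSq u K + scalNormSq u K ≤ C₂ * (T.h ^ d * ∑ a, x (g K a) ^ 2) := by
    intro K
    rw [Fintype.sum_sum_type]
    refine hcell T hM K u (fun a => x (g K (Sum.inl a))) (t K) (fun a => x (g K (Sum.inr a)))
      (fun a => ⟨ht1 K a, ht2 K a⟩) (fun z => ?_) (fun z => ?_)
    · have hz0 : vecVal (0 : Fin d → Poly d) (refMap K.1 z) = 0 := by
        ext i; simp [vecVal, Poly.val]
      rw [hu, vecVal_equivFun_symm, ← Fintype.sum_of_injective (g K) (hg K)
        (fun a => x (g K a) • vecVal ((b (g K a) : T.Piecewise).1 K) (refMap K.1 z)) _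
        (fun i hi => by rw [(hzero K i hi).1, hz0, smul_zero]) (fun _ => rfl),
        Fintype.sum_sum_type]
      simp only [(hscal K _).1, hz0, smul_zero, Finset.sum_const_zero, add_zero, hvec1, smul_smul]
    · rw [hu, val_equivFun_symm, ← Fintype.sum_of_injective (g K) (hg K)
        (fun a => x (g K a) * Poly.val ((b (g K a) : T.Piecewise).2 K) (refMap K.1 z)) _
        (fun i hi => by rw [(hzero K i hi).2, Poly.val_zero, mul_zero]) (fun _ => rfl),
        Fintype.sum_sum_type]
      simp only [hvec0, Poly.val_zero, mul_zero, Finset.sum_const_zero, zero_add, (hscal K _).2]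
  -- The pairs of a cell and a local number that belong to one global index. Their number is the
  -- multiplicity with which a coefficient enters the sum over the cells.
  set fib : ι → Finset (T.cells × (Fin n ⊕ Fin m)) :=
    fun i => Finset.univ.filter fun p => g p.1 p.2 = i with hfib
  have hcount : ∑ K, ∑ a, x (g K a) ^ 2 = ∑ i, (fib i).card * x i ^ 2 := by
    rw [← Fintype.sum_prod_type' (f := fun K a => x (g K a) ^ 2),
      ← Finset.sum_fiberwise Finset.univ (fun p : T.cells × (Fin n ⊕ Fin m) => g p.1 p.2)]
    refine Finset.sum_congr rfl fun i _ => ?_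
    rw [Finset.sum_congr rfl (g := fun _ => x i ^ 2), Finset.sum_const, nsmul_eq_mul]
    intro p hp
    rw [(Finset.mem_filter.1 hp).2]
  -- A basis function numbered by no cell would vanish.
  have hone : ∀ i, 1 ≤ ((fib i).card : ℝ) := by
    intro i
    by_contra hlt
    have h0 : fib i = ∅ := by
      rw [← Finset.card_eq_zero]
      by_contra hne
      exact hlt (by exact_mod_cast Nat.one_le_iff_ne_zero.2 hne)
    have hnr : ∀ K, i ∉ Set.range (g K) := by
      rintro K ⟨a, ha⟩
      have : (K, a) ∈ fib i := Finset.mem_filter.2 ⟨Finset.mem_univ _, ha⟩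
      rw [h0] at this
      exact absurd this (Finset.notMem_empty _)
    refine b.ne_zero i (Subtype.ext (Prod.ext (funext fun K => ?_) (funext fun K => ?_)))
    · exact (hzero K i (hnr K)).1
    · exact (hzero K i (hnr K)).2
  -- The numbering of a cell is injective, so each cell occurs once, and the cells that number `i`
  -- share a vertex.
  have hmany : ∀ i, ((fib i).card : ℝ) ≤ N := by
    intro i
    obtain ⟨v, hv⟩ := hvert i
    have hinj : Set.InjOn Prod.fst (fib i : Set (T.cells × (Fin n ⊕ Fin m))) := by
      rintro ⟨K, a⟩ hp ⟨K', a'⟩ hp' (rfl : K = K')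
      have h1 : g K a = i := (Finset.mem_filter.1 hp).2
      have h2 : g K a' = i := (Finset.mem_filter.1 hp').2
      rw [hg K (h1.trans h2.symm)]
    rw [← Finset.card_image_of_injOn hinj]
    refine hM.card_le (by linarith) v _ fun K hK => ?_
    obtain ⟨p, hp, rfl⟩ := Finset.mem_image.1 hK
    exact hv p.1 ⟨p.2, (Finset.mem_filter.1 hp).2⟩
  have hxx : x ⬝ᵥ x = ∑ i, x i ^ 2 := by simp [dotProduct, pow_two]
  have hx0 : 0 ≤ x ⬝ᵥ x := by rw [hxx]; exact Finset.sum_nonneg fun _ _ => sq_nonneg _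
  have hd0 : 0 ≤ T.h ^ d := by positivity
  have hlo : x ⬝ᵥ x ≤ ∑ K, ∑ a, x (g K a) ^ 2 := by
    rw [hcount, hxx]
    exact Finset.sum_le_sum fun i _ => le_mul_of_one_le_left (sq_nonneg _) (hone i)
  have hup : ∑ K, ∑ a, x (g K a) ^ 2 ≤ N * (x ⬝ᵥ x) := by
    rw [hcount, hxx, Finset.mul_sum]
    exact Finset.sum_le_sum fun i _ => mul_le_mul_of_nonneg_right (hmany i) (sq_nonneg _)
  have hM0 : 0 ≤ ∑ K, (vecNormSq u K + scalNormSq u K) := Finset.sum_nonneg fun K _ =>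
    add_nonneg (vecNormSq_nonneg u K) (scalNormSq_nonneg u K)
  rw [dotProduct_massMatrix hT, ← hu, l2Form_self_eq_sum hT]
  constructor
  · calc _ ≤ T.h ^ d * ∑ K, ∑ a, x (g K a) ^ 2 := mul_le_mul_of_nonneg_left hlo hd0
      _ ≤ C₂ * ∑ K, (vecNormSq u K + scalNormSq u K) := by
          rw [Finset.mul_sum, Finset.mul_sum]
          exact Finset.sum_le_sum fun K _ => (hloc K).1
      _ ≤ _ := mul_le_mul_of_nonneg_right (by nlinarith) hM0
  · calc _ ≤ C₂ * (T.h ^ d * ∑ K, ∑ a, x (g K a) ^ 2) := by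
          rw [Finset.mul_sum, Finset.mul_sum]
          exact Finset.sum_le_sum fun K _ => (hloc K).2
      _ ≤ C₂ * (T.h ^ d * (N * (x ⬝ᵥ x))) := by gcongr
      _ = C₂ * N * (T.h ^ d * (x ⬝ᵥ x)) := by ring
      _ ≤ _ := mul_le_mul_of_nonneg_right (by nlinarith) (mul_nonneg hd0 hx0)

end Assembled

/-! ### The stiffness matrix -/

section Stiffness

open Matrix

variable {d : ℕ} [NeZero d] {Ω : Set (E d)}

/-- A bound of the mesh size by the domain alone, which lets surplus powers of `h` pass into
constants. -/
theorem Mesh.Triangulates.h_le {T : Mesh d} (hT : T.Triangulates Ω) (hne : T.cells.Nonempty) :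
    T.h ≤ volume.real Ω ^ ((d : ℝ)⁻¹) := by
  have : Nonempty T.cells := hne.to_subtype
  refine ciSup_le fun K => Real.rpow_le_rpow measureReal_nonneg ?_ (by positivity)
  rw [← volume_interior_eq]
  exact measureReal_mono (hT.interior_cell_subset K.2) hT.isBounded.measure_lt_top.ne

theorem Mesh.Triangulates.cells_nonempty {T : Mesh d} (hT : T.Triangulates Ω) (hΩ : Ω.Nonempty) :
    T.cells.Nonempty := by
  obtain ⟨x, hx⟩ := hΩ
  have := hT.closure_subset (subset_closure hx)
  simp only [Mesh.space, Set.mem_iUnion] at this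
  obtain ⟨K, hK, -⟩ := this
  exact ⟨K, hK⟩

/-- The stiffness matrix is positive definite, and equivalent to the mass matrix up to `h⁻²`. -/
theorem exists_stiffness_bounds (hd : 2 ≤ d) (hΩ : Ω.Nonempty) {β : E d → E d} {c : E d → ℝ}
    (hβc : IsAdmissible Ω β c) (k : ℕ) (σ ρ : ℝ) :
    ∃ C₀ C₁ C₂, 1 ≤ C₀ ∧ 0 < C₁ ∧ 0 < C₂ ∧ ∀ ε : ℝ, 0 < ε → ε ≤ 1 →
      ∀ T : Mesh d, T.Triangulates Ω → T.ShapeRegular σ → T.QuasiUniform ρ →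
      MeshBounds T (k + 2) C₀ ∧ ∀ (ι : Type) [Fintype ι] (b : Module.Basis ι ℝ (T.feSpace Ω k)),
        (stiffnessMatrix β c ε b).PosDef ∧ ∀ x : ι → ℝ,
          x ⬝ᵥ massMatrix b *ᵥ x ≤ C₁ * (x ⬝ᵥ stiffnessMatrix β c ε b *ᵥ x) ∧
          x ⬝ᵥ stiffnessMatrix β c ε b *ᵥ x ≤ C₂ * T.h⁻¹ ^ 2 * (x ⬝ᵥ massMatrix b *ᵥ x) := by
  -- Without any triangulation there is nothing to show. With one, `Ω` is bounded, and `β` is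
  -- bounded on its compact closure.
  by_cases hex : ∃ T : Mesh d, T.Triangulates Ω
  swap
  · exact ⟨1, 1, 1, le_rfl, one_pos, one_pos, fun _ _ _ T hT => absurd ⟨T, hT⟩ hex⟩
  obtain ⟨T₀, hT₀⟩ := hex
  obtain ⟨B, hB⟩ := hT₀.isBounded.isCompact_closure.exists_bound_of_continuousOn hβc.continuousOn
  obtain ⟨B', hB'0, hB'⟩ := exists_bound_of_memLp_top hβc.c_mem
  obtain ⟨C₀, hC₀, hmesh⟩ := exists_meshBounds d hd σ ρ (k + 2)
  set H : ℝ := volume.real Ω ^ ((d : ℝ)⁻¹) with hH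
  have hH0 : 0 ≤ H := Real.rpow_nonneg measureReal_nonneg _
  set D := max B B' with hD
  have hD0 : 0 ≤ D := hB'0.trans (le_max_right _ _)
  have hβD : ∀ x ∈ closure Ω, ‖β x‖ ≤ D := fun x hx => (hB x hx).trans (le_max_left _ _)
  have hcD : ∀ᵐ x ∂(volume.restrict Ω), |c x| ≤ D := by
    filter_upwards [hB'] with x hx
    exact hx.trans (le_max_right _ _)
  obtain ⟨C₂, hC₂, hupper⟩ := exists_lsForm_le hd (k + 2) (H := H) hC₀ hD0 hβc.continuousOn hβD
    hβc.c_mem hcD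
  obtain ⟨C₁, hC₁, hlower⟩ := exists_l2Form_le hd (k + 2) hC₀ hH0 hβc hβD
  refine ⟨C₀, C₁, C₂, hC₀, hC₁, hC₂, fun ε hε hε1 T hT hσ hρ => ?_⟩
  have hne := hT.cells_nonempty hΩ
  have hM := hmesh T hne hσ hρ
  have hh := hT.h_le hne
  have hβL := memLp_beta hT hβc.continuousOn hβD
  have hlow : ∀ u ∈ T.feSpace Ω k, l2Form Ω T u u ≤ C₁ * lsForm Ω β c ε T u u := fun u hu => by
    have hu' : T.MemFESpace Ω k u := hu
    exact hlower T ε u hT hM hh hε hε1 hu'.degreeLE hu'.1.1 hu'.2.1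
  refine ⟨hM, fun ι _ b => ⟨posDef_stiffnessMatrix hT hβc.continuousOn hβL hβc.c_mem b
    fun u hu hu0 => ?_, fun x => ?_⟩⟩
  · have h1 := (l2Form_self_pos hT hu0).trans_le (hlow u hu)
    exact (pos_iff_pos_of_mul_pos h1).1 hC₁
  · rw [dotProduct_massMatrix hT, dotProduct_stiffnessMatrix hT hβc.continuousOn hβL hβc.c_mem]
    set u := b.equivFun.symm x
    have hu : T.MemFESpace Ω k (u : T.Piecewise) := u.2
    refine ⟨hlow _ u.2, ?_⟩
    have h1 := hupper T ε u hT hM hh hε hε1 hu.degreeLE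
    have h0 := hM.h_pos
    calc _ = T.h⁻¹ ^ 2 * (T.h ^ 2 * lsForm Ω β c ε T u u) := by field_simp
      _ ≤ T.h⁻¹ ^ 2 * (C₂ * l2Form Ω T u u) := by gcongr
      _ = _ := by ring

end Stiffness

end LeastSquaresFEM

end

/-! ### The two bounds of the condition number -/

theorem theorem2p3 (d : ℕ) [NeZero d] (hd : d = 2 ∨ d = 3)
    (Ω : Set (E d)) (hΩ : IsOpen Ω) (hΩ' : IsConnected Ω)
    (β : E d → E d) (c : E d → ℝ) (hβc : IsAdmissible Ω β c) (k : ℕ) (σ ρ : ℝ) :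
    (∃ C : ℝ, 0 < C ∧ ∀ ε : ℝ, 0 < ε → ε ≤ 1 →
      ∀ T : Mesh d, T.Triangulates Ω → T.ShapeRegular σ → T.QuasiUniform ρ →
      ∀ (ι : Type) [Fintype ι] [DecidableEq ι] (b : Module.Basis ι ℝ (T.feSpace Ω k)),
        (stiffnessMatrix β c ε b).PosDef ∧ (massMatrix b).PosDef ∧
        condNumber (stiffnessMatrix β c ε b) ≤ C * T.h⁻¹ ^ 2 * condNumber (massMatrix b)) ∧
    (∀ (n m : ℕ) (S : Fin n → Fin d → Poly d) (R : Fin m → Poly d) (τ : ℝ),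
      LinearIndependent ℝ S → LinearIndependent ℝ R → 0 < τ →
      ∃ C : ℝ, 0 < C ∧ ∀ ε : ℝ, 0 < ε → ε ≤ 1 →
      ∀ T : Mesh d, T.Triangulates Ω → T.ShapeRegular σ → T.QuasiUniform ρ →
      ∀ (ι : Type) [Fintype ι] [DecidableEq ι] (b : Module.Basis ι ℝ (T.feSpace Ω k)),
        IsAssembledBasis S R τ b →
        (stiffnessMatrix β c ε b).PosDef ∧
        condNumber (stiffnessMatrix β c ε b) ≤ C * T.h⁻¹ ^ 2) := by
  have hd2 : 2 ≤ d := by omega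
  obtain ⟨C₀, C₁, C₂, hC₀, hC₁, hC₂, hmain⟩ :=
    exists_stiffness_bounds hd2 hΩ'.nonempty hβc k σ ρ
  refine ⟨⟨C₂ * C₁, by positivity, fun ε hε hε1 T hT hσ hρ ι _ _ b => ?_⟩,
    fun n m S R τ hS hR hτ => ?_⟩
  · obtain ⟨hM, hb⟩ := hmain ε hε hε1 T hT hσ hρ
    obtain ⟨hA, hx⟩ := hb ι b
    have hMp := posDef_massMatrix hT b
    refine ⟨hA, hMp, ?_⟩
    refine (condNumber_le_of_equiv hA hMp hC₁.le (by positivity) (fun x => (hx x).1)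
      fun x => (hx x).2).trans_eq ?_
    ring
  · obtain ⟨C₃, hC₃, hmass⟩ := exists_mass_bounds (m' := k + 2) hS hR hτ hC₀ Ω k
    refine ⟨C₂ * C₁ * C₃ ^ 2, by positivity, fun ε hε hε1 T hT hσ hρ ι _ _ b hb => ?_⟩
    obtain ⟨hM, hbs⟩ := hmain ε hε hε1 T hT hσ hρ
    obtain ⟨hA, hx⟩ := hbs ι b
    have hm := hmass T hT hM ι b hb
    have hh := hM.h_pos
    -- The spectrum of `A` is enclosed through that of the mass matrix. The factors `h ^ d` of the
    -- two bounds cancel, and only `h⁻¹ ^ 2` remains.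
    refine ⟨hA, (condNumber_le hA (α := (T.h ^ d)⁻¹ * (C₃ * C₁))
      (μ := C₂ * T.h⁻¹ ^ 2 * (C₃ * T.h ^ d)) (by positivity) (by positivity) (fun x => ?_)
      fun x => ?_).trans_eq ?_⟩
    · rw [mul_assoc, ← div_eq_inv_mul, le_div_iff₀ (by positivity), mul_comm, mul_assoc]
      exact (hm x).1.trans (mul_le_mul_of_nonneg_left (hx x).1 hC₃.le)
    · rw [mul_assoc, mul_assoc C₃]
      exact (hx x).2.trans (mul_le_mul_of_nonneg_left (hm x).2 (by positivity))
    · field_simp
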